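/- **Trigraphs.** A *trigraph* $G$ has a finite vertex set $V(G)$, here nonempty, and a symmetric function $\phi_G:V(G)\times V(G)\to\{-1,0,1\}$ with $\phi_G(v,v)=0$ such that for all distinct $u,v,w$ at most one of $\phi_G(u,v),\phi_G(u,w)$ is $0$. Distinct $u,v$ are *strongly adjacent*, *semiadjacent* or *strongly antiadjacent* if $\phi_G(u,v)=1,0,-1$ respectively; *adjacent* means strongly adjacent or semiadjacent, and *antiadjacent* means strongly antiadjacent or semiadjacent. A graph is regarded as the trigraph with $\phi=1$ on edges and $\phi=-1$ on non-adjacent pairs of distinct vertices. $A$ is *strongly complete* (*strongly anticomplete*) to $B$ if all $a\in A$, $b\in B$ are strongly adjacent (strongly antiadjacent). A *strong clique* (*strongly stable set*) is a set of pairwise strongly adjacent (strongly antiadjacent) vertices. A vertex is *strongly simplicial* if it together with its neighbours (the vertices adjacent to it) forms a strong clique. $G$ is *claw-free* if there are no distinct $a,b,c,d$ such that $a$ is adjacent to $b,c,d$ and $b,c,d$ are pairwise antiadjacent. **Joins, twins.** $G$ admits a *$0$-join* if $V(G)$ has a partition into two nonempty sets that are strongly anticomplete to each other. $G$ admits a *pseudo-$1$-join*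 if $V(G)$ has a partition $(V_1,V_2)$ and there are $A_i\subseteq V_i$ such that $A_1\cup A_2$ is a strong clique, $V_1\setminus A_1$ is strongly anticomplete to $V_2$, $V_2\setminus A_2$ is strongly anticomplete to $V_1$, and neither $V_1$ nor $V_2$ is strongly stable. $G$ admits a *pseudo-$2$-join* if $V(G)$ has a partition $(V_0,V_1,V_2)$ and there are disjoint $A_i,B_i\subseteq V_i$ ($i=1,2$) such that $V_0\cup A_1\cup A_2$ and $V_0\cup B_1\cup B_2$ are strong cliques, all pairs of vertices from different parts that do not both lie in one of these two cliques are strongly antiadjacent, and neither $V_1$ nor $V_2$ is strongly stable. *Twins* are strongly adjacent vertices $u,v$ such that every other vertex is strongly complete or strongly anticomplete to $\{u,v\}$. A *W-join* is a pair $(A,B)$ of disjoint strong cliques such that every vertex outside $A\cup B$ is strongly complete or strongly anticomplete to $A$, and strongly complete or strongly anticomplete to $B$; $A$ is neither strongly complete nor strongly anticomplete to $B$; and $\max(|A|,|B|)\ge 2$. **Strip-structures.** A *strip-structure* $(H,\eta)$ of $G$ consists of finite sets $V(H)$ and $E(H)\neq\emptyset$, for each $F\in E(H)$ a set $\overline F\subseteq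 V(H)$ (of vertices incident with $F$) and a set $\eta(F)\subseteq V(G)$, and for each $h\in\overline F$ a set $\eta(F,h)\subseteq\eta(F)$, such that: 1. the sets $\eta(F)$ are nonempty, pairwise disjoint, and have union $V(G)$; 2. for each $h\in V(H)$, the union of the sets $\eta(F,h)$ over all $F$ with $h\in\overline F$ is a strong clique; 3. if $F_1\ne F_2$ and $v_1\in\eta(F_1)$, $v_2\in\eta(F_2)$ are adjacent, then some $h\in\overline{F_1}\cap\overline{F_2}$ satisfies $v_1\in\eta(F_1,h)$ and $v_2\in\eta(F_2,h)$; 4. for each $F$, the family $\eta(F,h)$ ($h\in\overline F$) is a *circus* in $\eta(F)$: for $x\in\eta(F,h)$ the neighbours of $x$ in $\eta(F)\setminus\eta(F,h)$ form a strong clique; for distinct $h,h'$, $\eta(F,h)\cap\eta(F,h')$ is strongly anticomplete to $\eta(F)\setminus(\eta(F,h)\cup\eta(F,h'))$; and $\eta(F,h)\cap\eta(F,h')\cap\eta(F,h'')=\emptyset$ for distinct $h,h',h''$. The *nullity* of $(H,\eta)$ is the number of pairs $(F,h)$ with $h\in\overline F$ and $\eta(F,h)=\emptyset$. $(H,\eta)$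 is *purified* if for every $F$ either the sets $\eta(F,h)$ ($h\in\overline F$) are pairwise disjoint, or $\overline F=\{h_1,h_2\}$, $|\eta(F)|=1$ and $\eta(F,h_1)=\eta(F,h_2)=\eta(F)$. The *strip* of $F$ is $(J,Z)$, where $J$ is obtained from the trigraph induced on $\eta(F)$ by adding, for each $h\in\overline F$, a new vertex $z_h$ strongly complete to $\eta(F,h)$ and strongly antiadjacent to all other vertices of $J$, and $Z=\{z_h : h\in\overline F\}$. **Strips.** $(J,Z)$ is a *spot* if $V(J)$ consists of three vertices $v,z_1,z_2$, where $v$ is strongly adjacent to $z_1,z_2$, and $z_1,z_2$ are strongly antiadjacent, and $Z=\{z_1,z_2\}$. $(J,Z)$ is a *stripe* if $J$ is claw-free, $Z\subseteq V(J)$ is a strongly stable set of strongly simplicial vertices, and no vertex outside $Z$ is adjacent to more than one vertex of $Z$. A stripe $(J,Z)$ is *almost-unbreakable* if $J$ admits no $0$-join, no pseudo-$1$-join and no pseudo-$2$-join, there are no twins $u,v\in V(J)\setminus Z$, and there is no W-join $(A,B)$ in $J$ with $A\cap Z=B\cap Z=\emptyset$. A stripe $(J,Z)$ is a *thickening* of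 a stripe $(J',Z')$ if $V(J)$ is partitioned into nonempty strong cliques $X_v$ ($v\in V(J')$) such that $X_u$ is strongly complete to $X_v$ if $u,v$ are strongly adjacent in $J'$, strongly anticomplete to $X_v$ if $u,v$ are strongly antiadjacent, and neither if $u,v$ are semiadjacent; moreover $|X_z|=1$ for all $z\in Z'$ and $Z=\bigcup_{z\in Z'}X_z$. **Theorem.** Every claw-free trigraph $G$ (with nonempty vertex set) admits a purified strip-structure of nullity zero in which every strip is a spot or a thickening of an almost-unbreakable stripe. Moreover, such a strip-structure can be found in polynomial time if $G$ is a graph: there are a program for a random access machine with logarithmic costs and a polynomial $B$ such that for every $n\ge 1$ and every claw-free graph $G$ on the vertex set $\{0,\dots,n-1\}$, the program, given $n$ and the adjacency matrix of $G$, halts within time $B(n)$ and prints such a strip-structure $(H,\eta)$ of $G$ with $V(H)=\{0,\dots,p-1\}$ and $E(H)=\{0,\dots,q-1\}$ for some $p,q$: the numbers $p$ and $q$ followed by the $0/1$-tables of the incidence relation, of the sets $\eta(F)$, and of the sets $\eta(F,h)$. -/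

import Mathlib

/-- A trigraph with vertex set `V`: an adjacency function with values `-1, 0, 1`. -/
structure Trigraph (V : Type*) where
  φ : V → V → SignType
  diag : ∀ v, φ v v = 0
  symm : ∀ u v, φ u v = φ v u
  matching : ∀ u v w, u ≠ v → u ≠ w → v ≠ w → ¬ (φ u v = 0 ∧ φ u w = 0)

namespace Trigraph

variable {V U : Type*}

/-- Strongly adjacent (such vertices are distinct, as `φ v v = 0`). -/
def SAdj (G : Trigraph V) (u v : V) : Prop := G.φ u v = 1

/-- Strongly antiadjacent (such vertices are distinct, as `φ v v = 0`). -/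
def SAnti (G : Trigraph V) (u v : V) : Prop := G.φ u v = -1

/-- Semiadjacent. -/
def Semi (G : Trigraph V) (u v : V) : Prop := u ≠ v ∧ G.φ u v = 0

/-- Adjacent: strongly adjacent or semiadjacent. -/
def Adj (G : Trigraph V) (u v : V) : Prop := G.SAdj u v ∨ G.Semi u v

/-- Antiadjacent: strongly antiadjacent or semiadjacent. -/
def Anti (G : Trigraph V) (u v : V) : Prop := G.SAnti u v ∨ G.Semi u v

/-- Every vertex of `A` is strongly adjacent to every vertex of `B`. -/
def SComplete (G : Trigraph V) (A B : Set V) : Prop := ∀ a ∈ A, ∀ b ∈ B, G.SAdj a b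

/-- Every vertex of `A` is strongly antiadjacent to every vertex of `B`. -/
def SAnticomplete (G : Trigraph V) (A B : Set V) : Prop := ∀ a ∈ A, ∀ b ∈ B, G.SAnti a b

def StrongClique (G : Trigraph V) (X : Set V) : Prop := X.Pairwise G.SAdj

def StronglyStable (G : Trigraph V) (X : Set V) : Prop := X.Pairwise G.SAnti

/-- The closed neighbourhood of `v` is a strong clique. -/
def StronglySimplicial (G : Trigraph V) (v : V) : Prop :=
  G.StrongClique (insert v {u | G.Adj v u})

/-- No four vertices `a, b, c, d` with `{b, c, d}` stable and complete to `a`. -/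
def ClawFree (G : Trigraph V) : Prop :=
  ∀ a b c d : V, ¬ (G.Adj a b ∧ G.Adj a c ∧ G.Adj a d ∧ G.Anti b c ∧ G.Anti b d ∧ G.Anti c d)

open Classical in
/-- A graph regarded as a trigraph. -/
noncomputable def ofGraph (G : SimpleGraph V) : Trigraph V where
  φ u v := if u = v then 0 else if G.Adj u v then 1 else -1
  diag v := by simp
  symm u v := by simp only [eq_comm, G.adj_comm]
  matching u v w huv huw _ := by
    rintro ⟨h, -⟩
    rw [if_neg huv] at h
    split_ifs at h

/-- `V₁, V₂` partition the vertex set into two (possibly empty) parts. -/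
def IsBipartition (V₁ V₂ : Set V) : Prop := Disjoint V₁ V₂ ∧ V₁ ∪ V₂ = Set.univ

def HasZeroJoin (G : Trigraph V) : Prop :=
  ∃ V₁ V₂ : Set V, IsBipartition V₁ V₂ ∧ G.SAnticomplete V₁ V₂ ∧ V₁.Nonempty ∧ V₂.Nonempty

def HasPseudoOneJoin (G : Trigraph V) : Prop :=
  ∃ V₁ V₂ A₁ A₂ : Set V, IsBipartition V₁ V₂ ∧ A₁ ⊆ V₁ ∧ A₂ ⊆ V₂ ∧
    G.StrongClique (A₁ ∪ A₂) ∧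
    G.SAnticomplete (V₁ \ A₁) V₂ ∧ G.SAnticomplete (V₂ \ A₂) V₁ ∧
    ¬ G.StronglyStable V₁ ∧ ¬ G.StronglyStable V₂

def HasPseudoTwoJoin (G : Trigraph V) : Prop :=
  ∃ V₀ V₁ V₂ A₁ A₂ B₁ B₂ : Set V,
    Disjoint V₀ V₁ ∧ Disjoint V₀ V₂ ∧ Disjoint V₁ V₂ ∧ V₀ ∪ V₁ ∪ V₂ = Set.univ ∧
    A₁ ⊆ V₁ ∧ B₁ ⊆ V₁ ∧ Disjoint A₁ B₁ ∧ A₂ ⊆ V₂ ∧ B₂ ⊆ V₂ ∧ Disjoint A₂ B₂ ∧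
    G.StrongClique (V₀ ∪ A₁ ∪ A₂) ∧ G.StrongClique (V₀ ∪ B₁ ∪ B₂) ∧
    -- apart from these two cliques, the three parts are pairwise strongly anticomplete
    (∀ x ∈ V₀, ∀ y ∈ V₁ \ (A₁ ∪ B₁), G.SAnti x y) ∧
    (∀ x ∈ V₀, ∀ y ∈ V₂ \ (A₂ ∪ B₂), G.SAnti x y) ∧
    (∀ x ∈ V₁, ∀ y ∈ V₂, ¬ (x ∈ A₁ ∧ y ∈ A₂) → ¬ (x ∈ B₁ ∧ y ∈ B₂) → G.SAnti x y) ∧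
    ¬ G.StronglyStable V₁ ∧ ¬ G.StronglyStable V₂

/-- `{u, v}` is a homogeneous strong clique of size two. -/
def IsTwins (G : Trigraph V) (u v : V) : Prop :=
  G.SAdj u v ∧ ∀ w, w ≠ u → w ≠ v → (G.SAdj w u ∧ G.SAdj w v) ∨ (G.SAnti w u ∧ G.SAnti w v)

def IsHomogeneousPair (G : Trigraph V) (A B : Set V) : Prop :=
  Disjoint A B ∧ G.StrongClique A ∧ G.StrongClique B ∧
    ∀ v, v ∉ A ∪ B → (G.SComplete {v} A ∨ G.SAnticomplete {v} A) ∧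
      (G.SComplete {v} B ∨ G.SAnticomplete {v} B)

def IsWJoin (G : Trigraph V) (A B : Set V) : Prop :=
  G.IsHomogeneousPair A B ∧ ¬ G.SComplete A B ∧ ¬ G.SAnticomplete A B ∧
    (A.Nontrivial ∨ B.Nontrivial)

/-- The sets `X v` witness that `G` is a thickening of `G'`. -/
def IsThickeningVia (G : Trigraph V) (G' : Trigraph U) (X : U → Set V) : Prop :=
  (∀ v, (X v).Nonempty) ∧ Pairwise (Function.onFun Disjoint X) ∧ (⋃ v, X v) = Set.univ ∧
  (∀ v, G.StrongClique (X v)) ∧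
  (∀ u v, G'.SAdj u v → G.SComplete (X u) (X v)) ∧
  (∀ u v, G'.SAnti u v → G.SAnticomplete (X u) (X v)) ∧
  (∀ u v, G'.Semi u v → ¬ G.SComplete (X u) (X v) ∧ ¬ G.SAnticomplete (X u) (X v))

def IsSpot (J : Trigraph V) (Z : Set V) : Prop :=
  ∃ v z₁ z₂ : V, (Set.univ : Set V) = {v, z₁, z₂} ∧ J.SAdj v z₁ ∧ J.SAdj v z₂ ∧
    J.SAnti z₁ z₂ ∧ Z = {z₁, z₂}

def IsStripe (J : Trigraph V) (Z : Set V) : Prop :=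
  J.ClawFree ∧ (∀ z ∈ Z, J.StronglySimplicial z) ∧ J.StronglyStable Z ∧
    ∀ v, v ∉ Z → ∀ z ∈ Z, ∀ z' ∈ Z, J.Adj v z → J.Adj v z' → z = z'

/-- The stripe `(J, Z)` is a thickening of the stripe `(J', Z')`. -/
def IsStripeThickening (J : Trigraph V) (Z : Set V) (J' : Trigraph U) (Z' : Set U) : Prop :=
  J.IsStripe Z ∧ J'.IsStripe Z' ∧
    ∃ X : U → Set V, J.IsThickeningVia J' X ∧ (∀ z ∈ Z', ∃ v, X z = {v}) ∧ Z = ⋃ z ∈ Z', X z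

def IsAlmostUnbreakable (J : Trigraph V) (Z : Set V) : Prop :=
  J.IsStripe Z ∧ ¬ J.HasZeroJoin ∧ ¬ J.HasPseudoOneJoin ∧ ¬ J.HasPseudoTwoJoin ∧
    (¬ ∃ u v, u ∉ Z ∧ v ∉ Z ∧ J.IsTwins u v) ∧
    (¬ ∃ A B : Set V, J.IsWJoin A B ∧ Disjoint Z A ∧ Disjoint Z B)

/-- `(J, Z)` is a thickening of some (finite) almost-unbreakable stripe. -/
def IsThickeningOfAlmostUnbreakable (J : Trigraph V) (Z : Set V) : Prop :=
  ∃ (T : Type) (_ : Finite T) (J' : Trigraph T) (Z' : Set T),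
    J'.IsAlmostUnbreakable Z' ∧ J.IsStripeThickening Z J' Z'

/-- The family `X i`, `i ∈ I`, of subsets of `Y` is a circus in `Y`. -/
def IsCircus (G : Trigraph V) {ι : Type*} (I : Set ι) (X : ι → Set V) (Y : Set V) : Prop :=
  (∀ i ∈ I, ∀ x ∈ X i, G.StrongClique {y | y ∈ Y \ X i ∧ G.Adj x y}) ∧
  (∀ i ∈ I, ∀ j ∈ I, i ≠ j → G.SAnticomplete (X i ∩ X j) (Y \ (X i ∪ X j))) ∧
  (∀ h ∈ I, ∀ i ∈ I, ∀ j ∈ I, h ≠ i → h ≠ j → i ≠ j → X h ∩ X i ∩ X j = ∅)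

end Trigraph

/-- A strip-structure `(H, η)` of a trigraph `G`, where the strip-graph `H` has vertex set `W` and
edge set `E` (both meant to be finite). The value `att F h` matters only for `h` incident
with `F`. -/
structure StripStructure {V : Type*} (G : Trigraph V) (W E : Type) where
  /-- the set of vertices of the strip-graph that are incident with an edge -/
  ends : E → Set W
  /-- the set `η(F)` -/
  part : E → Set V
  /-- the set `η(F, h)` -/
  att : E → W → Set V
  edges_nonempty : Nonempty E
  att_subset : ∀ F, ∀ h ∈ ends F, att F h ⊆ part F
  part_nonempty : ∀ F, (part F).Nonempty
  part_disjoint : Pairwise (Function.onFun Disjoint part)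
  part_cover : (⋃ F, part F) = Set.univ
  clique : ∀ h, G.StrongClique {v | ∃ F, h ∈ ends F ∧ v ∈ att F h}
  adj : ∀ F₁ F₂, F₁ ≠ F₂ → ∀ v₁ ∈ part F₁, ∀ v₂ ∈ part F₂, G.Adj v₁ v₂ →
    ∃ h ∈ ends F₁ ∩ ends F₂, v₁ ∈ att F₁ h ∧ v₂ ∈ att F₂ h
  circus : ∀ F, G.IsCircus (ends F) (att F) (part F)

namespace StripStructure

variable {V : Type*} {G : Trigraph V} {W E : Type}

open Classical in
/-- The trigraph of the strip corresponding to `F`: the trigraph induced on `η(F)` together with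
one new vertex for every `h` incident with `F`. -/
noncomputable def strip (S : StripStructure G W E) (F : E) : Trigraph (S.part F ⊕ S.ends F) where
  φ
    | .inl u, .inl v => G.φ u v
    | .inl u, .inr h => if (u : V) ∈ S.att F h then 1 else -1
    | .inr h, .inl u => if (u : V) ∈ S.att F h then 1 else -1
    | .inr h, .inr k => if h = k then 0 else -1
  diag := by rintro (v | h) <;> simp [G.diag]
  symm := by rintro (u | h) (v | k) <;> simp [G.symm, eq_comm]
  matching := by
    rintro (u | h) (v | k) (w | l) h₁ h₂ h₃ ⟨h₄, h₅⟩
    · exact G.matching u v w (fun e => h₁ (congrArg _ (Subtype.ext e)))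
        (fun e => h₂ (congrArg _ (Subtype.ext e))) (fun e => h₃ (congrArg _ (Subtype.ext e)))
        ⟨h₄, h₅⟩
    all_goals
      dsimp only at h₄ h₅
      split_ifs at h₄ h₅ <;> simp_all

/-- The set `Z` of new vertices of the strip corresponding to `F`. -/
def stripEnds (S : StripStructure G W E) (F : E) : Set (S.part F ⊕ S.ends F) := Set.range Sum.inr

/-- The number of incident pairs `(F, h)` with `η(F, h) = ∅`. -/
noncomputable def nullity (S : StripStructure G W E) : ℕ :=
  {x : E × W | x.2 ∈ S.ends x.1 ∧ S.att x.1 x.2 = ∅}.ncard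

def Purified (S : StripStructure G W E) : Prop :=
  ∀ F, (S.ends F).PairwiseDisjoint (S.att F) ∨
    ∃ h₁ h₂, h₁ ≠ h₂ ∧ S.ends F = {h₁, h₂} ∧ (∃ v, S.part F = {v}) ∧
      S.att F h₁ = S.part F ∧ S.att F h₂ = S.part F

/-- Every strip is a spot or a thickening of an almost-unbreakable stripe. -/
def StripsAreBasic (S : StripStructure G W E) : Prop :=
  ∀ F, (S.strip F).IsSpot (S.stripEnds F) ∨
    (S.strip F).IsThickeningOfAlmostUnbreakable (S.stripEnds F)

open Classical in
/-- A strip-structure of a trigraph on `{0, …, n - 1}`, written down as a list of numbers: `|V(H)|`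
and `|E(H)|`, followed by the 0/1-tables of the incidence relation, of `η(F)`, and
of `η(F, h)`. -/
noncomputable def code {n p q : ℕ} {G : Trigraph (Fin n)}
    (S : StripStructure G (Fin p) (Fin q)) : List ℕ :=
  [p, q] ++
  ((List.finRange q).flatMap fun F => (List.finRange p).map fun h =>
    if h ∈ S.ends F then 1 else 0) ++
  ((List.finRange q).flatMap fun F => (List.finRange n).map fun v =>
    if v ∈ S.part F then 1 else 0) ++
  ((List.finRange q).flatMap fun F => (List.finRange p).flatMap fun h =>
    (List.finRange n).map fun v => if v ∈ S.att F h then 1 else 0)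

end StripStructure

open Classical in
/-- A graph on `{0, …, n - 1}`, written down as a list of numbers: `n`, followed by the rows of its
adjacency matrix. -/
noncomputable def SimpleGraph.code {n : ℕ} (G : SimpleGraph (Fin n)) : List ℕ :=
  n :: (List.finRange n).flatMap fun i => (List.finRange n).map fun j =>
    if G.Adj i j then 1 else 0

/-! ### Random access machines with logarithmic cost -/

namespace RAM

/-- A memory consists of arrays `0, 1, 2, …` of natural numbers (a program names only finitely
many of them); `out` is the list of numbers printed so far. -/
structure State where
  mem : ℕ → ℕ → ℕ
  out : List ℕ

/-- `load a e` is the entry with index `e` of the array `a`; subtraction is truncated. -/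
inductive Expr where
  | const (k : ℕ)
  | load (a : ℕ) (e : Expr)
  | add (e f : Expr)
  | sub (e f : Expr)
  | mul (e f : Expr)

def Expr.eval (s : State) : Expr → ℕ
  | .const k => k
  | .load a e => s.mem a (e.eval s)
  | .add e f => e.eval s + f.eval s
  | .sub e f => e.eval s - f.eval s
  | .mul e f => e.eval s * f.eval s

/-- The logarithmic cost of evaluating an expression: every number that occurs (constants,
addresses, contents of memory cells, results of operations) is charged one plus the number of its
binary digits. -/
def Expr.cost (s : State) : Expr → ℕ
  | .const k => k.size + 1
  | .load a e => e.cost s + (s.mem a (e.eval s)).size + 1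
  | .add e f => e.cost s + f.cost s + (e.eval s + f.eval s).size + 1
  | .sub e f => e.cost s + f.cost s + (e.eval s - f.eval s).size + 1
  | .mul e f => e.cost s + f.cost s + (e.eval s * f.eval s).size + 1

/-- Programs. `store a i e` writes the value of `e` to the entry with index `i` of the array `a`,
`emit e` prints the value of `e`, and a test succeeds when its value is nonzero. -/
inductive Prog where
  | nop
  | store (a : ℕ) (i e : Expr)
  | emit (e : Expr)
  | seq (P Q : Prog)
  | cond (e : Expr) (P Q : Prog)
  | loop (e : Expr) (P : Prog)

/-- `Run P s s' t`: started in the state `s`, the program `P` halts in the state `s'` after time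
`t` (with logarithmic costs). -/
inductive Run : Prog → State → State → ℕ → Prop
  | nop (s) : Run .nop s s 1
  | store (s a i e) : Run (.store a i e) s
      { s with mem := Function.update s.mem a
                (Function.update (s.mem a) (Expr.eval s i) (Expr.eval s e)) }
      (Expr.cost s i + Expr.cost s e + 1)
  | emit (s e) : Run (.emit e) s { s with out := s.out ++ [Expr.eval s e] } (Expr.cost s e + 1)
  | seq {P Q s s' s'' t t'} : Run P s s' t → Run Q s' s'' t' → Run (.seq P Q) s s'' (t + t' + 1)
  | cond_true {e P Q s s' t} : Expr.eval s e ≠ 0 → Run P s s' t →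
      Run (.cond e P Q) s s' (Expr.cost s e + t + 1)
  | cond_false {e P Q s s' t} : Expr.eval s e = 0 → Run Q s s' t →
      Run (.cond e P Q) s s' (Expr.cost s e + t + 1)
  | loop_true {e P s s' s'' t t'} : Expr.eval s e ≠ 0 → Run P s s' t →
      Run (.loop e P) s' s'' t' → Run (.loop e P) s s'' (Expr.cost s e + t + t' + 1)
  | loop_false {e P s} : Expr.eval s e = 0 → Run (.loop e P) s s (Expr.cost s e + 1)

/-- Initially the array `0` holds the input and all other cells hold `0`. -/
def init (input : List ℕ) : State where
  mem a i := if a = 0 then input.getD i 0 else 0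
  out := []

/-- Given `input`, the program `P` halts within time `T`, having printed `output`. -/
def Computes (P : Prog) (input output : List ℕ) (T : ℕ) : Prop :=
  ∃ s t, Run P (init input) s t ∧ s.out = output ∧ t ≤ T

end RAM

/-! A purified strip-structure of nullity zero amounts to a partition of the vertices together with
cliques that link its parts: a `Linkage` that is `Valid`. The proof starts with one part and no
cliques and refines for as long as possible. A `Split` is the common form of 0-joins, pseudo-1-joins
and pseudo-2-joins: two sides `P` and `Q` and the centre `C ∩ E`, where all adjacencies between the
three belong to one of the cliques `C`, `E`. If a strip has a split with a non-terminal vertex on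
both sides, its part is cut along it: `C` and `E` become linking cliques, and every vertex that now
lies in two linking cliques becomes a part of its own, whose strip is a spot. A clique containing an
old terminal is covered by the linking clique of that terminal; any other one is indexed by `(a₁,
a₂)`, an index that is free because `a₁` and `a₂` were in one part before.

Claw-freeness makes this work. A vertex of `C` on the side `P` has the neighbour `a₂` across, so its
neighbours on its own side outside `C` cannot be antiadjacent (`Split.sAdj_of_adj`,
`Split.mem_or_not_anti`). This yields the circus condition and shows that the edges at a split-off
vertex are linked (`Linkage.Refinable.refine_valid`). Pairs in a common part get fewer
(`Linkage.Refinable.measure_lt`), so some valid linkage is `Stuck`.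

In a stuck linkage every strip that is not a spot is a stripe without joins, since each join would
give a split. Among the contractions of such a stripe, take a smallest one: twins or a W-join would
allow a further contraction, and joins of the contraction pull back to the strip. Hence the
contraction is almost-unbreakable (`IsStripe.isThickeningOfAlmostUnbreakable`).

For graphs a split is found from six vertices: a nonempty `C` is the common closed neighbourhood of
`a₁` and `a₂`, likewise `E`, and `P` may be shrunk to what can be reached from `a₁`, `b₁` and a
given vertex `u` without entering the centre or using edges inside `C` or `E`; the sixth vertex `t`
must stay outside. Trying all six-tuples in `n + n²` sweeps suffices, as every successful sweep
lowers a measure that is at most `n²`. All tests and updates are first-order over the `n + n²`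
vertices and possible terminals, so the algorithm is written with formulas and bounded loops, and
`Cmd.exists_computes` translates every such program into a polynomial-time machine. -/

/-! ### A first-order programming language on top of random access machines -/

namespace RAM

/-- The size of the domain over which the variables of formulas range. -/
abbrev width (n : ℕ) : ℕ := n + n * n

open Classical in
/-- The truth value of a proposition. -/
noncomputable def bit (p : Prop) : ℕ := if p then 1 else 0

theorem bit_ne_zero {p : Prop} : bit p ≠ 0 ↔ p := by simp [bit]

theorem bit_le_one (p : Prop) : bit p ≤ 1 := by
  unfold bit
  split_ifs <;> omega

/-- The contents of the binary relations `0, 1, 2, …`. -/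
abbrev Interp := ℕ → ℕ → ℕ → Prop

/-- First-order formulas; in the scope of `k` quantifiers, `ex` binds the variable `k`. -/
inductive Fm where
  | rel (a i j : ℕ)
  | eq (i j : ℕ)
  | lt (i j : ℕ)
  | real (i : ℕ)
  | code (z x y : ℕ)
  | inp (x y : ℕ)
  | not (φ : Fm)
  | and (φ ψ : Fm)
  | ex (φ : Fm)

namespace Fm

def Holds (n : ℕ) (inp : ℕ → Prop) : Fm → ℕ → (ℕ → ℕ) → Interp → Prop
  | rel a i j, _, ρ, I => I a (ρ i) (ρ j)
  | eq i j, _, ρ, _ => ρ i = ρ j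
  | lt i j, _, ρ, _ => ρ i < ρ j
  | real i, _, ρ, _ => ρ i < n
  | code z x y, _, ρ, _ => ρ z = n + (n * ρ x + ρ y)
  | .inp x y, _, ρ, _ => inp (1 + (n * ρ x + ρ y))
  | not φ, k, ρ, I => ¬ φ.Holds n inp k ρ I
  | and φ ψ, k, ρ, I => φ.Holds n inp k ρ I ∧ ψ.Holds n inp k ρ I
  | ex φ, k, ρ, I => ∃ v < width n, φ.Holds n inp (k + 1) (Function.update ρ k v) I

/-- All variables of the formula are below `k` or bound. -/
def closedAt : Fm → ℕ → Bool
  | rel _ i j, k => i < k && j < k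
  | eq i j, k => i < k && j < k
  | lt i j, k => i < k && j < k
  | real i, k => i < k
  | code z x y, k => z < k && x < k && y < k
  | inp x y, k => x < k && y < k
  | not φ, k => φ.closedAt k
  | and φ ψ, k => φ.closedAt k && ψ.closedAt k
  | ex φ, k => φ.closedAt (k + 1)

/-- The formula does not mention the relation `b`. -/
def avoids (b : ℕ) : Fm → Bool
  | rel a _ _ => a != b
  | not φ => φ.avoids b
  | and φ ψ => φ.avoids b && ψ.avoids b
  | ex φ => φ.avoids b
  | _ => true

/-- Makes it safe to overwrite a relation cell by cell while the defining formula is still being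
evaluated for later cells. -/
theorem holds_congr {n : ℕ} {inp : ℕ → Prop} (b : ℕ) (φ : Fm) (hφ : φ.avoids b) {k : ℕ} {ρ : ℕ → ℕ}
    {I I' : Interp} (h : ∀ a, a ≠ b → I a = I' a) :
    φ.Holds n inp k ρ I ↔ φ.Holds n inp k ρ I' := by
  induction φ generalizing k ρ <;> simp_all [Holds, avoids]

end Fm

/-- Commands; in the scope of `k` loops, `loop` binds the variable `k`, and `fill` binds the
variables `k` and `k + 1`. -/
inductive Cmd where
  | nop
  | fill (a : ℕ) (φ : Fm)
  | seq (c d : Cmd)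
  | ite (φ : Fm) (c d : Cmd)
  | loop (c : Cmd)
  | emit (φ : Fm)
  | count (φ : Fm)

namespace Cmd

open Classical in
/-- The effect of a command on the relations and on the list of numbers printed so far. -/
noncomputable def exec (n : ℕ) (inp : ℕ → Prop) :
    Cmd → ℕ → (ℕ → ℕ) → Interp × List ℕ → Interp × List ℕ
  | nop, _, _, p => p
  | fill a φ, k, ρ, p => (Function.update p.1 a fun x y =>
      φ.Holds n inp (k + 2) (Function.update (Function.update ρ k x) (k + 1) y) p.1, p.2)
  | seq c d, k, ρ, p => d.exec n inp k ρ (c.exec n inp k ρ p)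
  | ite φ c d, k, ρ, p => if φ.Holds n inp k ρ p.1 then c.exec n inp k ρ p else d.exec n inp k ρ p
  | loop c, k, ρ, p =>
      (List.range (width n)).foldl (fun p i => c.exec n inp (k + 1) (Function.update ρ k i) p) p
  | emit φ, k, ρ, p => (p.1, p.2 ++ [bit (φ.Holds n inp k ρ p.1)])
  | count φ, k, ρ, p => (p.1, p.2 ++ [(List.range (width n)).countP fun i =>
      φ.Holds n inp (k + 1) (Function.update ρ k i) p.1])

def closedAt : Cmd → ℕ → Bool
  | nop, _ => true
  | fill a φ, k => φ.closedAt (k + 2) && φ.avoids a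
  | seq c d, k => c.closedAt k && d.closedAt k
  | ite φ c d, k => φ.closedAt k && c.closedAt k && d.closedAt k
  | loop c, k => c.closedAt (k + 1)
  | emit φ, k => φ.closedAt k
  | count φ, k => φ.closedAt (k + 1)

end Cmd

/-! ### Compilation -/

/-- Memory layout: array 0 is the input, array 1 the variables, array 2 the flags holding truth
values and counters, and array `a + 3` the relation `a`, stored row by row. -/
def varE (i : ℕ) : Expr := .load 1 (.const i)

def flagE (i : ℕ) : Expr := .load 2 (.const i)

def sizeE : Expr := .load 0 (.const 0)

def widthE : Expr := .add sizeE (.mul sizeE sizeE)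

/-- Truncated subtraction turns every nonzero value into 1. -/
def boolE (e : Expr) : Expr := .sub (.const 1) (.sub (.const 1) e)

def eqE (e f : Expr) : Expr := .sub (.const 1) (.add (.sub e f) (.sub f e))

def pairE (i j : ℕ) : Expr := .add (.mul (varE i) widthE) (varE j)

def setFlag (d : ℕ) (e : Expr) : Prog := .store 2 (.const d) e

/-- The guard is a truncated difference, which vanishes once the counter has reached the width. -/
def loopP (k : ℕ) (P : Prog) : Prog :=
  .seq (.store 1 (.const k) (.const 0))
    (.loop (.sub widthE (varE k)) (.seq P (.store 1 (.const k) (.add (varE k) (.const 1)))))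

/-- The flags form a stack: the result goes to flag `d`, and subformulas evaluated while `d` is in
use work from `d + 1` on. -/
def Fm.comp : Fm → ℕ → ℕ → Prog
  | rel a i j, _, d => setFlag d (boolE (.load (a + 3) (pairE i j)))
  | eq i j, _, d => setFlag d (eqE (varE i) (varE j))
  | lt i j, _, d => setFlag d (boolE (.sub (varE j) (varE i)))
  | real i, _, d => setFlag d (boolE (.sub sizeE (varE i)))
  | code z x y, _, d =>
      setFlag d (eqE (varE z) (.add sizeE (.add (.mul sizeE (varE x)) (varE y))))
  | inp x y, _, d => setFlag d
      (boolE (.load 0 (.add (.const 1) (.add (.mul sizeE (varE x)) (varE y)))))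
  | not φ, k, d => .seq (φ.comp k d) (setFlag d (.sub (.const 1) (flagE d)))
  | and φ ψ, k, d => .seq (φ.comp k d) (.seq (ψ.comp k (d + 1))
      (setFlag d (boolE (.mul (flagE d) (flagE (d + 1))))))
  | ex φ, k, d => .seq (setFlag d (.const 0)) (loopP k (.seq (φ.comp (k + 1) (d + 1))
      (setFlag d (boolE (.add (flagE d) (flagE (d + 1)))))))

def Cmd.comp : Cmd → ℕ → Prog
  | nop, _ => .nop
  | fill a φ, k => loopP k (loopP (k + 1)
      (.seq (φ.comp (k + 2) 0) (.store (a + 3) (pairE k (k + 1)) (boolE (flagE 0)))))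
  | seq c d, k => .seq (c.comp k) (d.comp k)
  | ite φ c d, k => .seq (φ.comp k 0) (.cond (flagE 0) (c.comp k) (d.comp k))
  | loop c, k => loopP k (c.comp (k + 1))
  | emit φ, k => .seq (φ.comp k 0) (.emit (flagE 0))
  | count φ, k => .seq (.seq (setFlag 0 (.const 0)) (loopP k (.seq (φ.comp (k + 1) 1)
      (setFlag 0 (.add (flagE 0) (flagE 1)))))) (.emit (flagE 0))

/-! ### Costs of expressions -/

/-- All numbers in the memory are at most `width n + 1`. -/
def Bounded (n : ℕ) (s : State) : Prop := ∀ a i, s.mem a i ≤ width n + 1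

open Polynomial in
-- Bounding the number of digits of a number by the number itself is wasteful but harmless, because
-- all values are polynomial in `n`. Value and cost are bounded together since the cost of an
-- operation depends on the value of its result.
theorem Expr.exists_bound (e : Expr) : ∃ B : Polynomial ℕ, ∀ n s, Bounded n s →
    e.eval s ≤ B.eval n ∧ e.cost s ≤ B.eval n := by
  have size_le (m : ℕ) : m.size ≤ m := Nat.size_le.2 Nat.lt_two_pow_self
  induction e with
  | const k =>
    refine ⟨C (k + 1), fun n s _ => ?_⟩
    simp [Expr.eval, Expr.cost, size_le]
  | load a e ih =>
    obtain ⟨B, hB⟩ := ih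
    refine ⟨B + (X + X * X + 2), fun n s hs => ?_⟩
    have h1 := hs a (e.eval s)
    have h2 := size_le (s.mem a (e.eval s))
    have h3 := hB n s hs
    simp only [Expr.eval, Expr.cost, eval_add, eval_X, eval_mul, eval_ofNat]
    simp only [width] at h1
    omega
  | add e f ihe ihf =>
    obtain ⟨B, hB⟩ := ihe
    obtain ⟨B', hB'⟩ := ihf
    refine ⟨2 * B + 2 * B' + 1, fun n s hs => ?_⟩
    have h2 := size_le (e.eval s + f.eval s)
    have h3 := hB n s hs
    have h4 := hB' n s hs
    simp only [Expr.eval, Expr.cost, eval_add, eval_one, eval_mul, eval_ofNat]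
    omega
  | sub e f ihe ihf =>
    obtain ⟨B, hB⟩ := ihe
    obtain ⟨B', hB'⟩ := ihf
    refine ⟨2 * B + 2 * B' + 1, fun n s hs => ?_⟩
    have h2 := size_le (e.eval s - f.eval s)
    have h3 := hB n s hs
    have h4 := hB' n s hs
    simp only [Expr.eval, Expr.cost, eval_add, eval_one, eval_mul, eval_ofNat]
    omega
  | mul e f ihe ihf =>
    obtain ⟨B, hB⟩ := ihe
    obtain ⟨B', hB'⟩ := ihf
    refine ⟨B + B' + B * B' + 1, fun n s hs => ?_⟩
    have h2 := size_le (e.eval s * f.eval s)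
    have h3 := hB n s hs
    have h4 := hB' n s hs
    have h5 := Nat.mul_le_mul h3.1 h4.1
    simp only [Expr.eval, Expr.cost, eval_add, eval_one, eval_mul]
    omega

theorem Expr.exists_cost_bound (e : Expr) : ∃ B : Polynomial ℕ, ∀ n s, Bounded n s →
    e.cost s ≤ B.eval n :=
  e.exists_bound.imp fun _ h n s hs => (h n s hs).2

/-! ### Total correctness with time bounds -/

def State.set (s : State) (a i v : ℕ) : State :=
  { s with mem := Function.update s.mem a (Function.update (s.mem a) i v) }

theorem State.set_mem (s : State) (a i v b j : ℕ) :
    (s.set a i v).mem b j = if b = a ∧ j = i then v else s.mem b j := by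
  by_cases hb : b = a
  · subst hb
    by_cases hj : j = i <;> simp [State.set, hj]
  · simp [State.set, hb]

@[simp] theorem State.set_out (s : State) (a i v : ℕ) : (s.set a i v).out = s.out := rfl

/-- Started in `s`, the program halts within time `T` in a state satisfying `Q`. -/
def RunsIn (P : Prog) (s : State) (T : ℕ) (Q : State → Prop) : Prop :=
  ∃ s' t, Run P s s' t ∧ t ≤ T ∧ Q s'

theorem RunsIn.imp {P : Prog} {s : State} {T T' : ℕ} {Q Q' : State → Prop} (h : RunsIn P s T Q)
    (hT : T ≤ T') (hQ : ∀ s', Q s' → Q' s') : RunsIn P s T' Q' :=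
  let ⟨s', t, h1, h2, h3⟩ := h
  ⟨s', t, h1, h2.trans hT, hQ _ h3⟩

theorem RunsIn.seq {P P' : Prog} {s : State} {T T' : ℕ} {Q Q' : State → Prop} (h : RunsIn P s T Q)
    (h' : ∀ s', Q s' → RunsIn P' s' T' Q') : RunsIn (.seq P P') s (T + T' + 1) Q' := by
  obtain ⟨s', t, h1, h2, h3⟩ := h
  obtain ⟨s'', t', h4, h5, h6⟩ := h' s' h3
  exact ⟨s'', _, .seq h1 h4, by omega, h6⟩

theorem RunsIn.store (s : State) (a : ℕ) (i e : Expr) :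
    RunsIn (.store a i e) s (i.cost s + e.cost s + 1) (· = s.set a (i.eval s) (e.eval s)) :=
  ⟨_, _, .store s a i e, le_rfl, rfl⟩

/-- The time for a single assignment is polynomially bounded. -/
theorem exists_store_bound (a : ℕ) (i e : Expr) : ∃ B : Polynomial ℕ, ∀ n s, Bounded n s →
    RunsIn (.store a i e) s (B.eval n) (· = s.set a (i.eval s) (e.eval s)) := by
  obtain ⟨B, hB⟩ := i.exists_cost_bound
  obtain ⟨B', hB'⟩ := e.exists_cost_bound
  refine ⟨B + B' + 1, fun n s hs => (RunsIn.store s a i e).imp ?_ fun _ h => h⟩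
  have := hB n s hs
  have := hB' n s hs
  simp only [Polynomial.eval_add, Polynomial.eval_one]
  omega

theorem Bounded.set {n : ℕ} {s : State} (hs : Bounded n s) {a i v : ℕ} (hv : v ≤ width n + 1) :
    Bounded n (s.set a i v) := by
  intro b j
  rw [State.set_mem]
  split_ifs
  exacts [hv, hs b j]

theorem eval_widthE {n : ℕ} {s : State} (h : s.mem 0 0 = n) : widthE.eval s = width n := by
  simp [widthE, sizeE, Expr.eval, h]

/-- The rule for bounded loops. -/
theorem exists_loopP_bound (k : ℕ) (P : Prog) (B : Polynomial ℕ) :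
    ∃ B' : Polynomial ℕ, ∀ (n : ℕ) (Q : ℕ → State → Prop),
    (∀ i s, Q i s → s.mem 0 0 = n ∧ Bounded n s) →
    (∀ i < width n, ∀ s, Q i s → s.mem 1 k = i →
      RunsIn P s (B.eval n) fun s' => s'.mem 1 k = i ∧ Bounded n s' ∧ Q (i + 1) (s'.set 1 k (i + 1))) →
    ∀ s, Bounded n s → Q 0 (s.set 1 k 0) → RunsIn (loopP k P) s (B'.eval n) (Q (width n)) := by
  obtain ⟨B₁, hB₁⟩ := exists_store_bound 1 (.const k) (.const 0)
  obtain ⟨B₂, hB₂⟩ := exists_store_bound 1 (.const k) (.add (varE k) (.const 1))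
  obtain ⟨B₃, hB₃⟩ := (Expr.sub widthE (varE k)).exists_cost_bound
  refine ⟨B₁ + ((Polynomial.X + Polynomial.X * Polynomial.X) * (B₃ + B + B₂ + 2) + B₃ + 1) + 1,
    fun n Q hQ hP s hs h0 => ?_⟩
  -- Induction on the number `m` of iterations still to come; the final test of the guard costs one
  -- more `B₃`.
  have key : ∀ m i s, i + m = width n → Q i s → s.mem 1 k = i →
      RunsIn (.loop (.sub widthE (varE k))
        (.seq P (.store 1 (.const k) (.add (varE k) (.const 1))))) s
        (m * (B₃.eval n + B.eval n + B₂.eval n + 2) + B₃.eval n + 1) (Q (width n)) := by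
    intro m
    induction m with
    | zero =>
      intro i s hi hs hv
      have h1 := hQ i s hs
      refine ⟨s, _, .loop_false ?_, ?_, ?_⟩
      · simp only [Expr.eval, eval_widthE h1.1, varE, hv]
        omega
      · have := hB₃ n s h1.2
        omega
      · rwa [← hi]
    | succ m ih =>
      intro i s hi hs hv
      have h1 := hQ i s hs
      obtain ⟨s', t, h2, h3, h4, h5, h6⟩ := hP i (by omega) s hs hv
      obtain ⟨s'', t', h7, h8, h9⟩ := hB₂ n s' h5
      have e : (Expr.add (varE k) (.const 1)).eval s' = i + 1 := by simp [Expr.eval, varE, h4]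
      rw [e] at h9
      simp only [Expr.eval] at h9
      subst h9
      obtain ⟨s3, t3, h10, h11, h12⟩ := ih (i + 1) _ (by omega) h6 (by simp [State.set_mem])
      refine ⟨s3, _, .loop_true ?_ (.seq h2 h7) h10, ?_, h12⟩
      · simp only [Expr.eval, eval_widthE h1.1, varE, hv]
        omega
      · have := hB₃ n s h1.2
        rw [Nat.add_mul, one_mul]
        omega
  refine ((hB₁ n s hs).seq (T' := width n * (B₃.eval n + B.eval n + B₂.eval n + 2) +
    B₃.eval n + 1) (Q' := Q (width n)) fun s' h => ?_).imp ?_ fun _ h => h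
  · subst h
    exact key _ 0 _ (by simp) h0 (by simp [State.set_mem, Expr.eval])
  · simp [Polynomial.eval_add, Polynomial.eval_mul]

/-! ### Representation of variables and relations in memory -/

/-- The memory of `s` represents the values of the first `k` variables and the relations. -/
structure Rep (n : ℕ) (inp : ℕ → Prop) (k : ℕ) (ρ : ℕ → ℕ) (I : Interp) (s : State) : Prop where
  size : s.mem 0 0 = n
  input : ∀ i, s.mem 0 i ≠ 0 ↔ inp i
  bounded : Bounded n s
  var : ∀ i < k, s.mem 1 i = ρ i
  var_lt : ∀ i < k, ρ i < width n
  rel : ∀ a x y, x < width n → y < width n → (s.mem (a + 3) (x * width n + y) ≠ 0 ↔ I a x y)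

/-- The states differ at most in the variables from `k` on and the flags from `d` on. -/
structure Frame (k d : ℕ) (s s' : State) : Prop where
  mem : ∀ a i, (a ≠ 1 ∨ i < k) → (a ≠ 2 ∨ i < d) → s'.mem a i = s.mem a i
  out : s'.out = s.out

theorem Frame.trans {k d : ℕ} {s s' s'' : State} (h : Frame k d s s') (h' : Frame k d s' s'') :
    Frame k d s s'' :=
  ⟨fun a i h1 h2 => (h'.mem a i h1 h2).trans (h.mem a i h1 h2), h'.out.trans h.out⟩

theorem Frame.mono {k d k' d' : ℕ} {s s' : State} (h : Frame k d s s') (hk : k' ≤ k)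
    (hd : d' ≤ d) : Frame k' d' s s' :=
  ⟨fun a i h1 h2 => h.mem a i (by omega) (by omega), h.out⟩

theorem Frame.set_flag {k d : ℕ} (s : State) {i : ℕ} (v : ℕ) (h : d ≤ i) :
    Frame k d s (s.set 2 i v) := by
  refine ⟨fun a j h1 h2 => ?_, rfl⟩
  rw [State.set_mem, if_neg]
  omega

theorem Frame.set_var {k d : ℕ} (s : State) {i : ℕ} (v : ℕ) (h : k ≤ i) :
    Frame k d s (s.set 1 i v) := by
  refine ⟨fun a j h1 h2 => ?_, rfl⟩
  rw [State.set_mem, if_neg]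
  omega

theorem Rep.frame {n : ℕ} {inp : ℕ → Prop} {k : ℕ} {ρ : ℕ → ℕ} {I : Interp} {s s' : State}
    (h : Rep n inp k ρ I s) {d : ℕ} (hf : Frame k d s s') (hb : Bounded n s') :
    Rep n inp k ρ I s' where
  size := by rw [hf.mem _ _ (by omega) (by omega), h.size]
  input i := by rw [hf.mem _ _ (by omega) (by omega), h.input]
  bounded := hb
  var i hi := by rw [hf.mem _ _ (by omega) (by omega), h.var i hi]
  var_lt := h.var_lt
  rel a x y hx hy := by rw [hf.mem _ _ (by omega) (by omega), h.rel a x y hx hy]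

/-- For entering the scope of a loop or quantifier, whose counter becomes the new variable `k`. -/
theorem Rep.push {n : ℕ} {inp : ℕ → Prop} {k : ℕ} {ρ : ℕ → ℕ} {I : Interp} {s : State}
    (h : Rep n inp k ρ I s) {i : ℕ} (hi : i < width n) (hs : s.mem 1 k = i) :
    Rep n inp (k + 1) (Function.update ρ k i) I s where
  size := h.size
  input := h.input
  bounded := h.bounded
  var j hj := by
    by_cases hjk : j = k
    · subst hjk
      simp [hs]
    · simpa [hjk] using h.var j (by omega)
  var_lt j hj := by
    by_cases hjk : j = k
    · subst hjk
      simpa using hi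
    · simpa [hjk] using h.var_lt j (by omega)
  rel := h.rel

theorem Rep.pop {n : ℕ} {inp : ℕ → Prop} {k : ℕ} {ρ : ℕ → ℕ} {I : Interp} {s : State} {i : ℕ}
    (h : Rep n inp (k + 1) (Function.update ρ k i) I s) : Rep n inp k ρ I s where
  size := h.size
  input := h.input
  bounded := h.bounded
  var j hj := by
    have := h.var j (by omega)
    rwa [Function.update_of_ne (by omega)] at this
  var_lt j hj := by
    have := h.var_lt j (by omega)
    rwa [Function.update_of_ne (by omega)] at this
  rel := h.rel

theorem eval_boolE (e : Expr) (s : State) (p : Prop) (h : e.eval s ≠ 0 ↔ p) :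
    (boolE e).eval s = bit p := by
  simp only [boolE, Expr.eval, bit]
  split_ifs with hp
  · have := h.2 hp
    omega
  · have : e.eval s = 0 := by
      by_contra h'
      exact hp (h.1 h')
    omega

theorem eval_eqE (e f : Expr) (s : State) (p : Prop) (h : e.eval s = f.eval s ↔ p) :
    (eqE e f).eval s = bit p := by
  simp only [eqE, Expr.eval, bit]
  split_ifs with hp
  · have := h.2 hp
    omega
  · have : e.eval s ≠ f.eval s := fun h' => hp (h.1 h')
    omega

/-- The specification of a program that evaluates a formula. -/
def Fm.CompSpec (φ : Fm) (k d : ℕ) (B : Polynomial ℕ) : Prop :=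
  ∀ n inp ρ I s, Rep n inp k ρ I s → RunsIn (φ.comp k d) s (B.eval n) fun s' =>
    Frame k d s s' ∧ Bounded n s' ∧ s'.mem 2 d = bit (φ.Holds n inp k ρ I)

theorem exists_setFlag_bound (d : ℕ) (e : Expr) : ∃ B : Polynomial ℕ, ∀ n s k (p : Prop),
    Bounded n s → e.eval s = bit p →
    RunsIn (setFlag d e) s (B.eval n) fun s' =>
      Frame k d s s' ∧ Bounded n s' ∧ s'.mem 2 d = bit p := by
  obtain ⟨B, hB⟩ := exists_store_bound 2 (.const d) e
  refine ⟨B, fun n s k p hs he => (hB n s hs).imp le_rfl ?_⟩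
  rintro _ rfl
  rw [he]
  refine ⟨Frame.set_flag _ _ le_rfl, hs.set ?_, by simp [State.set_mem, Expr.eval]⟩
  have := bit_le_one p
  omega

/-- Structural induction. The frame condition is what lets intermediate results survive: evaluating
a subformula at depth `d + 1` leaves flag `d` and the variables in scope untouched. -/
theorem Fm.exists_compSpec (φ : Fm) : ∀ k d, φ.closedAt k → ∃ B, φ.CompSpec k d B := by
  induction φ with
  | rel a i j =>
    intro k d hφ
    obtain ⟨B, hB⟩ := exists_setFlag_bound d (boolE (.load (a + 3) (pairE i j)))
    refine ⟨B, fun n inp ρ I s h => hB n s k _ h.bounded (eval_boolE _ _ _ ?_)⟩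
    simp only [closedAt, Bool.and_eq_true, decide_eq_true_eq] at hφ
    simp only [Expr.eval, pairE, eval_widthE h.size, varE, h.var i hφ.1, h.var j hφ.2, Holds]
    exact h.rel a _ _ (h.var_lt i hφ.1) (h.var_lt j hφ.2)
  | eq i j =>
    intro k d hφ
    obtain ⟨B, hB⟩ := exists_setFlag_bound d (eqE (varE i) (varE j))
    refine ⟨B, fun n inp ρ I s h => hB n s k _ h.bounded (eval_eqE _ _ _ _ ?_)⟩
    simp only [closedAt, Bool.and_eq_true, decide_eq_true_eq] at hφ
    simp only [Expr.eval, varE, h.var i hφ.1, h.var j hφ.2, Holds]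
  | lt i j =>
    intro k d hφ
    obtain ⟨B, hB⟩ := exists_setFlag_bound d (boolE (.sub (varE j) (varE i)))
    refine ⟨B, fun n inp ρ I s h => hB n s k _ h.bounded (eval_boolE _ _ _ ?_)⟩
    simp only [closedAt, Bool.and_eq_true, decide_eq_true_eq] at hφ
    simp only [Expr.eval, varE, h.var i hφ.1, h.var j hφ.2, Holds]
    omega
  | real i =>
    intro k d hφ
    obtain ⟨B, hB⟩ := exists_setFlag_bound d (boolE (.sub sizeE (varE i)))
    refine ⟨B, fun n inp ρ I s h => hB n s k _ h.bounded (eval_boolE _ _ _ ?_)⟩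
    simp only [closedAt, decide_eq_true_eq] at hφ
    simp only [Expr.eval, varE, sizeE, h.size, h.var i hφ, Holds]
    omega
  | code z x y =>
    intro k d hφ
    obtain ⟨B, hB⟩ := exists_setFlag_bound d
      (eqE (varE z) (.add sizeE (.add (.mul sizeE (varE x)) (varE y))))
    refine ⟨B, fun n inp ρ I s h => hB n s k _ h.bounded (eval_eqE _ _ _ _ ?_)⟩
    simp only [closedAt, Bool.and_eq_true, decide_eq_true_eq] at hφ
    simp only [Expr.eval, varE, sizeE, h.size, h.var z hφ.1.1, h.var x hφ.1.2, h.var y hφ.2, Holds]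
  | inp x y =>
    intro k d hφ
    obtain ⟨B, hB⟩ := exists_setFlag_bound d
      (boolE (.load 0 (.add (.const 1) (.add (.mul sizeE (varE x)) (varE y)))))
    refine ⟨B, fun n inp ρ I s h => hB n s k _ h.bounded (eval_boolE _ _ _ ?_)⟩
    simp only [closedAt, Bool.and_eq_true, decide_eq_true_eq] at hφ
    simp only [Expr.eval, varE, sizeE, h.size, h.var x hφ.1, h.var y hφ.2, Holds]
    exact h.input _
  | not φ ih =>
    intro k d hφ
    obtain ⟨B, hB⟩ := ih k d hφ
    obtain ⟨B', hB'⟩ := exists_setFlag_bound d (.sub (.const 1) (flagE d))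
    refine ⟨B + B' + 1, fun n inp ρ I s h => ?_⟩
    simp only [Polynomial.eval_add, Polynomial.eval_one]
    refine (hB n inp ρ I s h).seq fun s' ⟨h1, h2, h3⟩ => ?_
    refine (hB' n s' k (¬ φ.Holds n inp k ρ I) h2 ?_).imp le_rfl fun s'' h4 => ⟨h1.trans h4.1, h4.2⟩
    simp only [Expr.eval, flagE, h3, bit]
    split_ifs <;> simp_all
  | and φ ψ ihφ ihψ =>
    intro k d hφ
    simp only [closedAt, Bool.and_eq_true] at hφ
    obtain ⟨B, hB⟩ := ihφ k d hφ.1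
    obtain ⟨B₁, hB₁⟩ := ihψ k (d + 1) hφ.2
    obtain ⟨B', hB'⟩ := exists_setFlag_bound d (boolE (.mul (flagE d) (flagE (d + 1))))
    refine ⟨B + (B₁ + B' + 1) + 1, fun n inp ρ I s h => ?_⟩
    simp only [Polynomial.eval_add, Polynomial.eval_one]
    refine (hB n inp ρ I s h).seq fun s' ⟨h1, h2, h3⟩ => ?_
    refine (hB₁ n inp ρ I s' (h.frame h1 h2)).seq fun s'' ⟨h4, h5, h6⟩ => ?_
    refine (hB' n s'' k (φ.Holds n inp k ρ I ∧ ψ.Holds n inp k ρ I) h5 ?_).imp le_rfl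
      fun s3 h7 => ⟨(h1.trans (h4.mono le_rfl (Nat.le_succ d))).trans h7.1, h7.2⟩
    refine eval_boolE _ _ _ ?_
    simp only [Expr.eval, flagE, h6, h4.mem 2 d (by omega) (by omega), h3, Nat.mul_ne_zero_iff, bit_ne_zero]
  | ex φ ih =>
    intro k d hφ
    obtain ⟨B, hB⟩ := ih (k + 1) (d + 1) hφ
    obtain ⟨B₁, hB₁⟩ := exists_setFlag_bound d (.const 0)
    obtain ⟨B₂, hB₂⟩ := exists_setFlag_bound d (boolE (.add (flagE d) (flagE (d + 1))))
    obtain ⟨B₃, hB₃⟩ := exists_loopP_bound k (.seq (φ.comp (k + 1) (d + 1))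
      (setFlag d (boolE (.add (flagE d) (flagE (d + 1)))))) (B + B₂ + 1)
    refine ⟨B₁ + B₃ + 1, fun n inp ρ I s h => ?_⟩
    simp only [Polynomial.eval_add, Polynomial.eval_one]
    refine (hB₁ n s k False h.bounded (by simp [Expr.eval, bit])).seq fun s₁ ⟨h1, h2, h3⟩ => ?_
    -- Loop invariant: flag `d` records whether a witness below `i` has been found.
    let Q : ℕ → State → Prop := fun i s' => Frame k d s s' ∧ Bounded n s' ∧
      s'.mem 2 d = bit (∃ v < i, φ.Holds n inp (k + 1) (Function.update ρ k v) I)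
    refine (hB₃ n Q ?_ ?_ s₁ h2 ?_).imp le_rfl fun s' h => h
    · rintro i s' ⟨h4, h5, h6⟩
      exact ⟨by rw [h4.mem _ _ (by omega) (by omega), h.size], h5⟩
    · rintro i hi s' ⟨h4, h5, h6⟩ h7
      simp only [Polynomial.eval_add, Polynomial.eval_one]
      have hr := (h.frame h4 h5).push hi h7
      refine (hB n inp _ I s' hr).seq fun s₂ ⟨h8, h9, h10⟩ => ?_
      refine (hB₂ n s₂ (k + 1) (∃ v < i + 1, φ.Holds n inp (k + 1) (Function.update ρ k v) I)
        h9 ?_).imp le_rfl fun s₃ h11 => ⟨?_, h11.2.1, ?_, h11.2.1.set (by omega), ?_⟩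
      · refine eval_boolE _ _ _ ?_
        simp only [Expr.eval, flagE, h10, h8.mem 2 d (by omega) (by omega), h6,
          Nat.lt_succ_iff_lt_or_eq]
        rw [show ∀ a b : ℕ, a + b ≠ 0 ↔ a ≠ 0 ∨ b ≠ 0 by omega]
        constructor
        · rintro (h12 | h12)
          · obtain ⟨v, hv, hv'⟩ := bit_ne_zero.1 h12
            exact ⟨v, .inl hv, hv'⟩
          · exact ⟨i, .inr rfl, bit_ne_zero.1 h12⟩
        · rintro ⟨v, hv | rfl, hv'⟩
          · exact .inl (bit_ne_zero.2 ⟨v, hv, hv'⟩)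
          · exact .inr (bit_ne_zero.2 hv')
      · rw [h11.1.mem _ _ (by omega) (by omega), h8.mem _ _ (by omega) (by omega), h7]
      · refine ((h4.trans (h8.mono (Nat.le_succ k) (Nat.le_succ d))).trans
          (h11.1.mono (Nat.le_succ k) le_rfl)).trans (Frame.set_var _ _ le_rfl)
      · rw [State.set_mem, if_neg (by omega)]
        exact h11.2.2
    · refine ⟨h1.trans (Frame.set_var _ _ le_rfl), h2.set (by omega), ?_⟩
      rw [State.set_mem, if_neg (by omega), h3]
      simp [bit]

/-! ### Correctness of compiled commands -/

/-- The specification of a compiled command. -/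
def Cmd.CompSpec (c : Cmd) (k : ℕ) (B : Polynomial ℕ) : Prop :=
  ∀ n inp ρ I s, Rep n inp k ρ I s → RunsIn (c.comp k) s (B.eval n) fun s' =>
    Rep n inp k ρ (c.exec n inp k ρ (I, s.out)).1 s' ∧ s'.out = (c.exec n inp k ρ (I, s.out)).2

theorem Rep.congr {n : ℕ} {inp : ℕ → Prop} {k : ℕ} {ρ : ℕ → ℕ} {I I' : Interp} {s : State}
    (h : Rep n inp k ρ I s)
    (hI : ∀ a x y, x < width n → y < width n → (I a x y ↔ I' a x y)) : Rep n inp k ρ I' s :=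
  { h with rel := fun a x y hx hy => (h.rel a x y hx hy).trans (hI a x y hx hy) }

theorem Rep.set_var {n : ℕ} {inp : ℕ → Prop} {k : ℕ} {ρ : ℕ → ℕ} {I : Interp} {s : State}
    (h : Rep n inp k ρ I s) {v : ℕ} (hv : v ≤ width n) : Rep n inp k ρ I (s.set 1 k v) :=
  h.frame (d := 0) (Frame.set_var _ _ le_rfl) (h.bounded.set (by omega))

theorem eval_pairE {n : ℕ} {inp : ℕ → Prop} {k : ℕ} {ρ : ℕ → ℕ} {I : Interp} {s : State}
    (h : Rep n inp k ρ I s) {i j : ℕ} (hi : i < k) (hj : j < k) :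
    (pairE i j).eval s = ρ i * width n + ρ j := by
  simp [pairE, Expr.eval, varE, eval_widthE h.size, h.var i hi, h.var j hj]

/-- Different pairs have different addresses in the row-by-row storage. -/
theorem mul_add_inj {w x y x' y' : ℕ} (hy : y < w) (hy' : y' < w) :
    x * w + y = x' * w + y' ↔ x = x' ∧ y = y' := by
  refine ⟨fun h => ?_, by rintro ⟨rfl, rfl⟩; rfl⟩
  have h1 : x = x' := by
    have := congrArg (· / w) h
    simpa [Nat.mul_comm _ w, Nat.mul_add_div (Nat.zero_lt_of_lt hy), Nat.div_eq_of_lt hy,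
      Nat.div_eq_of_lt hy'] using this
  subst h1
  exact ⟨rfl, by omega⟩

theorem Cmd.exists_compSpec_fill (a : ℕ) (φ : Fm) (k : ℕ) (h : (fill a φ).closedAt k) :
    ∃ B, (fill a φ).CompSpec k B := by
  simp only [closedAt, Bool.and_eq_true] at h
  obtain ⟨B, hB⟩ := φ.exists_compSpec (k + 2) 0 h.1
  obtain ⟨B₁, hB₁⟩ := exists_store_bound (a + 3) (pairE k (k + 1)) (boolE (flagE 0))
  obtain ⟨B₂, hB₂⟩ := exists_loopP_bound (k + 1)
    (.seq (φ.comp (k + 2) 0) (.store (a + 3) (pairE k (k + 1)) (boolE (flagE 0)))) (B + B₁ + 1)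
  obtain ⟨B₃, hB₃⟩ := exists_loopP_bound k (loopP (k + 1)
    (.seq (φ.comp (k + 2) 0) (.store (a + 3) (pairE k (k + 1)) (boolE (flagE 0))))) B₂
  refine ⟨B₃, fun n inp ρ I s hs => ?_⟩
  let T : ℕ → ℕ → Prop := fun x y =>
    φ.Holds n inp (k + 2) (Function.update (Function.update ρ k x) (k + 1) y) I
  -- The half-overwritten state: cells lexicographically before `(i, j)` hold new values, the others
  -- old ones.
  let J : ℕ → ℕ → Interp := fun i j => Function.update I a fun x y =>
    if x < i ∨ x = i ∧ y < j then T x y else I a x y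
  let Q : ℕ → State → Prop := fun i s' => Rep n inp k ρ (J i 0) s' ∧ s'.out = s.out
  refine (hB₃ n Q (fun i s' h' => ⟨h'.1.size, h'.1.bounded⟩) ?_ s hs.bounded ?_).imp le_rfl ?_
  · rintro i hi s₁ ⟨h1, h2⟩ h3
    let Q' : ℕ → State → Prop := fun j s' =>
      Rep n inp (k + 1) (Function.update ρ k i) (J i j) s' ∧ s'.out = s.out
    refine (hB₂ n Q' (fun i s' h' => ⟨h'.1.size, h'.1.bounded⟩) ?_ s₁ h1.bounded ?_).imp le_rfl ?_
    · rintro j hj s₂ ⟨h4, h5⟩ h6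
      simp only [Polynomial.eval_add, Polynomial.eval_one]
      have h7 := h4.push hj h6
      refine (hB n inp _ _ s₂ h7).seq fun s₃ ⟨h8, h9, h10⟩ => (hB₁ n s₃ h9).imp le_rfl ?_
      rintro _ rfl
      have h11 := h7.frame h8 h9
      have hv : (boolE (flagE 0)).eval s₃ = bit (T i j) := by
        refine eval_boolE _ _ _ ?_
        rw [flagE, Expr.eval, Expr.eval, h10, bit_ne_zero]
        -- The formula does not read `a`, so its value is the same as before the overwriting began.
        exact (φ.holds_congr a h.2 fun b hb => by simp [J, hb])
      have hi' : (pairE k (k + 1)).eval s₃ = i * width n + j := by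
        rw [eval_pairE h11 (by omega) (by omega)]
        simp
      rw [hv, hi']
      have h12 : Bounded n (s₃.set (a + 3) (i * width n + j) (bit (T i j))) :=
        h9.set ((bit_le_one _).trans (by omega))
      refine ⟨?_, h12, ?_, ?_⟩
      · rw [State.set_mem, if_neg (by omega)]
        simpa using h11.var (k + 1) (by omega)
      · refine Rep.set_var ?_ (by omega)
        refine Rep.pop (i := j) ⟨?_, fun i => ?_, h12, fun i hi => ?_, h11.var_lt, ?_⟩
        · rw [State.set_mem, if_neg (by omega)]
          exact h11.size
        · rw [State.set_mem, if_neg (by omega)]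
          exact h11.input i
        · rw [State.set_mem, if_neg (by omega)]
          exact h11.var i hi
        · intro b x y hx hy
          rw [State.set_mem]
          by_cases hb : b = a
          · subst hb
            simp only [mul_add_inj hy hj, true_and]
            by_cases hxy : x = i ∧ y = j
            · rw [if_pos hxy]
              simp only [J, Function.update_self]
              rw [if_pos (by omega), bit_ne_zero, hxy.1, hxy.2]
            · rw [if_neg hxy, h11.rel b x y hx hy]
              simp only [J, Function.update_self]
              split_ifs <;> first | rfl | omega
          · rw [if_neg (by omega), h11.rel b x y hx hy]
            simp [J, hb]
      · rw [State.set_out, State.set_out, h8.out, h5]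
    · exact ⟨(h1.push hi h3).set_var (Nat.zero_le _), h2⟩
    · rintro s₂ ⟨h4, h5⟩
      refine ⟨?_, h4.bounded, (h4.pop.set_var hi).congr ?_, h5⟩
      · simpa using h4.var k (by omega)
      · intro b x y hx hy
        by_cases hb : b = a
        · subst hb
          simp only [J, Function.update_self]
          split_ifs <;> first | rfl | omega
        · simp [J, hb]
  · refine ⟨(hs.set_var (Nat.zero_le _)).congr ?_, rfl⟩
    intro b x y hx hy
    by_cases hb : b = a
    · subst hb
      simp [J]
    · simp [J, hb]
  · rintro s' ⟨h1, h2⟩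
    refine ⟨h1.congr ?_, h2⟩
    intro b x y hx hy
    by_cases hb : b = a
    · subst hb
      simp [J, exec, hx, T]
    · simp [J, exec, hb]

theorem Cmd.exists_compSpec_count (φ : Fm) (k : ℕ) (h : (count φ).closedAt k) :
    ∃ B, (count φ).CompSpec k B := by
  classical
  obtain ⟨B, hB⟩ := φ.exists_compSpec (k + 1) 1 h
  obtain ⟨B₁, hB₁⟩ := exists_store_bound 2 (.const 0) (.add (flagE 0) (flagE 1))
  obtain ⟨B₂, hB₂⟩ := exists_loopP_bound k
    (.seq (φ.comp (k + 1) 1) (setFlag 0 (.add (flagE 0) (flagE 1)))) (B + B₁ + 1)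
  obtain ⟨B₃, hB₃⟩ := exists_store_bound 2 (.const 0) (.const 0)
  obtain ⟨B₄, hB₄⟩ := (flagE 0).exists_cost_bound
  refine ⟨B₃ + B₂ + 1 + (B₄ + 1) + 1, fun n inp ρ I s hs => ?_⟩
  simp only [Polynomial.eval_add, Polynomial.eval_one]
  let N : ℕ → ℕ := fun m => (List.range m).countP fun i =>
      decide (φ.Holds n inp (k + 1) (Function.update ρ k i) I)
  -- Keeps the counter within the bound for memory contents.
  have hN (m : ℕ) : N m ≤ m := List.countP_le_length.trans_eq List.length_range
  let Q : ℕ → State → Prop := fun i s' => Rep n inp k ρ I s' ∧ s'.out = s.out ∧ s'.mem 2 0 = N i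
  refine RunsIn.seq (Q := Q (width n)) ((hB₃ n s hs.bounded).seq fun s₁ h1 => ?_) fun s' h' => ?_
  · refine hB₂ n Q (fun i s' h' => ⟨h'.1.size, h'.1.bounded⟩) ?_ s₁ ?_ ?_
    · rintro i hi s₂ ⟨h2, h3, h4⟩ h5
      simp only [Polynomial.eval_add, Polynomial.eval_one]
      refine (hB n inp _ _ s₂ (h2.push hi h5)).seq fun s₃ ⟨h6, h7, h8⟩ =>
        (hB₁ n s₃ h7).imp le_rfl ?_
      rintro _ rfl
      have e : (Expr.add (flagE 0) (flagE 1)).eval s₃ = N (i + 1) := by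
        simp only [Expr.eval, flagE, h8, h6.mem 2 0 (by omega) (by omega), h4]
        simp only [N, List.range_succ, List.countP_append, List.countP_singleton, bit,
          decide_eq_true_eq]
      have h9 : Frame k 0 s₂ (s₃.set 2 0 (N (i + 1))) :=
        (h6.mono (Nat.le_succ k) (Nat.zero_le _)).trans (Frame.set_flag _ _ le_rfl)
      have h10 : Bounded n (s₃.set 2 0 (N (i + 1))) := h7.set ((hN _).trans (by omega))
      rw [e]
      simp only [Expr.eval]
      refine ⟨?_, h10, ((h2.frame h9 h10).set_var hi), ?_, ?_⟩
      · rw [State.set_mem, if_neg (by omega), h6.mem 1 k (by omega) (by omega), h5]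
      · rw [State.set_out, h9.out, h3]
      · simp [State.set_mem]
    · subst h1
      exact hs.bounded.set (by simp [Expr.eval])
    · subst h1
      refine ⟨(hs.frame (d := 0) (Frame.set_flag _ _ le_rfl)
        (hs.bounded.set (by simp [Expr.eval]))).set_var (Nat.zero_le _), rfl, ?_⟩
      simp [State.set_mem, Expr.eval, N]
  · obtain ⟨h1, h2, h3⟩ := h'
    refine ⟨_, _, .emit _ _, Nat.add_le_add_right (hB₄ n s' h1.bounded) 1, ?_, ?_⟩
    · exact ⟨h1.size, h1.input, h1.bounded, h1.var, h1.var_lt, h1.rel⟩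
    · simp [h2, exec, flagE, Expr.eval, h3, N]

theorem Cmd.exists_compSpec (c : Cmd) : ∀ k, c.closedAt k → ∃ B, c.CompSpec k B := by
  induction c with
  | nop =>
    intro k _
    exact ⟨1, fun n inp ρ I s h => ⟨s, _, .nop s, by simp, h, rfl⟩⟩
  | fill a φ => exact fun k h => exists_compSpec_fill a φ k h
  | count φ => exact fun k h => exists_compSpec_count φ k h
  | seq c d ihc ihd =>
    intro k h
    simp only [closedAt, Bool.and_eq_true] at h
    obtain ⟨B, hB⟩ := ihc k h.1
    obtain ⟨B', hB'⟩ := ihd k h.2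
    refine ⟨B + B' + 1, fun n inp ρ I s hs => ?_⟩
    simp only [Polynomial.eval_add, Polynomial.eval_one]
    refine (hB n inp ρ I s hs).seq fun s' ⟨h1, h2⟩ => (hB' n inp ρ _ s' h1).imp le_rfl fun s'' h3 => ?_
    rwa [h2] at h3
  | ite φ c d ihc ihd =>
    intro k h
    simp only [closedAt, Bool.and_eq_true] at h
    obtain ⟨B, hB⟩ := ihc k h.1.2
    obtain ⟨B', hB'⟩ := ihd k h.2
    obtain ⟨B₁, hB₁⟩ := φ.exists_compSpec k 0 h.1.1
    obtain ⟨B₂, hB₂⟩ := (flagE 0).exists_cost_bound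
    refine ⟨B₁ + (B₂ + (B + B') + 1) + 1, fun n inp ρ I s hs => ?_⟩
    simp only [Polynomial.eval_add, Polynomial.eval_one]
    refine (hB₁ n inp ρ I s hs).seq fun s₁ ⟨h1, h2, h3⟩ => ?_
    have h4 := hB₂ n s₁ h2
    have h5 := hs.frame h1 h2
    by_cases hφ : φ.Holds n inp k ρ I
    · obtain ⟨s', t, h6, h7, h8⟩ := hB n inp ρ I s₁ h5
      refine ⟨s', _, .cond_true (by simp [flagE, Expr.eval, h3, bit, hφ]) h6, by omega, ?_⟩
      rw [h1.out] at h8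
      simpa only [exec, if_pos hφ] using h8
    · obtain ⟨s', t, h6, h7, h8⟩ := hB' n inp ρ I s₁ h5
      refine ⟨s', _, .cond_false (by simp [flagE, Expr.eval, h3, bit, hφ]) h6, by omega, ?_⟩
      rw [h1.out] at h8
      simpa only [exec, if_neg hφ] using h8
  | loop c ih =>
    intro k h
    obtain ⟨B, hB⟩ := ih (k + 1) h
    obtain ⟨B', hB'⟩ := exists_loopP_bound k (c.comp (k + 1)) B
    refine ⟨B', fun n inp ρ I s hs => ?_⟩
    let p : ℕ → Interp × List ℕ := fun m => (List.range m).foldl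
      (fun p i => c.exec n inp (k + 1) (Function.update ρ k i) p) (I, s.out)
    let Q : ℕ → State → Prop := fun i s' => Rep n inp k ρ (p i).1 s' ∧ s'.out = (p i).2
    refine (hB' n Q (fun i s' h' => ⟨h'.1.size, h'.1.bounded⟩) ?_ s hs.bounded ?_).imp le_rfl
      fun s' h => h
    · rintro i hi s₁ ⟨h1, h2⟩ h3
      refine (hB n inp _ _ s₁ (h1.push hi h3)).imp le_rfl fun s₂ ⟨h4, h5⟩ => ?_
      have e : c.exec n inp (k + 1) (Function.update ρ k i) ((p i).1, s₁.out) = p (i + 1) := by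
        simp only [p, List.range_succ, List.foldl_append, List.foldl_cons, List.foldl_nil, h2]
      rw [e] at h4 h5
      refine ⟨by simpa using h4.var k (by omega), h4.bounded, h4.pop.set_var hi, h5⟩
    · exact ⟨hs.set_var (Nat.zero_le _), rfl⟩
  | emit φ =>
    intro k h
    obtain ⟨B, hB⟩ := φ.exists_compSpec k 0 h
    obtain ⟨B', hB'⟩ := (flagE 0).exists_cost_bound
    refine ⟨B + (B' + 1) + 1, fun n inp ρ I s hs => ?_⟩
    simp only [Polynomial.eval_add, Polynomial.eval_one]
    refine (hB n inp ρ I s hs).seq fun s' ⟨h1, h2, h3⟩ => ?_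
    have h4 := hs.frame h1 h2
    refine ⟨_, _, .emit _ _, Nat.add_le_add_right (hB' n s' h2) 1, ?_, ?_⟩
    · exact ⟨h4.size, h4.input, h4.bounded, h4.var, h4.var_lt, h4.rel⟩
    · simp [exec, flagE, Expr.eval, h3, h1.out]

/-- Commands are executed by random access machines in polynomial time. -/
theorem Cmd.exists_computes (c : Cmd) (h : c.closedAt 0) : ∃ (P : Prog) (B : Polynomial ℕ),
    ∀ (n : ℕ) (L : List ℕ), (∀ i, L.getD i 0 ≤ width n + 1) → L.getD 0 0 = n →
      Computes P L (c.exec n (fun i => L.getD i 0 ≠ 0) 0 (fun _ => 0)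
        (fun _ _ _ => False, [])).2 (B.eval n) := by
  obtain ⟨B, hB⟩ := c.exists_compSpec 0 h
  refine ⟨c.comp 0, B, fun n L hL hn => ?_⟩
  have hb : Bounded n (init L) := by
    intro a i
    by_cases ha : a = 0
    · simpa [init, ha] using hL i
    · simp [init, ha]
  obtain ⟨s, t, h1, h2, h3⟩ := hB n (fun i => L.getD i 0 ≠ 0) (fun _ => 0)
    (fun _ _ _ => False) (init L) ⟨by simpa [init] using hn, fun i => by simp [init], hb,
      by simp, by simp, by simp [init]⟩
  exact ⟨s, t, h1, h3.2, h2⟩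

end RAM

/-! ### Trigraphs -/

namespace Trigraph

universe u v

variable {V : Type u} {D : Type v} {G : Trigraph V}

theorem SAdj.symm {x y : V} (h : G.SAdj x y) : G.SAdj y x := (G.symm y x).trans h

theorem SAnti.symm {x y : V} (h : G.SAnti x y) : G.SAnti y x := (G.symm y x).trans h

theorem Semi.symm {x y : V} (h : G.Semi x y) : G.Semi y x := ⟨h.1.symm, (G.symm y x).trans h.2⟩

theorem Adj.symm {x y : V} (h : G.Adj x y) : G.Adj y x := h.imp SAdj.symm Semi.symm

theorem Anti.symm {x y : V} (h : G.Anti x y) : G.Anti y x := h.imp SAnti.symm Semi.symm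

theorem SAdj.ne {x y : V} (h : G.SAdj x y) : x ≠ y := by
  rintro rfl
  have := G.diag x
  simp_all [SAdj]

theorem SAnti.ne {x y : V} (h : G.SAnti x y) : x ≠ y := by
  rintro rfl
  have := G.diag x
  simp_all [SAnti]

theorem Adj.ne {x y : V} (h : G.Adj x y) : x ≠ y := h.elim SAdj.ne And.left

theorem Anti.ne {x y : V} (h : G.Anti x y) : x ≠ y := h.elim SAnti.ne And.left

theorem trichotomy {x y : V} (h : x ≠ y) : G.SAdj x y ∨ G.Semi x y ∨ G.SAnti x y := by
  rcases e : G.φ x y with _ | _ | _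
  · exact .inr (.inl ⟨h, e⟩)
  · exact .inr (.inr e)
  · exact .inl e

theorem Adj.not_sAnti {x y : V} (h : G.Adj x y) : ¬ G.SAnti x y := by
  intro h'
  rcases h with h | h
  · simp_all [SAdj, SAnti]
  · have := h.2
    simp_all [SAnti]

theorem Anti.not_sAdj {x y : V} (h : G.Anti x y) : ¬ G.SAdj x y := by
  intro h'
  rcases h with h | h
  · simp_all [SAdj, SAnti]
  · have := h.2
    simp_all [SAdj]

theorem adj_iff {x y : V} : G.Adj x y ↔ x ≠ y ∧ ¬ G.SAnti x y := by
  refine ⟨fun h => ⟨h.ne, h.not_sAnti⟩, fun ⟨h, h'⟩ => ?_⟩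
  rcases G.trichotomy h with h1 | h1 | h1
  exacts [.inl h1, .inr h1, absurd h1 h']

theorem anti_iff {x y : V} : G.Anti x y ↔ x ≠ y ∧ ¬ G.SAdj x y := by
  refine ⟨fun h => ⟨h.ne, h.not_sAdj⟩, fun ⟨h, h'⟩ => ?_⟩
  rcases G.trichotomy h with h1 | h1 | h1
  exacts [absurd h1 h', .inr h1, .inl h1]

theorem SAdj.not_sAnti {x y : V} (h : G.SAdj x y) : ¬ G.SAnti x y := Adj.not_sAnti (.inl h)

/-! ### Splits and their interaction with claws -/

/-- There is no claw within `S`. -/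
def ClawFreeOn (J : Trigraph D) (S : Set D) : Prop := ∀ a ∈ S, ∀ b ∈ S, ∀ c ∈ S, ∀ d ∈ S,
  ¬ (J.Adj a b ∧ J.Adj a c ∧ J.Adj a d ∧ J.Anti b c ∧ J.Anti b d ∧ J.Anti c d)

/-- A decomposition of the vertex set `S` into `P`, `Q` and `C ∩ E` such that the adjacencies between
the three parts all belong to one of the strong cliques `C` and `E`. -/
structure Split (J : Trigraph D) (S C E P Q : Set D) (a₁ a₂ b₁ b₂ : D) : Prop where
  cliqueC : J.StrongClique C
  cliqueE : J.StrongClique E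
  subC : C ⊆ S
  subE : E ⊆ S
  subP : P ⊆ S
  subQ : Q ⊆ S
  cover : ∀ x ∈ S, x ∈ P ∨ x ∈ Q ∨ x ∈ C ∧ x ∈ E
  not_mem_Q : ∀ x ∈ P, x ∉ Q
  centreP : ∀ x ∈ P, x ∈ C → x ∉ E
  centreQ : ∀ x ∈ Q, x ∈ C → x ∉ E
  cross : ∀ x ∈ P, ∀ y ∈ Q, ¬ (x ∈ C ∧ y ∈ C) → ¬ (x ∈ E ∧ y ∈ E) → J.SAnti x y
  centre : ∀ x ∈ C, x ∈ E → ∀ y ∈ S, y ∉ C → y ∉ E → J.SAnti x y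
  endC : C.Nonempty → a₁ ∈ C ∧ a₁ ∈ P ∧ a₂ ∈ C ∧ a₂ ∈ Q
  endE : E.Nonempty → b₁ ∈ E ∧ b₁ ∈ P ∧ b₂ ∈ E ∧ b₂ ∈ Q

namespace Split

variable {J : Trigraph D} {S C E P Q : Set D} {a₁ a₂ b₁ b₂ : D}

theorem swapCE (h : J.Split S C E P Q a₁ a₂ b₁ b₂) : J.Split S E C P Q b₁ b₂ a₁ a₂ where
  cliqueC := h.cliqueE
  cliqueE := h.cliqueC
  subC := h.subE
  subE := h.subC
  subP := h.subP
  subQ := h.subQ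
  cover x hx := by simpa only [and_comm (a := x ∈ E)] using h.cover x hx
  not_mem_Q := h.not_mem_Q
  centreP x hx h1 h2 := h.centreP x hx h2 h1
  centreQ x hx h1 h2 := h.centreQ x hx h2 h1
  cross x hx y hy h1 h2 := h.cross x hx y hy h2 h1
  centre x hx hx' y hy h1 h2 := h.centre x hx' hx y hy h2 h1
  endC := h.endE
  endE := h.endC

theorem swapPQ (h : J.Split S C E P Q a₁ a₂ b₁ b₂) : J.Split S C E Q P a₂ a₁ b₂ b₁ where
  cliqueC := h.cliqueC
  cliqueE := h.cliqueE
  subC := h.subC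
  subE := h.subE
  subP := h.subQ
  subQ := h.subP
  cover x hx := by
    rcases h.cover x hx with h1 | h1 | h1 <;> simp [h1]
  not_mem_Q x hx hx' := h.not_mem_Q x hx' hx
  centreP := h.centreQ
  centreQ := h.centreP
  cross x hx y hy h1 h2 := (h.cross y hy x hx (by tauto) (by tauto)).symm
  centre := h.centre
  endC hC := by have := h.endC hC; tauto
  endE hE := by have := h.endE hE; tauto

/-- Outside of `C`, the neighbours in `P` of a member of `P ∩ C` are pairwise strongly adjacent. -/
theorem sAdj_of_adj (h : J.Split S C E P Q a₁ a₂ b₁ b₂) (hJ : J.ClawFreeOn S) {x y y' : D}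
    (hx : x ∈ C) (hxP : x ∈ P) (hy : y ∈ P) (hyC : y ∉ C) (hy' : y' ∈ P) (hyC' : y' ∉ C)
    (hne : y ≠ y') (hxy : J.Adj x y) (hxy' : J.Adj x y') : J.SAdj y y' := by
  obtain ⟨-, -, h3, h4⟩ := h.endC ⟨x, hx⟩
  by_contra hn
  have h5 (w : D) (hw : w ∈ P) (hwC : w ∉ C) : J.Anti w a₂ :=
    .inl (h.cross w hw a₂ h4 (fun h' => hwC h'.1) fun h' => h.centreQ a₂ h4 h3 h'.2)
  -- Otherwise `x` would be the centre of a claw with leaves `y`, `y'` and the end `a₂` on the other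
  -- side.
  refine hJ x (h.subP hxP) y (h.subP hy) y' (h.subP hy') a₂ (h.subQ h4)
    ⟨hxy, hxy', .inl (h.cliqueC hx h3 ?_), anti_iff.2 ⟨hne, hn⟩, h5 y hy hyC, h5 y' hy' hyC'⟩
  rintro rfl
  exact h.not_mem_Q x hxP h4

/-- If this fails, then `y`, `z` and `a₂` are the leaves of a claw at `x`. In the application `z` is
an old terminal. -/
theorem mem_or_not_anti_aux (h : J.Split S C E P Q a₁ a₂ b₁ b₂) (hJ : J.ClawFreeOn S) {x y z : D}
    (hx : x ∈ C) (hxP : x ∈ P) (hz : z ∈ S) (hzC : z ∉ C) (hy : y ∈ S)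
    (hxz : J.SAdj x z) (hxy : J.Adj x y) : y ∈ C ∨ ¬ J.Anti y z := by
  obtain ⟨-, -, h3, h4⟩ := h.endC ⟨x, hx⟩
  by_contra! hn
  -- A neighbour of `x` outside `C` cannot lie in `Q`, since `x` is not in `E`; so it lies in `P`,
  -- away from `a₂`.
  have h5 (w : D) (hw : w ∈ S) (hwC : w ∉ C) (hxw : J.Adj x w) : J.Anti w a₂ := by
    rcases h.cover w hw with h6 | h6 | h6
    · exact .inl (h.cross w h6 a₂ h4 (fun h' => hwC h'.1) fun h' => h.centreQ a₂ h4 h3 h'.2)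
    · exact absurd (h.cross x hxP w h6 (fun h' => hwC h'.2) fun h' => h.centreP x hxP hx h'.1)
        hxw.not_sAnti
    · exact absurd h6.1 hwC
  refine hJ x (h.subP hxP) y hy z hz a₂ (h.subQ h4)
    ⟨hxy, .inl hxz, .inl (h.cliqueC hx h3 ?_), hn.2, h5 y hy hn.1 hxy, h5 z hz hzC (.inl hxz)⟩
  rintro rfl
  exact h.not_mem_Q x hxP h4

/-- A neighbour `y` of a member `x` of `C` either belongs to `C` or is adjacent to any given
neighbour `z` of `x` outside `C`. -/
theorem mem_or_not_anti (h : J.Split S C E P Q a₁ a₂ b₁ b₂) (hJ : J.ClawFreeOn S) {x y z : D}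
    (hx : x ∈ C) (hxE : x ∉ E) (hz : z ∈ S) (hzC : z ∉ C) (hy : y ∈ S)
    (hxz : J.SAdj x z) (hxy : J.Adj x y) : y ∈ C ∨ ¬ J.Anti y z := by
  rcases h.cover x (h.subC hx) with h1 | h1 | h1
  · exact h.mem_or_not_anti_aux hJ hx h1 hz hzC hy hxz hxy
  · exact h.swapPQ.mem_or_not_anti_aux hJ hx h1 hz hzC hy hxz hxy
  · exact absurd h1.2 hxE

end Split

/-! ### Partitions with linking cliques -/

/-- A partition of `V` (given by an equivalence relation) together with cliques that link its
parts. -/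
structure Linkage (V : Type u) where
  same : V → V → Prop
  K : V × V → Set V

namespace Linkage

/-- `x` is a member of two different linking cliques. -/
def Double (s : Linkage V) (x : V) : Prop := ∃ h h', h ≠ h' ∧ x ∈ s.K h ∧ x ∈ s.K h'

/-- The linkage describes a purified strip-structure of nullity zero. -/
structure Valid (s : Linkage V) (G : Trigraph V) : Prop where
  equiv : Equivalence s.same
  clique : ∀ h, G.StrongClique (s.K h)
  single : ∀ x, s.Double x → ∀ y, s.same x y → y = x
  two : ∀ h h' h'' x, h ≠ h' → h ≠ h'' → h' ≠ h'' → x ∈ s.K h → x ∈ s.K h' → x ∉ s.K h''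
  cross : ∀ x y, G.Adj x y → ¬ s.same x y → ∃ h, x ∈ s.K h ∧ y ∈ s.K h
  circus : ∀ h, ∀ x ∈ s.K h, G.StrongClique {y | s.same x y ∧ y ∉ s.K h ∧ G.Adj x y}
  idx : ∀ h, ∀ x ∈ s.K h, ¬ s.same h.1 h.2

open Classical in
/-- The trigraph `G` together with a new vertex for every linking clique. -/
noncomputable def big (s : Linkage V) (G : Trigraph V) : Trigraph (V ⊕ V × V) where
  φ
    | .inl u, .inl v => G.φ u v
    | .inl u, .inr h => if u ∈ s.K h then 1 else -1
    | .inr h, .inl u => if u ∈ s.K h then 1 else -1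
    | .inr h, .inr k => if h = k then 0 else -1
  diag := by rintro (v | h) <;> simp [G.diag]
  symm := by rintro (u | h) (v | k) <;> simp [G.symm, eq_comm]
  matching := by
    rintro (u | h) (v | k) (w | l) h₁ h₂ h₃ ⟨h₄, h₅⟩
    · exact G.matching u v w (fun e => h₁ (congrArg _ e)) (fun e => h₂ (congrArg _ e))
        (fun e => h₃ (congrArg _ e)) ⟨h₄, h₅⟩
    all_goals
      dsimp only at h₄ h₅
      split_ifs at h₄ h₅ <;> simp_all

variable (s : Linkage V)

@[simp] theorem big_sAdj_inl_inl {x y : V} :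
    (s.big G).SAdj (.inl x) (.inl y) ↔ G.SAdj x y := Iff.rfl

@[simp] theorem big_sAnti_inl_inl {x y : V} :
    (s.big G).SAnti (.inl x) (.inl y) ↔ G.SAnti x y := Iff.rfl

@[simp] theorem big_sAdj_inl_inr {x : V} {h : V × V} :
    (s.big G).SAdj (.inl x) (.inr h) ↔ x ∈ s.K h := by
  simp only [SAdj, big]
  split_ifs <;> simp_all

@[simp] theorem big_sAnti_inl_inr {x : V} {h : V × V} :
    (s.big G).SAnti (.inl x) (.inr h) ↔ x ∉ s.K h := by
  simp only [SAnti, big]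
  split_ifs <;> simp_all

@[simp] theorem big_sAdj_inr_inl {x : V} {h : V × V} :
    (s.big G).SAdj (.inr h) (.inl x) ↔ x ∈ s.K h := by
  simp only [SAdj, big]
  split_ifs <;> simp_all

@[simp] theorem big_sAnti_inr_inl {x : V} {h : V × V} :
    (s.big G).SAnti (.inr h) (.inl x) ↔ x ∉ s.K h := by
  simp only [SAnti, big]
  split_ifs <;> simp_all

@[simp] theorem big_sAdj_inr_inr {h k : V × V} : ¬ (s.big G).SAdj (.inr h) (.inr k) := by
  simp only [SAdj, big]
  split_ifs <;> simp_all

@[simp] theorem big_sAnti_inr_inr {h k : V × V} :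
    (s.big G).SAnti (.inr h) (.inr k) ↔ h ≠ k := by
  simp only [SAnti, big]
  split_ifs <;> simp_all

@[simp] theorem big_adj_inl_inl {x y : V} :
    (s.big G).Adj (.inl x) (.inl y) ↔ G.Adj x y := by simp [adj_iff]

@[simp] theorem big_anti_inl_inl {x y : V} :
    (s.big G).Anti (.inl x) (.inl y) ↔ G.Anti x y := by simp [anti_iff]

/-- The vertices of the strip of the part containing `r`. -/
def stripSet (r : V) : Set (V ⊕ V × V) :=
  {z | Sum.elim (fun x => s.same r x) (fun h => ∃ x, s.same r x ∧ x ∈ s.K h) z}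

@[simp] theorem inl_mem_stripSet {r x : V} : .inl x ∈ s.stripSet r ↔ s.same r x := Iff.rfl

@[simp] theorem inr_mem_stripSet {r : V} {h : V × V} :
    .inr h ∈ s.stripSet r ↔ ∃ x, s.same r x ∧ x ∈ s.K h := Iff.rfl

variable {s}

/-- A claw within the vertices of `G` is excluded by hypothesis. A claw centred at a terminal has
its leaves in a strong clique. If a leaf is a terminal, the centre lies in its linking clique, and
by the circus condition the other two leaves are strongly adjacent. -/
theorem Valid.clawFreeOn (hs : s.Valid G) (hG : G.ClawFree) {r : V}
    (hr : ∀ x, s.same r x → ¬ s.Double x) : (s.big G).ClawFreeOn (s.stripSet r) := by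
  -- A second terminal among the neighbours of `x` would make `x` double, so `c` and `d` are
  -- vertices of `G` or the assumptions are contradictory.
  have key : ∀ x h c d, s.same r x → x ∈ s.K h → c ∈ s.stripSet r → d ∈ s.stripSet r →
      (s.big G).Adj (.inl x) c → (s.big G).Adj (.inl x) d → (s.big G).Anti (.inr h) c →
      (s.big G).Anti (.inr h) d → (s.big G).SAdj c d ∨ c = d := by
    rintro x h (y | k) (y' | k') hx hxh hc hd h1 h2 h3 h4
    · by_cases hyy : y = y'
      · exact .inr (congrArg _ hyy)
      · refine .inl (hs.circus h x hxh ⟨hs.equiv.trans (hs.equiv.symm hx) hc, ?_, ?_⟩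
          ⟨hs.equiv.trans (hs.equiv.symm hx) hd, ?_, ?_⟩ hyy)
        · simpa using h3.not_sAdj
        · simpa using h1
        · simpa using h4.not_sAdj
        · simpa using h2
    · have : x ∈ s.K k' := by simpa using h2.not_sAnti
      exact absurd ⟨h, k', fun e => h4.ne (congrArg _ e), hxh, this⟩ (hr x hx)
    · have : x ∈ s.K k := by simpa using h1.not_sAnti
      exact absurd ⟨h, k, fun e => h3.ne (congrArg _ e), hxh, this⟩ (hr x hx)
    · have : x ∈ s.K k' := by simpa using h2.not_sAnti
      exact absurd ⟨h, k', fun e => h4.ne (congrArg _ e), hxh, this⟩ (hr x hx)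
  have no {c d : V ⊕ V × V} (h : (s.big G).Anti c d) :
      ¬ ((s.big G).SAdj c d ∨ c = d) := fun h' => h'.elim h.not_sAdj h.ne
  rintro (x | h) ha b hb c hc d hd ⟨h1, h2, h3, h4, h5, h6⟩
  · have mem {h : V × V} (h' : (s.big G).Adj (.inl x) (.inr h)) : x ∈ s.K h := by
      simpa using h'.not_sAnti
    rcases b with y | k
    · rcases c with y' | k
      · rcases d with y'' | k
        · simp only [big_adj_inl_inl, big_anti_inl_inl] at *
          exact hG x y y' y'' ⟨h1, h2, h3, h4, h5, h6⟩
        · exact no h4 (key x k _ _ ha (mem h3) hb hc h1 h2 h5.symm h6.symm)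
      · exact no h5 (key x k _ _ ha (mem h2) hb hd h1 h3 h4.symm h6)
    · exact no h6 (key x k _ _ ha (mem h1) hc hd h2 h3 h4 h5)
  · rcases b with y | k
    · rcases c with y' | k
      · refine h4.not_sAdj (hs.clique h ?_ ?_ ?_)
        · simpa using h1.not_sAnti
        · simpa using h2.not_sAnti
        · exact fun e => h4.ne (congrArg _ e)
      · exact h2.not_sAnti (by simpa using h2.ne)
    · exact h1.not_sAnti (by simpa using h1.ne)

/-! ### Refining a linkage along a split -/

/-- The clique `C` gives rise to the new linking clique with index `h`. -/
def NewLink (C : Set (V ⊕ V × V)) (a₁ a₂ : V ⊕ V × V) (h : V × V) : Prop :=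
  a₁ = .inl h.1 ∧ a₂ = .inl h.2 ∧ ∀ k, .inr k ∉ C

variable (s) in
/-- Refinement of a linkage along a split. -/
def refine (C E P : Set (V ⊕ V × V)) (a₁ a₂ b₁ b₂ : V ⊕ V × V) : Linkage V :=
  let K' : V × V → Set V := fun h =>
    {x | x ∈ s.K h ∨ NewLink C a₁ a₂ h ∧ .inl x ∈ C ∨ NewLink E b₁ b₂ h ∧ .inl x ∈ E}
  { K := K'
    same := fun x y => x = y ∨ s.same x y ∧ ¬ Double ⟨s.same, K'⟩ x ∧ ¬ Double ⟨s.same, K'⟩ y ∧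
      (.inl x ∈ P ↔ .inl y ∈ P) }

theorem NewLink.eq {C : Set (V ⊕ V × V)} {a₁ a₂ : V ⊕ V × V} {h h' : V × V}
    (hh : NewLink C a₁ a₂ h) (hh' : NewLink C a₁ a₂ h') : h = h' :=
  Prod.ext (Sum.inl_injective (hh.1.symm.trans hh'.1))
    (Sum.inl_injective (hh.2.1.symm.trans hh'.2.1))

section Refine

variable {C E P Q : Set (V ⊕ V × V)} {a₁ a₂ b₁ b₂ : V ⊕ V × V} {r t : V}

theorem mem_refine {h : V × V} {x : V} : x ∈ (s.refine C E P a₁ a₂ b₁ b₂).K h ↔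
    x ∈ s.K h ∨ NewLink C a₁ a₂ h ∧ .inl x ∈ C ∨ NewLink E b₁ b₂ h ∧ .inl x ∈ E := Iff.rfl

theorem same_refine {x y : V} : (s.refine C E P a₁ a₂ b₁ b₂).same x y ↔
    x = y ∨ s.same x y ∧ ¬ (s.refine C E P a₁ a₂ b₁ b₂).Double x ∧
      ¬ (s.refine C E P a₁ a₂ b₁ b₂).Double y ∧ (.inl x ∈ P ↔ .inl y ∈ P) := Iff.rfl

/-- The hypotheses under which a refinement is formed. -/
structure Refinable (s : Linkage V) (G : Trigraph V) (C E P Q : Set (V ⊕ V × V))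
    (a₁ a₂ b₁ b₂ : V ⊕ V × V) (r t : V) : Prop where
  clawFree : G.ClawFree
  valid : s.Valid G
  split : (s.big G).Split (s.stripSet r) C E P Q a₁ a₂ b₁ b₂
  leftP : .inl r ∈ P
  rightQ : .inl t ∈ Q

theorem Refinable.swapCE (h : s.Refinable G C E P Q a₁ a₂ b₁ b₂ r t) :
    s.Refinable G E C P Q b₁ b₂ a₁ a₂ r t :=
  { h with split := h.split.swapCE }

/-- The part of a double vertex is a singleton, whereas this part contains `r` and `t` on different
sides. -/
theorem Refinable.not_double (h : s.Refinable G C E P Q a₁ a₂ b₁ b₂ r t) {x : V}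
    (hx : s.same r x) : ¬ s.Double x := by
  intro hd
  have h1 := h.valid.single x hd r (h.valid.equiv.symm hx)
  have h2 := h.valid.single x hd t (h.valid.equiv.trans (h.valid.equiv.symm hx)
    (h.split.subQ h.rightQ))
  rw [h2, ← h1] at h
  exact h.split.not_mem_Q _ h.leftP h.rightQ

theorem Refinable.clawFreeOn (h : s.Refinable G C E P Q a₁ a₂ b₁ b₂ r t) :
    (s.big G).ClawFreeOn (s.stripSet r) :=
  h.valid.clawFreeOn h.clawFree fun _ => h.not_double

/-- The index of a new link is fresh: its two entries are still in one part, and `Valid.idx` leaves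
the clique of such an index empty. -/
theorem Refinable.not_mem_of_newLink (h : s.Refinable G C E P Q a₁ a₂ b₁ b₂ r t) {k : V × V}
    (hk : NewLink C a₁ a₂ k) {x y : V} (hx : .inl x ∈ C) : y ∉ s.K k := by
  intro hy
  obtain ⟨h1, -, h2, -⟩ := h.split.endC ⟨_, hx⟩
  have h3 := h.split.subC h1
  have h4 := h.split.subC h2
  rw [hk.1] at h3
  rw [hk.2.1] at h4
  exact h.valid.idx k y hy (h.valid.equiv.trans (h.valid.equiv.symm h3) h4)

/-- A terminal in the centre would be adjacent to `a₁` and `b₂`, so both would lie in its linking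
clique; but they lie on different sides and in different cliques of the split, hence are strongly
antiadjacent. -/
theorem Refinable.inr_not_mem (h : s.Refinable G C E P Q a₁ a₂ b₁ b₂ r t) {k : V × V}
    (hk : .inr k ∈ C) : .inr k ∉ E := by
  intro hk'
  obtain ⟨h1, h2, -, -⟩ := h.split.endC ⟨_, hk⟩
  obtain ⟨-, -, h3, h4⟩ := h.split.endE ⟨_, hk'⟩
  have h5 : (s.big G).SAdj (.inr k) a₁ := h.split.cliqueC hk h1 (by
    rintro rfl
    exact h.split.centreP _ h2 hk hk')
  have h6 : (s.big G).SAdj (.inr k) b₂ := h.split.cliqueE hk' h3 (by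
    rintro rfl
    exact h.split.centreQ _ h4 hk hk')
  have h7 := h.split.cross a₁ h2 b₂ h4 (fun h' => h.split.centreQ b₂ h4 h'.2 h3)
    fun h' => h.split.centreP a₁ h2 h1 h'.1
  rcases a₁ with x | k'
  · rcases b₂ with y | k''
    · simp only [big_sAdj_inr_inl, big_sAnti_inl_inl] at h5 h6 h7
      exact SAdj.not_sAnti (h.valid.clique k h5 h6 h7.ne) h7
    · simp at h6
  · simp at h5

/-- The members of `C` share a linking clique after refinement. -/
theorem Refinable.exists_link (h : s.Refinable G C E P Q a₁ a₂ b₁ b₂ r t) (hC : C.Nonempty) :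
    ∃ k, (.inr k ∈ C ∨ NewLink C a₁ a₂ k) ∧
      ∀ x, .inl x ∈ C → x ∈ s.K k ∨ NewLink C a₁ a₂ k ∧ .inl x ∈ C := by
  by_cases hk : ∃ k, .inr k ∈ C
  · obtain ⟨k, hk⟩ := hk
    refine ⟨k, .inl hk, fun x hx => .inl ?_⟩
    simpa using h.split.cliqueC hx hk (by simp)
  · push Not at hk
    obtain ⟨h1, -, h2, -⟩ := h.split.endC hC
    rcases a₁ with x | k
    · rcases a₂ with y | k
      · have : NewLink C (.inl x) (.inl y) (x, y) := ⟨rfl, rfl, hk⟩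
        exact ⟨(x, y), .inr this, fun x hx => .inr ⟨this, hx⟩⟩
      · exact absurd h2 (hk k)
    · exact absurd h1 (hk k)

/-- `C` and `E` each have a link covering them; the point is that the two links have different
indices. -/
theorem Refinable.double_of_mem (h : s.Refinable G C E P Q a₁ a₂ b₁ b₂ r t) {x : V}
    (hC : .inl x ∈ C) (hE : .inl x ∈ E) : (s.refine C E P a₁ a₂ b₁ b₂).Double x := by
  obtain ⟨k, hk, h1⟩ := h.exists_link ⟨_, hC⟩
  obtain ⟨k', hk', h2⟩ := h.swapCE.exists_link ⟨_, hE⟩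
  refine ⟨k, k', ?_, ?_, ?_⟩
  · rintro rfl
    rcases hk with hk | hk
    · rcases hk' with hk' | hk'
      · exact h.inr_not_mem hk hk'
      · obtain ⟨y, -, hy⟩ := h.split.subC hk
        exact h.swapCE.not_mem_of_newLink hk' hE hy
    · rcases hk' with hk' | hk'
      · obtain ⟨y, -, hy⟩ := h.split.subE hk'
        exact h.not_mem_of_newLink hk hC hy
      -- Two new links with equal index would give `a₁ = b₁`, a vertex of `P` in the centre.
      · obtain ⟨h3, h4, -⟩ := h.split.endC ⟨_, hC⟩
        obtain ⟨h5, -⟩ := h.split.endE ⟨_, hE⟩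
        rw [hk'.1, ← hk.1] at h5
        exact h.split.centreP _ h4 h3 h5
  · have := h1 x hC
    simp only [mem_refine]
    tauto
  · have := h2 x hE
    simp only [mem_refine]
    tauto

/-- Applies when an old link and a new one make `x` double. If `x` is not in `E`, then
`Split.mem_or_not_anti` applies with the old terminal as `z`; otherwise `x` is central, so that
terminal lies in `E`, and `y` lies in `C` or `E`. -/
theorem Refinable.mem_or_mem (h : s.Refinable G C E P Q a₁ a₂ b₁ b₂ r t) {x y : V} {k k' : V × V}
    (hk : x ∈ s.K k) (hk' : NewLink C a₁ a₂ k') (hx : .inl x ∈ C) (hy : s.same r y)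
    (hxy : G.Adj x y) : y ∈ s.K k ∨ .inl y ∈ C := by
  have hxk : (s.big G).SAdj (.inl x) (.inr k) := by simpa using hk
  have hkr : .inr k ∈ s.stripSet r := ⟨x, h.split.subC hx, hk⟩
  by_cases hxE : .inl x ∈ E
  · by_cases hkE : .inr k ∈ E
    · by_cases hyC : .inl y ∈ C
      · exact .inr hyC
      · by_cases hyE : .inl y ∈ E
        · left
          simpa using h.split.cliqueE hyE hkE (by simp)
        · exact absurd (h.split.centre _ hx hxE (.inl y) hy hyC hyE)
            (Adj.not_sAnti (by simpa using hxy))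
    · exact absurd (h.split.centre _ hx hxE _ hkr (hk'.2.2 k) hkE) hxk.not_sAnti
  · rcases h.split.mem_or_not_anti h.clawFreeOn hx hxE hkr (hk'.2.2 k) (y := .inl y) hy hxk
      (by simpa using hxy) with h1 | h1
    · exact .inr h1
    · left
      rw [anti_iff] at h1
      simpa using h1

/-- Whatever lies in an old and a new linking clique does not lie in the other new one. -/
theorem Refinable.not_three (h : s.Refinable G C E P Q a₁ a₂ b₁ b₂ r t) {x : V} {k k' k'' : V × V}
    (hk : x ∈ s.K k) (hC : NewLink C a₁ a₂ k' ∧ .inl x ∈ C)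
    (hE : NewLink E b₁ b₂ k'' ∧ .inl x ∈ E) : False := by
  have hkr : .inr k ∈ s.stripSet r := ⟨x, h.split.subC hC.2, hk⟩
  have h1 := h.split.centre _ hC.2 hE.2 _ hkr (hC.1.2.2 k) (hE.1.2.2 k)
  simp only [big_sAnti_inl_inr] at h1
  exact h1 hk

theorem Refinable.mem_iff (h : s.Refinable G C E P Q a₁ a₂ b₁ b₂ r t) {x : V} (hx : ¬ s.same r x)
    {k : V × V} : x ∈ (s.refine C E P a₁ a₂ b₁ b₂).K k ↔ x ∈ s.K k := by
  rw [mem_refine]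
  have h1 : .inl x ∉ C := fun h' => hx (h.split.subC h')
  have h2 : .inl x ∉ E := fun h' => hx (h.split.subE h')
  tauto

theorem Refinable.double_iff (h : s.Refinable G C E P Q a₁ a₂ b₁ b₂ r t) {x : V}
    (hx : ¬ s.same r x) : (s.refine C E P a₁ a₂ b₁ b₂).Double x ↔ s.Double x := by
  simp only [Double, h.mem_iff hx]

/-- The neighbours in its part of a double vertex share a linking clique with it. -/
theorem Refinable.exists_of_double (h : s.Refinable G C E P Q a₁ a₂ b₁ b₂ r t) {x y : V}
    (hx : s.same r x) (hy : s.same r y) (hd : (s.refine C E P a₁ a₂ b₁ b₂).Double x)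
    (hxy : G.Adj x y) : ∃ k, x ∈ (s.refine C E P a₁ a₂ b₁ b₂).K k ∧
      y ∈ (s.refine C E P a₁ a₂ b₁ b₂).K k := by
  obtain ⟨k, k', hne, h1, h2⟩ := hd
  simp only [mem_refine] at *
  have hCE {k k' : V × V} (h1 : NewLink C a₁ a₂ k ∧ .inl x ∈ C)
      (h2 : NewLink E b₁ b₂ k' ∧ .inl x ∈ E) : .inl y ∈ C ∨ .inl y ∈ E := by
    by_contra! hn
    exact absurd (h.split.centre _ h1.2 h2.2 (.inl y) hy hn.1 hn.2)
      (Adj.not_sAnti (by simpa using hxy))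
  rcases h1 with h1 | h1 | h1
  · rcases h2 with h2 | h2 | h2
    · exact absurd ⟨k, k', hne, h1, h2⟩ (h.not_double hx)
    · rcases h.mem_or_mem h1 h2.1 h2.2 hy hxy with h3 | h3
      · exact ⟨k, by tauto⟩
      · exact ⟨k', by tauto⟩
    · rcases h.swapCE.mem_or_mem h1 h2.1 h2.2 hy hxy with h3 | h3
      · exact ⟨k, by tauto⟩
      · exact ⟨k', by tauto⟩
  · rcases h2 with h2 | h2 | h2
    · rcases h.mem_or_mem h2 h1.1 h1.2 hy hxy with h3 | h3
      · exact ⟨k', by tauto⟩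
      · exact ⟨k, by tauto⟩
    · exact absurd (h1.1.eq h2.1) hne
    · rcases hCE h1 h2 with h3 | h3
      · exact ⟨k, by tauto⟩
      · exact ⟨k', by tauto⟩
  · rcases h2 with h2 | h2 | h2
    · rcases h.swapCE.mem_or_mem h2 h1.1 h1.2 hy hxy with h3 | h3
      · exact ⟨k', by tauto⟩
      · exact ⟨k, by tauto⟩
    · rcases hCE h2 h1 with h3 | h3
      · exact ⟨k', by tauto⟩
      · exact ⟨k, by tauto⟩
    · exact absurd (h1.1.eq h2.1) hne

theorem Refinable.clique_newLink (h : s.Refinable G C E P Q a₁ a₂ b₁ b₂ r t) :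
    G.StrongClique {x | .inl x ∈ C} := fun x hx y hy hne => by
  simpa using h.split.cliqueC hx hy (by simpa using hne)

/-- The circus condition for a new linking clique. -/
theorem Refinable.sAdj_newLink (h : s.Refinable G C E P Q a₁ a₂ b₁ b₂ r t) {x y y' : V}
    (hx : .inl x ∈ C) (hxE : .inl x ∉ E) (hy : s.same r y) (hy' : s.same r y')
    (hyE : ¬ (.inl y ∈ C ∧ .inl y ∈ E)) (hyE' : ¬ (.inl y' ∈ C ∧ .inl y' ∈ E))
    (hxy : .inl x ∈ P ↔ .inl y ∈ P) (hxy' : .inl x ∈ P ↔ .inl y' ∈ P)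
    (hyC : .inl y ∉ C) (hyC' : .inl y' ∉ C) (hne : y ≠ y') (h1 : G.Adj x y) (h2 : G.Adj x y') :
    G.SAdj y y' := by
  have h1' : (s.big G).Adj (.inl x) (.inl y) := by simpa using h1
  have h2' : (s.big G).Adj (.inl x) (.inl y') := by simpa using h2
  have hne' : (.inl y : V ⊕ V × V) ≠ .inl y' := by simpa using hne
  have hQ {w : V} (hw : s.same r w) (hwP : .inl w ∉ P) (hwE : ¬ (.inl w ∈ C ∧ .inl w ∈ E)) :
      .inl w ∈ Q := by
    have := h.split.cover (.inl w) hw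
    tauto
  have hr : s.same r x := h.split.subC hx
  by_cases hxP : .inl x ∈ P
  · simpa using h.split.sAdj_of_adj h.clawFreeOn hx hxP (hxy.1 hxP) hyC (hxy'.1 hxP) hyC' hne' h1' h2'
  · simpa using h.split.swapPQ.sAdj_of_adj h.clawFreeOn hx (hQ hr hxP (by tauto))
      (hQ hy (by tauto) hyE) hyC (hQ hy' (by tauto) hyE') hyC' hne' h1' h2'

/-- Edges that now run between parts either cross the split or leave a vertex that became double;
`Split.cross` and `exists_of_double` provide their links. For new links the circus condition comes
from `sAdj_newLink`. -/
theorem Refinable.refine_valid (h : s.Refinable G C E P Q a₁ a₂ b₁ b₂ r t) :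
    (s.refine C E P a₁ a₂ b₁ b₂).Valid G where
  equiv := by
    refine ⟨fun x => .inl rfl, ?_, ?_⟩
    · rintro x y (rfl | h1)
      · exact .inl rfl
      · exact .inr ⟨h.valid.equiv.symm h1.1, h1.2.2.1, h1.2.1, h1.2.2.2.symm⟩
    · rintro x y z (rfl | h1) (rfl | h2)
      · exact .inl rfl
      · exact .inr h2
      · exact .inr h1
      · exact .inr ⟨h.valid.equiv.trans h1.1 h2.1, h1.2.1, h2.2.2.1, h1.2.2.2.trans h2.2.2.2⟩
  clique k x hx y hy hne := by
    rw [mem_refine] at hx hy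
    rcases hx with hx | hx | hx <;> rcases hy with hy | hy | hy
    · exact h.valid.clique k hx hy hne
    · exact absurd hx (h.not_mem_of_newLink hy.1 hy.2)
    · exact absurd hx (h.swapCE.not_mem_of_newLink hy.1 hy.2)
    · exact absurd hy (h.not_mem_of_newLink hx.1 hx.2)
    · exact h.clique_newLink hx.2 hy.2 hne
    · have h1 := h.split.endC ⟨_, hx.2⟩
      have h2 := h.split.endE ⟨_, hy.2⟩
      rw [hx.1.1] at h1
      rw [hy.1.1] at h2
      exact absurd h2.1 (h.split.centreP _ h1.2.1 h1.1)
    · exact absurd hy (h.swapCE.not_mem_of_newLink hx.1 hx.2)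
    · have h1 := h.split.endE ⟨_, hx.2⟩
      have h2 := h.split.endC ⟨_, hy.2⟩
      rw [hx.1.1] at h1
      rw [hy.1.1] at h2
      exact absurd h1.1 (h.split.centreP _ h1.2.1 h2.1)
    · exact h.swapCE.clique_newLink hx.2 hy.2 hne
  single x hx y hxy := by
    rcases hxy with rfl | hxy
    · rfl
    · exact absurd hx hxy.2.1
  two k k' k'' x h1 h2 h3 hk hk' hk'' := by
    by_cases hx : s.same r x
    · have old {k k' : V × V} (hne : k ≠ k') (h1 : x ∈ s.K k) (h2 : x ∈ s.K k') : False :=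
        h.not_double hx ⟨k, k', hne, h1, h2⟩
      rw [mem_refine] at hk hk' hk''
      -- Three different links: two old ones are impossible here, two new ones from the same clique
      -- coincide, and an old one excludes lying in both new ones.
      rcases hk with hk | hk | hk <;> rcases hk' with hk' | hk' | hk' <;>
        rcases hk'' with hk'' | hk'' | hk'' <;>
        first
        | exact old h1 hk hk'
        | exact old h2 hk hk''
        | exact old h3 hk' hk''
        | exact h1 (hk.1.eq hk'.1)
        | exact h2 (hk.1.eq hk''.1)
        | exact h3 (hk'.1.eq hk''.1)
        | exact h.not_three hk hk' hk''
        | exact h.not_three hk hk'' hk'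
        | exact h.not_three hk' hk hk''
        | exact h.not_three hk' hk'' hk
        | exact h.not_three hk'' hk hk'
        | exact h.not_three hk'' hk' hk
    · rw [h.mem_iff hx] at hk hk' hk''
      exact h.valid.two k k' k'' x h1 h2 h3 hk hk' hk''
  cross x y hxy hn := by
    by_cases hs : s.same x y
    · have hne : x ≠ y := hxy.ne
      by_cases hx : s.same r x
      · have hy := h.valid.equiv.trans hx hs
        by_cases hdx : (s.refine C E P a₁ a₂ b₁ b₂).Double x
        · exact h.exists_of_double hx hy hdx hxy
        by_cases hdy : (s.refine C E P a₁ a₂ b₁ b₂).Double y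
        · obtain ⟨k, h1, h2⟩ := h.exists_of_double hy hx hdy hxy.symm
          exact ⟨k, h2, h1⟩
        -- Neither vertex is double, so they were separated by lying on different sides.
        have hP : ¬ (.inl x ∈ P ↔ .inl y ∈ P) := fun hP => hn (.inr ⟨hs, hdx, hdy, hP⟩)
        have link : .inl x ∈ C ∧ .inl y ∈ C ∨ .inl x ∈ E ∧ .inl y ∈ E := by
          have h1 := h.split.cover (.inl x) hx
          have h2 := h.split.cover (.inl y) hy
          have h3 : ¬ (.inl x ∈ C ∧ .inl x ∈ E) := fun h' => hdx (h.double_of_mem h'.1 h'.2)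
          have h4 : ¬ (.inl y ∈ C ∧ .inl y ∈ E) := fun h' => hdy (h.double_of_mem h'.1 h'.2)
          have h5 : ¬ (s.big G).SAnti (.inl x) (.inl y) := by simpa using hxy.not_sAnti
          have h6 : ¬ (s.big G).SAnti (.inl y) (.inl x) := by simpa using hxy.symm.not_sAnti
          by_contra hlink
          push Not at hlink
          by_cases hxP : .inl x ∈ P
          · have hyQ : .inl y ∈ Q :=
              (h2.resolve_left fun h' => hP (iff_of_true hxP h')).resolve_right h4
            exact h5 (h.split.cross _ hxP _ hyQ (fun h' => hlink.1 h'.1 h'.2)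
              fun h' => hlink.2 h'.1 h'.2)
          · have hyP : .inl y ∈ P := by
              by_contra hyP
              exact hP (iff_of_false hxP hyP)
            exact h6 (h.split.cross _ hyP _ ((h1.resolve_left hxP).resolve_right h3)
              (fun h' => hlink.1 h'.2 h'.1) fun h' => hlink.2 h'.2 h'.1)
        rcases link with hl | hl
        · obtain ⟨k, -, hk⟩ := h.exists_link ⟨_, hl.1⟩
          exact ⟨k, (hk x hl.1).imp_right .inl, (hk y hl.2).imp_right .inl⟩
        · obtain ⟨k, -, hk⟩ := h.swapCE.exists_link ⟨_, hl.1⟩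
          exact ⟨k, (hk x hl.1).imp_right .inr, (hk y hl.2).imp_right .inr⟩
      -- Other parts are not cut: they are disjoint from `C`, `E` and `P`.
      · have hy : ¬ s.same r y := fun hy => hx (h.valid.equiv.trans hy (h.valid.equiv.symm hs))
        refine absurd (same_refine.2 (.inr ⟨hs, ?_, ?_, ?_⟩)) hn
        · rw [h.double_iff hx]
          exact fun hd => hne (h.valid.single x hd y hs).symm
        · rw [h.double_iff hy]
          exact fun hd => hne (h.valid.single y hd x (h.valid.equiv.symm hs))
        · exact ⟨fun h' => absurd (h.split.subP h') hx, fun h' => absurd (h.split.subP h') hy⟩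
    · obtain ⟨k, h1, h2⟩ := h.valid.cross x y hxy hs
      exact ⟨k, .inl h1, .inl h2⟩
  circus k x hx y hy y' hy' hne := by
    obtain ⟨h1, h2, h3⟩ := hy
    obtain ⟨h1', h2', h3'⟩ := hy'
    have h1 := h1.resolve_left h3.ne
    have h1' := h1'.resolve_left h3'.ne
    have hc {C E : Set (V ⊕ V × V)} {a₁ a₂ b₁ b₂ : V ⊕ V × V}
        (h : s.Refinable G C E P Q a₁ a₂ b₁ b₂ r t) (hx : NewLink C a₁ a₂ k ∧ .inl x ∈ C)
        (hd : ∀ x, .inl x ∈ C → .inl x ∈ E → (s.refine C E P a₁ a₂ b₁ b₂).Double x)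
        (h1 : s.same x y ∧ ¬ (s.refine C E P a₁ a₂ b₁ b₂).Double x ∧
          ¬ (s.refine C E P a₁ a₂ b₁ b₂).Double y ∧ (.inl x ∈ P ↔ .inl y ∈ P))
        (h1' : s.same x y' ∧ ¬ (s.refine C E P a₁ a₂ b₁ b₂).Double x ∧
          ¬ (s.refine C E P a₁ a₂ b₁ b₂).Double y' ∧ (.inl x ∈ P ↔ .inl y' ∈ P))
        (h2 : ¬ (NewLink C a₁ a₂ k ∧ .inl y ∈ C)) (h2' : ¬ (NewLink C a₁ a₂ k ∧ .inl y' ∈ C)) :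
        G.SAdj y y' := by
      have hr : s.same r x := h.split.subC hx.2
      exact h.sAdj_newLink hx.2 (fun h' => h1.2.1 (h.double_of_mem hx.2 h'))
        (h.valid.equiv.trans hr h1.1) (h.valid.equiv.trans hr h1'.1)
        (fun h' => h1.2.2.1 (h.double_of_mem h'.1 h'.2))
        (fun h' => h1'.2.2.1 (h.double_of_mem h'.1 h'.2)) h1.2.2.2 h1'.2.2.2
        (fun h' => h2 ⟨hx.1, h'⟩) (fun h' => h2' ⟨hx.1, h'⟩) hne h3 h3'
    rw [mem_refine] at hx h2 h2'
    rcases hx with hx | hx | hx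
    · exact h.valid.circus k x hx ⟨h1.1, by tauto, h3⟩ ⟨h1'.1, by tauto, h3'⟩ hne
    · exact hc h hx (fun _ => h.double_of_mem) h1 h1' (by tauto) (by tauto)
    · have e : s.refine E C P b₁ b₂ a₁ a₂ = s.refine C E P a₁ a₂ b₁ b₂ := by
        simp only [refine, or_comm (a := NewLink E b₁ b₂ _ ∧ _)]
      refine hc h.swapCE hx ?_ ?_ ?_ (by tauto) (by tauto)
      · exact fun _ => h.swapCE.double_of_mem
      · rwa [e]
      · rwa [e]
  idx k x hx := by
    rw [mem_refine] at hx
    have hc {C E : Set (V ⊕ V × V)} {a₁ a₂ b₁ b₂ : V ⊕ V × V}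
        (h : s.Refinable G C E P Q a₁ a₂ b₁ b₂ r t) (hx : NewLink C a₁ a₂ k ∧ .inl x ∈ C) :
        k.1 ≠ k.2 ∧ ¬ (.inl k.1 ∈ P ↔ .inl k.2 ∈ P) := by
      obtain ⟨-, h1, -, h2⟩ := h.split.endC ⟨_, hx.2⟩
      rw [hx.1.1] at h1
      rw [hx.1.2.1] at h2
      refine ⟨fun e => ?_, fun e => h.split.not_mem_Q _ (e.1 h1) h2⟩
      rw [e] at h1
      exact h.split.not_mem_Q _ h1 h2
    rintro (e | h1)
    · rcases hx with hx | hx | hx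
      · refine h.valid.idx k x hx ?_
        rw [e]
        exact h.valid.equiv.refl _
      · exact (hc h hx).1 e
      · exact (hc h.swapCE hx).1 e
    · rcases hx with hx | hx | hx
      · exact h.valid.idx k x hx h1.1
      · exact (hc h hx).2 h1.2.2.2
      · exact (hc h.swapCE hx).2 h1.2.2.2

/-- The number of pairs of vertices in the same part. -/
noncomputable def measure (s : Linkage V) : ℕ := {x : V × V | s.same x.1 x.2}.ncard

/-- The pair `(r, t)` is lost, and no pair is gained. -/
theorem Refinable.measure_lt [Finite V] (h : s.Refinable G C E P Q a₁ a₂ b₁ b₂ r t) :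
    (s.refine C E P a₁ a₂ b₁ b₂).measure < s.measure := by
  refine Set.ncard_lt_ncard ⟨?_, fun hsub => ?_⟩ (Set.toFinite _)
  · rintro ⟨x, y⟩ (h1 | h1)
    · obtain rfl : x = y := h1
      exact h.valid.equiv.refl _
    · exact h1.1
  · have h1 : (r, t) ∈ {x : V × V | s.same x.1 x.2} := h.split.subQ h.rightQ
    rcases hsub h1 with h2 | h2
    · obtain rfl : r = t := h2
      exact h.split.not_mem_Q _ h.leftP h.rightQ
    · exact h.split.not_mem_Q _ (h2.2.2.2.1 h.leftP) h.rightQ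

end Refine

end Linkage

end Trigraph

namespace Trigraph

universe u v w

variable {V : Type u} {U : Type v} {T : Type w} {J : Trigraph V} {J' : Trigraph U} {J'' : Trigraph T}

/-! ### Thickenings -/

theorem Semi.eq {G : Trigraph V} {x y z : V} (h : G.Semi x y) (h' : G.Semi x z) : y = z := by
  by_contra hne
  exact G.matching x y z h.1 h'.1 hne ⟨h.2, h'.2⟩

/-- `J` is a thickening of `J'`, where the vertex `x` of `J` belongs to the set of the vertex
`π x` of `J'`. -/
structure Contracts (J : Trigraph V) (J' : Trigraph U) (π : V → U) : Prop where
  surj : Function.Surjective π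
  fibre : ∀ x y, x ≠ y → π x = π y → J.SAdj x y
  sAdj : ∀ x y, J'.SAdj (π x) (π y) → J.SAdj x y
  sAnti : ∀ x y, J'.SAnti (π x) (π y) → J.SAnti x y
  semi : ∀ u v, J'.Semi u v → (∃ x y, π x = u ∧ π y = v ∧ ¬ J.SAdj x y) ∧
    ∃ x y, π x = u ∧ π y = v ∧ ¬ J.SAnti x y

namespace Contracts

theorem isThickeningVia {π : V → U} (h : J.Contracts J' π) :
    J.IsThickeningVia J' fun u => {x | π x = u} := by
  refine ⟨h.surj, ?_, ?_, ?_, ?_, ?_, ?_⟩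
  · intro u v huv
    refine Set.disjoint_left.2 ?_
    rintro x rfl h'
    exact huv h'
  · ext x
    simp
  · intro u x hx y hy hne
    exact h.fibre x y hne (hx.trans hy.symm)
  · rintro u v huv x rfl y rfl
    exact h.sAdj x y huv
  · rintro u v huv x rfl y rfl
    exact h.sAnti x y huv
  · intro u v huv
    obtain ⟨⟨x, y, h1, h2, h3⟩, ⟨x', y', h4, h5, h6⟩⟩ := h.semi u v huv
    exact ⟨fun hc => h3 (hc x h1 y h2), fun hc => h6 (hc x' h4 y' h5)⟩

theorem trans {π : V → U} {c : U → T} (h : J.Contracts J' π) (h' : J'.Contracts J'' c) :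
    J.Contracts J'' (c ∘ π) where
  surj := h'.surj.comp h.surj
  fibre x y hne hxy := by
    by_cases hπ : π x = π y
    · exact h.fibre x y hne hπ
    · exact h.sAdj x y (h'.fibre _ _ hπ hxy)
  sAdj x y hxy := h.sAdj x y (h'.sAdj _ _ hxy)
  sAnti x y hxy := h.sAnti x y (h'.sAnti _ _ hxy)
  semi u v huv := by
    obtain ⟨⟨x, y, rfl, rfl, h3⟩, ⟨x', y', h4, h5, h6⟩⟩ := h'.semi u v huv
    constructor
    · rcases J'.trichotomy (x := x) (y := y) (by rintro rfl; exact huv.1 rfl) with h7 | h7 | h7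
      · exact absurd h7 h3
      · obtain ⟨a, b, rfl, rfl, h8⟩ := (h.semi x y h7).1
        exact ⟨a, b, rfl, rfl, h8⟩
      · obtain ⟨a, rfl⟩ := h.surj x
        obtain ⟨b, rfl⟩ := h.surj y
        exact ⟨a, b, rfl, rfl, fun h8 => h8.not_sAnti (h.sAnti a b h7)⟩
    · rcases J'.trichotomy (x := x') (y := y')
        (by rintro rfl; exact huv.1 (h4.symm.trans h5)) with h7 | h7 | h7
      · obtain ⟨a, rfl⟩ := h.surj x'
        obtain ⟨b, rfl⟩ := h.surj y'
        exact ⟨a, b, h4, h5, (h.sAdj a b h7).not_sAnti⟩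
      · obtain ⟨a, b, rfl, rfl, h8⟩ := (h.semi x' y' h7).2
        exact ⟨a, b, h4, h5, h8⟩
      · exact absurd h7 h6

variable {π : V → U}

theorem ne {x y : V} (_ : J.Contracts J' π) (h : π x ≠ π y) : x ≠ y := fun h' => h (congrArg π h')

theorem exists_adj (h : J.Contracts J' π) {u v : U} (huv : J'.Adj u v) :
    ∃ x y, π x = u ∧ π y = v ∧ J.Adj x y := by
  rcases huv with h1 | h1
  · obtain ⟨x, rfl⟩ := h.surj u
    obtain ⟨y, rfl⟩ := h.surj v
    exact ⟨x, y, rfl, rfl, .inl (h.sAdj x y h1)⟩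
  · obtain ⟨-, x, y, rfl, rfl, h2⟩ := h.semi u v h1
    exact ⟨x, y, rfl, rfl, adj_iff.2 ⟨h.ne h1.1, h2⟩⟩

theorem exists_anti (h : J.Contracts J' π) {u v : U} (huv : J'.Anti u v) :
    ∃ x y, π x = u ∧ π y = v ∧ J.Anti x y := by
  rcases huv with h1 | h1
  · obtain ⟨x, rfl⟩ := h.surj u
    obtain ⟨y, rfl⟩ := h.surj v
    exact ⟨x, y, rfl, rfl, .inl (h.sAnti x y h1)⟩
  · obtain ⟨⟨x, y, rfl, rfl, h2⟩, -⟩ := h.semi u v h1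
    exact ⟨x, y, rfl, rfl, anti_iff.2 ⟨h.ne h1.1, h2⟩⟩

theorem adj (h : J.Contracts J' π) {x y : V} (h1 : J'.Adj (π x) (π y))
    (h2 : ¬ J'.Semi (π x) (π y)) : J.Adj x y := .inl (h.sAdj x y (h1.resolve_right h2))

theorem anti (h : J.Contracts J' π) {x y : V} (h1 : J'.Anti (π x) (π y))
    (h2 : ¬ J'.Semi (π x) (π y)) : J.Anti x y := .inl (h.sAnti x y (h1.resolve_right h2))

/-- Only semiadjacent pairs restrict the choice of preimages of a claw. They form a matching, so
after permuting the leaves at most `ab` and `cd` are semiadjacent, and preimages can be chosen for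
these two pairs independently. -/
theorem clawFree (h : J.Contracts J' π) (hJ : J.ClawFree) : J'.ClawFree := by
  have aux (a b c d : U) (h1 : J'.Adj a b) (h2 : J'.Adj a c) (h3 : J'.Adj a d) (h4 : J'.Anti b c)
      (h5 : J'.Anti b d) (h6 : J'.Anti c d) (n1 : ¬ J'.Semi a c) (n2 : ¬ J'.Semi a d)
      (n3 : ¬ J'.Semi b c) (n4 : ¬ J'.Semi b d) : False := by
    obtain ⟨a, b, rfl, rfl, h7⟩ := h.exists_adj h1
    obtain ⟨c, d, rfl, rfl, h8⟩ := h.exists_anti h6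
    exact hJ a b c d ⟨h7, h.adj h2 n1, h.adj h3 n2, h.anti h4 n3, h.anti h5 n4, h8⟩
  rintro a b c d ⟨h1, h2, h3, h4, h5, h6⟩
  by_cases s1 : J'.Semi a b
  · exact aux a b c d h1 h2 h3 h4 h5 h6 (fun s => h4.ne (s1.eq s)) (fun s => h5.ne (s1.eq s))
      (fun s => h2.ne (s1.symm.eq s)) (fun s => h3.ne (s1.symm.eq s))
  by_cases s2 : J'.Semi a c
  · exact aux a c b d h2 h1 h3 h4.symm h6 h5 s1 (fun s => h6.ne (s2.eq s))
      (fun s => h1.ne (s2.symm.eq s)) (fun s => h3.ne (s2.symm.eq s))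
  by_cases s3 : J'.Semi a d
  · exact aux a d b c h3 h1 h2 h5.symm h6.symm h4 s1 s2
      (fun s => h1.ne (s3.symm.eq s)) (fun s => h2.ne (s3.symm.eq s))
  by_cases s4 : J'.Semi b c
  · exact aux a d b c h3 h1 h2 h5.symm h6.symm h4 s1 s2 (fun s => h6.ne (s4.eq s.symm))
      (fun s => h5.ne (s4.symm.eq s.symm))
  by_cases s5 : J'.Semi b d
  · exact aux a c b d h2 h1 h3 h4.symm h6 h5 s1 s3 (fun s => s4 s.symm)
      (fun s => h4.ne (s5.symm.eq s.symm))
  exact aux a b c d h1 h2 h3 h4 h5 h6 s2 s3 s4 s5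

theorem isStripe (h : J.Contracts J' π) {Z : Set V} {Z' : Set U} (hJ : J.IsStripe Z)
    (hZ : Z = π ⁻¹' Z') (hsemi : ∀ z ∈ Z', ∀ u, ¬ J'.Semi z u) : J'.IsStripe Z' := by
  subst hZ
  have adj' {z u : U} (hz : z ∈ Z') (hzu : J'.Adj z u) : J'.SAdj z u :=
    hzu.resolve_right (hsemi z hz u)
  refine ⟨h.clawFree hJ.1, ?_, ?_, ?_⟩
  · intro z hz
    have key : ∀ u v, J'.Adj z u → J'.Adj z v → u ≠ v → J'.SAdj u v := by
      intro u v hu hv huv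
      by_contra hn
      obtain ⟨x, y, rfl, rfl, hxy⟩ := h.exists_anti (anti_iff.2 ⟨huv, hn⟩)
      obtain ⟨z, rfl⟩ := h.surj z
      exact hxy.not_sAdj (hJ.2.1 z hz (.inr (.inl (h.sAdj _ _ (adj' hz hu))))
        (.inr (.inl (h.sAdj _ _ (adj' hz hv)))) hxy.ne)
    rintro u (rfl | hu) v (rfl | hv) huv
    · exact absurd rfl huv
    · exact adj' hz hv
    · exact (adj' hz hu).symm
    · exact key u v hu hv huv
  · intro z hz z' hz' hne
    rcases J'.trichotomy hne with h1 | h1 | h1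
    · obtain ⟨x, rfl⟩ := h.surj z
      obtain ⟨y, rfl⟩ := h.surj z'
      exact absurd (hJ.2.2.1 hz hz' (h.ne hne)) (h.sAdj x y h1).not_sAnti
    · exact absurd h1 (hsemi z hz z')
    · exact h1
  · intro v hv z hz z' hz' h1 h2
    obtain ⟨v, rfl⟩ := h.surj v
    obtain ⟨x, rfl⟩ := h.surj z
    obtain ⟨y, rfl⟩ := h.surj z'
    exact congrArg π (hJ.2.2.2 v hv x hz y hz' (.inl (h.sAdj _ _ (adj' hz h1.symm).symm))
      (.inl (h.sAdj _ _ (adj' hz' h2.symm).symm)))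

theorem strongClique (h : J.Contracts J' π) {A : Set U} (hA : J'.StrongClique A) :
    J.StrongClique (π ⁻¹' A) := by
  intro x hx y hy hne
  by_cases hπ : π x = π y
  · exact h.fibre x y hne hπ
  · exact h.sAdj x y (hA hx hy hπ)

theorem sAnticomplete (h : J.Contracts J' π) {A B : Set U} (hA : J'.SAnticomplete A B) :
    J.SAnticomplete (π ⁻¹' A) (π ⁻¹' B) := fun x hx y hy => h.sAnti x y (hA _ hx _ hy)

theorem not_stronglyStable (h : J.Contracts J' π) {A : Set U} (hA : ¬ J'.StronglyStable A) :
    ¬ J.StronglyStable (π ⁻¹' A) := by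
  intro hs
  refine hA fun u hu v hv huv => ?_
  by_contra hn
  obtain ⟨x, y, rfl, rfl, hxy⟩ := h.exists_adj (adj_iff.2 ⟨huv, hn⟩)
  exact hxy.not_sAnti (hs hu hv hxy.ne)

theorem isBipartition {A B : Set U} (hAB : IsBipartition A B) :
    IsBipartition (π ⁻¹' A) (π ⁻¹' B) :=
  ⟨hAB.1.preimage π, by rw [← Set.preimage_union, hAB.2, Set.preimage_univ]⟩

theorem hasZeroJoin (h : J.Contracts J' π) (hJ : J'.HasZeroJoin) : J.HasZeroJoin := by
  obtain ⟨A, B, h1, h2, h3, h4⟩ := hJ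
  exact ⟨_, _, isBipartition h1, h.sAnticomplete h2, h3.preimage h.surj, h4.preimage h.surj⟩

theorem hasPseudoOneJoin (h : J.Contracts J' π) (hJ : J'.HasPseudoOneJoin) :
    J.HasPseudoOneJoin := by
  obtain ⟨V₁, V₂, A₁, A₂, h1, h2, h3, h4, h5, h6, h7, h8⟩ := hJ
  exact ⟨_, _, π ⁻¹' A₁, π ⁻¹' A₂, isBipartition h1, Set.preimage_mono h2, Set.preimage_mono h3,
    h.strongClique h4, h.sAnticomplete h5, h.sAnticomplete h6, h.not_stronglyStable h7,
    h.not_stronglyStable h8⟩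

theorem hasPseudoTwoJoin (h : J.Contracts J' π) (hJ : J'.HasPseudoTwoJoin) :
    J.HasPseudoTwoJoin := by
  obtain ⟨V₀, V₁, V₂, A₁, A₂, B₁, B₂, h1, h2, h3, h4, h5, h6, h7, h8, h9, h10, h11, h12, h13, h14,
    h15, h16, h17⟩ := hJ
  refine ⟨π ⁻¹' V₀, π ⁻¹' V₁, π ⁻¹' V₂, π ⁻¹' A₁, π ⁻¹' A₂, π ⁻¹' B₁, π ⁻¹' B₂, h1.preimage π,
    h2.preimage π, h3.preimage π, ?_, Set.preimage_mono h5, Set.preimage_mono h6, h7.preimage π,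
    Set.preimage_mono h8, Set.preimage_mono h9, h10.preimage π, h.strongClique h11,
    h.strongClique h12, ?_, ?_, ?_, h.not_stronglyStable h16, h.not_stronglyStable h17⟩
  · rw [← Set.preimage_union, ← Set.preimage_union, h4, Set.preimage_univ]
  · exact fun x hx y hy => h.sAnti x y (h13 _ hx _ hy)
  · exact fun x hx y hy => h.sAnti x y (h14 _ hx _ hy)
  · exact fun x hx y hy hA hB => h.sAnti x y (h15 _ hx _ hy hA hB)

end Contracts

/-! ### Smallest contractions of a stripe -/

/-- `J'` is obtained from `(J, Z)` by contracting strong cliques disjoint from `Z`. -/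
structure StripeContracts (J : Trigraph V) (Z : Set V) (J' : Trigraph U) (Z' : Set U)
    (π : V → U) : Prop extends J.Contracts J' π where
  stripe : J.IsStripe Z
  stripe' : J'.IsStripe Z'
  ends : Z = π ⁻¹' Z'
  inj : ∀ x y, π x ∈ Z' → π x = π y → x = y

theorem IsStripe.not_semi {Z : Set V} (h : J.IsStripe Z) {z x : V} (hz : z ∈ Z) :
    ¬ J.Semi z x := fun h' =>
  (Anti.not_sAdj (.inr h')) (h.2.1 z hz (Set.mem_insert _ _) (.inr (.inr h')) h'.1)

/-- Contraction along an idempotent map. -/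
theorem StripeContracts.contract {Z : Set V} {Z' : Set U} {π : V → U}
    (h : J.StripeContracts Z J' Z' π) (c : U → U) (hcc : ∀ x, c (c x) = c x)
    (K : Trigraph {x // c x = x}) (hfib : ∀ x y, x ≠ y → c x = c y → J'.SAdj x y)
    (h1 : ∀ x y, K.SAdj ⟨c x, hcc x⟩ ⟨c y, hcc y⟩ → J'.SAdj x y)
    (h2 : ∀ x y, K.SAnti ⟨c x, hcc x⟩ ⟨c y, hcc y⟩ → J'.SAnti x y)
    (h3 : ∀ u v, K.Semi u v → (∃ x y, c x = u ∧ c y = v ∧ ¬ J'.SAdj x y) ∧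
      ∃ x y, c x = u ∧ c y = v ∧ ¬ J'.SAnti x y)
    (hZ : ∀ x, c x ∈ Z' ∨ x ∈ Z' → c x = x)
    (hsemi : ∀ u v, K.Semi u v → J'.Semi u v ∨ u.1 ∉ Z') :
    ∃ (Z₁ : Set {x // c x = x}) (π₁ : V → {x // c x = x}), J.StripeContracts Z K Z₁ π₁ := by
  have hc : J'.Contracts K fun x => ⟨c x, hcc x⟩ := by
    refine ⟨fun u => ⟨u, Subtype.ext u.2⟩, fun x y hne hxy => hfib x y hne (congrArg Subtype.val hxy), h1, h2,
      fun u v huv => ?_⟩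
    obtain ⟨⟨x, y, h4, h5, h6⟩, ⟨x', y', h7, h8, h9⟩⟩ := h3 u v huv
    exact ⟨⟨x, y, Subtype.ext h4, Subtype.ext h5, h6⟩, ⟨x', y', Subtype.ext h7, Subtype.ext h8, h9⟩⟩
  have hZ' : Z' = (fun x => (⟨c x, hcc x⟩ : {x // c x = x})) ⁻¹' {x | x.1 ∈ Z'} := by
    ext x
    refine ⟨fun hx => ?_, fun hx => ?_⟩
    · change c x ∈ Z'
      rwa [hZ x (.inr hx)]
    · rwa [← hZ x (.inl hx)]
  refine ⟨{x | x.1 ∈ Z'}, _, h.toContracts.trans hc, h.stripe, hc.isStripe h.stripe' hZ' ?_, ?_, ?_⟩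
  · intro z hz v hzv
    rcases hsemi z v hzv with h4 | h4
    exacts [h.stripe'.not_semi hz h4, h4 hz]
  · rw [h.ends, Set.preimage_comp, ← hZ']
  · intro x y hx hxy
    have hx : c (π x) ∈ Z' := hx
    have hxy : c (π x) = c (π y) := congrArg Subtype.val hxy
    have h4 := hZ _ (.inl hx)
    rw [hxy] at hx
    have h5 := hZ _ (.inl hx)
    rw [h5] at hx
    have h6 : π x = π y := by rw [← h4, hxy, h5]
    exact h.inj x y (by rwa [h6]) h6

/-- A stripe without joins is a thickening of an almost-unbreakable stripe. -/
theorem IsStripe.isThickeningOfAlmostUnbreakable [Finite V] {Z : Set V} (hJ : J.IsStripe Z)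
    (h0 : ¬ J.HasZeroJoin) (h1 : ¬ J.HasPseudoOneJoin) (h2 : ¬ J.HasPseudoTwoJoin) :
    J.IsThickeningOfAlmostUnbreakable Z := by
  classical
  -- The trivial contraction, along a bijection onto `Fin`, which also brings the vertex set into
  -- `Type`.
  have hex : ∃ (m : ℕ) (T : Type) (_ : Finite T) (J' : Trigraph T) (Z' : Set T) (π : V → T),
      Nat.card T = m ∧ J.StripeContracts Z J' Z' π := by
    let e := Finite.equivFin V
    let J' : Trigraph (Fin (Nat.card V)) :=
      { φ := fun x y => J.φ (e.symm x) (e.symm y)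
        diag := fun x => J.diag _
        symm := fun x y => J.symm _ _
        matching := fun x y z h1 h2 h3 => J.matching _ _ _ (by simpa) (by simpa) (by simpa) }
    have hc : J.Contracts J' e := by
      refine ⟨e.surjective, fun x y hne h => absurd (e.injective h) hne, ?_, ?_, ?_⟩
      · intro x y h
        simpa [J', SAdj] using h
      · intro x y h
        simpa [J', SAnti] using h
      · rintro u v ⟨h, h'⟩
        have h : J.Semi (e.symm u) (e.symm v) := ⟨by simpa using h, h'⟩
        exact ⟨⟨_, _, by simp, by simp, Anti.not_sAdj (.inr h)⟩,
          ⟨_, _, by simp, by simp, Adj.not_sAnti (.inr h)⟩⟩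
    have hZ : Z = e ⁻¹' (e.symm ⁻¹' Z) := by
      ext
      simp
    refine ⟨_, Fin (Nat.card V), inferInstance, J', e.symm ⁻¹' Z, e, rfl, hc, hJ,
      hc.isStripe hJ hZ ?_, hZ, fun x y _ h => e.injective h⟩
    rintro z hz u ⟨h3, h4⟩
    exact hJ.not_semi (z := e.symm z) (x := e.symm u) hz ⟨by simpa using h3, h4⟩
  obtain ⟨T, hT, J', Z', π, hm, h⟩ := Nat.find_spec hex
  -- Contracting along a map that moves some vertex leaves fewer fixed points than vertices, against
  -- minimality.
  have hmin : ∀ (c : T → T) (x : T), c x ≠ x → ∀ (K : Trigraph {x // c x = x}) Z₁ π₁,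
      ¬ J.StripeContracts Z K Z₁ π₁ := by
    intro c x hx K Z₁ π₁ h'
    refine Nat.find_min hex ?_ ⟨_, inferInstance, K, Z₁, π₁, rfl, h'⟩
    rw [← hm]
    have := Finite.card_subtype_lt (p := fun x => c x = x) hx
    exact this
  refine ⟨T, hT, J', Z', ⟨h.stripe', fun h' => h0 (h.hasZeroJoin h'),
    fun h' => h1 (h.hasPseudoOneJoin h'), fun h' => h2 (h.hasPseudoTwoJoin h'), ?_, ?_⟩,
    h.stripe, h.stripe', _, h.isThickeningVia, ?_, ?_⟩
  · rintro ⟨u, v, hu, hv, huv, ht⟩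
    -- Twins: merge `v` into `u`.
    let c : T → T := fun x => if x = v then u else x
    have hv' : c v = u := if_pos rfl
    have hx' {x : T} (hx : x ≠ v) : c x = x := if_neg hx
    have hcc (x : T) : c (c x) = c x := by
      by_cases hx : x = v
      · rw [hx, hv', hx' huv.ne]
      · rw [hx' hx, hx' hx]
    let K : Trigraph {x // c x = x} :=
      { φ := fun x y => J'.φ x y
        diag := fun x => J'.diag _
        symm := fun x y => J'.symm _ _
        matching := fun x y z h1 h2 h3 => J'.matching _ _ _ (fun e => h1 (Subtype.ext e))
          (fun e => h2 (Subtype.ext e)) fun e => h3 (Subtype.ext e) }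
    have key (R : T → T → Prop) (hR : ∀ {x y}, R x y → R y x) (hne : ∀ {x y}, R x y → x ≠ y)
        (hw : ∀ w, w ≠ u → w ≠ v → R w u → R w v) (x y : T) (hxy : R (c x) (c y)) : R x y := by
      have hne' := hne hxy
      by_cases hxv : x = v
      · subst hxv
        by_cases hyv : y = x
        · subst hyv
          exact absurd rfl hne'
        · rw [hv', hx' hyv] at *
          exact hR (hw y hne'.symm hyv (hR hxy))
      · by_cases hyv : y = v
        · subst hyv
          rw [hv', hx' hxv] at *
          exact hw x hne' hxv hxy
        · rwa [hx' hxv, hx' hyv] at hxy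
    suffices hcon : ∃ Z₁ π₁, J.StripeContracts Z K Z₁ π₁ by
      obtain ⟨Z₁, π₁, h'⟩ := hcon
      exact hmin c v (by rw [hv']; exact huv.ne) K Z₁ π₁ h'
    refine h.contract c hcc K ?_ ?_ ?_ ?_ ?_ ?_
    · intro x y hne hxy
      by_cases hxv : x = v
      · rw [hxv, hv', hx' (by rw [← hxv]; exact hne.symm)] at hxy
        rw [hxv, ← hxy]
        exact huv.symm
      · by_cases hyv : y = v
        · rw [hyv, hv', hx' hxv] at hxy
          rw [hxy, hyv]
          exact huv
        · rw [hx' hxv, hx' hyv] at hxy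
          exact absurd hxy hne
    · exact key J'.SAdj SAdj.symm SAdj.ne fun w hwu hwv hw =>
        ((ht w hwu hwv).resolve_right fun h' => hw.not_sAnti h'.1).2
    · exact key J'.SAnti SAnti.symm SAnti.ne fun w hwu hwv hw =>
        ((ht w hwu hwv).resolve_left fun h' => h'.1.not_sAnti hw).2
    · rintro x y ⟨h3, h4⟩
      have h5 : J'.Semi x y := ⟨fun e => h3 (Subtype.ext e), h4⟩
      exact ⟨⟨x, y, x.2, y.2, Anti.not_sAdj (.inr h5)⟩, ⟨x, y, x.2, y.2, Adj.not_sAnti (.inr h5)⟩⟩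
    · rintro x hx
      by_cases hxv : x = v
      · subst hxv
        rw [hv'] at hx
        tauto
      · exact hx' hxv
    · exact fun x y h3 => .inl ⟨fun e => h3.1 (Subtype.ext e), h3.2⟩
  · rintro ⟨A, B, ⟨⟨hAB, hA, hB, hom⟩, hnc, hna, hnt⟩, hZA, hZB⟩
    rw [Set.disjoint_left] at hAB hZA hZB
    have hne : A.Nonempty ∧ B.Nonempty := by
      simp only [SAnticomplete, not_forall] at hna
      obtain ⟨a, ha, b, hb, -⟩ := hna
      exact ⟨⟨a, ha⟩, ⟨b, hb⟩⟩
    obtain ⟨⟨a, ha⟩, ⟨b, hb⟩⟩ := hne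
    have hab : a ≠ b := by
      rintro rfl
      exact hAB ha hb
    -- W-join: shrink `A` to `a` and `B` to `b`, which become semiadjacent.
    let c : T → T := fun x => if x ∈ A then a else if x ∈ B then b else x
    have hcA {x : T} (hx : x ∈ A) : c x = a := if_pos hx
    have hcB {x : T} (hx : x ∈ B) : c x = b := by
      simp only [c]
      rw [if_neg fun h' => hAB h' hx, if_pos hx]
    have hcn {x : T} (hx : x ∉ A) (hx' : x ∉ B) : c x = x := by
      simp only [c]
      rw [if_neg hx, if_neg hx']
    have cases (x : T) : x ∈ A ∧ c x = a ∨ x ∈ B ∧ c x = b ∨ (x ∉ A ∧ x ∉ B) ∧ c x = x := by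
      by_cases hx : x ∈ A
      · exact .inl ⟨hx, hcA hx⟩
      · by_cases hx' : x ∈ B
        · exact .inr (.inl ⟨hx', hcB hx'⟩)
        · exact .inr (.inr ⟨⟨hx, hx'⟩, hcn hx hx'⟩)
    have hcc (x : T) : c (c x) = c x := by
      rcases cases x with ⟨hx, e⟩ | ⟨hx, e⟩ | ⟨hx, e⟩
      · rw [e, hcA ha]
      · rw [e, hcB hb]
      · rw [e, e]
    -- By homogeneity no outside vertex is semiadjacent to `A ∪ B`; so declaring `a` and `b`
    -- semiadjacent keeps the semiadjacent pairs a matching.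
    have hom' {x y : T} (hx : x ∉ A ∧ x ∉ B) (hy : y ∈ A ∨ y ∈ B) : J'.φ x y ≠ 0 := by
      obtain ⟨h3, h4⟩ := hom x (by simpa using hx)
      intro h5
      rcases hy with hy | hy
      · rcases h3 with h3 | h3
        · simpa [SAdj, h5] using h3 x rfl y hy
        · simpa [SAnti, h5] using h3 x rfl y hy
      · rcases h4 with h3 | h3
        · simpa [SAdj, h5] using h3 x rfl y hy
        · simpa [SAnti, h5] using h3 x rfl y hy
    have fixed {x : T} (hx : c x = x) (hx1 : x ≠ a) (hx2 : x ≠ b) : x ∉ A ∧ x ∉ B :=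
      ⟨fun h' => hx1 (hx.symm.trans (hcA h')), fun h' => hx2 (hx.symm.trans (hcB h'))⟩
    let K : Trigraph {x // c x = x} :=
      { φ := fun x y => if x.1 = a ∧ y.1 = b ∨ x.1 = b ∧ y.1 = a then 0 else J'.φ x y
        diag := fun x => by simp [J'.diag]
        symm := fun x y => by simp only [J'.symm y x, and_comm, or_comm]
        matching := by
          rintro ⟨x, hx⟩ ⟨y, hy⟩ ⟨z, hz⟩ hxy hxz hyz ⟨h3, h4⟩
          simp only [ne_eq, Subtype.mk.injEq] at hxy hxz hyz h3 h4
          have only {w : T} (hw : c w = w) (hxw : x ≠ w) (hwx : J'.φ x w = 0) (hwn : ¬ (x = a ∧ w = b ∨ x = b ∧ w = a)) :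
              x ≠ a ∧ x ≠ b := by
            have hw0 : J'.φ w x = 0 := (J'.symm w x).trans hwx
            constructor
            · rintro rfl
              exact hom' (fixed hw hxw.symm fun e => hwn (.inl ⟨rfl, e⟩)) (.inl ha) hw0
            · rintro rfl
              exact hom' (fixed hw (fun e => hwn (.inr ⟨rfl, e⟩)) hxw.symm) (.inr hb) hw0
          split_ifs at h3 h4 with c1 c2 c2
          · rcases c1 with c1 | c1 <;> rcases c2 with c2 | c2 <;> simp_all
          · have := only hz hxz h4 c2
            tauto
          · have := only hy hxy h3 c1
            tauto
          · exact J'.matching x y z hxy hxz hyz ⟨h3, h4⟩ }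
    have hKab {x y : T} (hx : c x = x) (hy : c y = y)
        (hxy : ¬ (x = a ∧ y = b ∨ x = b ∧ y = a)) : K.φ ⟨x, hx⟩ ⟨y, hy⟩ = J'.φ x y := if_neg hxy
    have hK0 {x y : T} (hx : c x = x) (hy : c y = y)
        (hxy : x = a ∧ y = b ∨ x = b ∧ y = a) : K.φ ⟨x, hx⟩ ⟨y, hy⟩ = 0 := if_pos hxy
    -- Treats strong adjacency (`i = 1`) and strong antiadjacency (`i = -1`) at once.
    have key (i : SignType) (hi : i ≠ 0) (hw : ∀ w, w ∉ A ∧ w ∉ B →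
        (J'.φ w a = i → ∀ x ∈ A, J'.φ w x = i) ∧ (J'.φ w b = i → ∀ x ∈ B, J'.φ w x = i))
        (x y : T) (hxy : K.φ ⟨c x, hcc x⟩ ⟨c y, hcc y⟩ = i) : J'.φ x y = i := by
      have hne : c x ≠ c y := by
        intro e
        have := K.diag ⟨c x, hcc x⟩
        simp only [e] at this
        simp only [e] at hxy
        exact hi (hxy.symm.trans this)
      have hnab : ¬ (c x = a ∧ c y = b ∨ c x = b ∧ c y = a) := by
        intro h'
        rw [hK0 _ _ h'] at hxy
        exact hi hxy.symm
      rw [hKab _ _ hnab] at hxy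
      rcases cases x with ⟨hx, e⟩ | ⟨hx, e⟩ | ⟨hx, e⟩ <;>
        rcases cases y with ⟨hy, e'⟩ | ⟨hy, e'⟩ | ⟨hy, e'⟩ <;> rw [e, e'] at hxy hne hnab
      · exact absurd rfl hne
      · exact absurd (.inl ⟨rfl, rfl⟩) hnab
      · rw [J'.symm] at hxy ⊢
        exact (hw y hy).1 hxy x hx
      · exact absurd (.inr ⟨rfl, rfl⟩) hnab
      · exact absurd rfl hne
      · rw [J'.symm] at hxy ⊢
        exact (hw y hy).2 hxy x hx
      · exact (hw x hx).1 hxy y hy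
      · exact (hw x hx).2 hxy y hy
      · exact hxy
    suffices hcon : ∃ Z₁ π₁, J.StripeContracts Z K Z₁ π₁ by
      obtain ⟨Z₁, π₁, h'⟩ := hcon
      -- Of two distinct members of `A`, or of `B`, at most one is fixed by `c`.
      rcases hnt with ⟨x, hx, y, hy, hxy⟩ | ⟨x, hx, y, hy, hxy⟩
      · by_cases e : c x = x
        · refine hmin c y ?_ K Z₁ π₁ h'
          rwa [hcA hy, ← hcA hx, e]
        · exact hmin c x e K Z₁ π₁ h'
      · by_cases e : c x = x
        · refine hmin c y ?_ K Z₁ π₁ h'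
          rwa [hcB hy, ← hcB hx, e]
        · exact hmin c x e K Z₁ π₁ h'
    refine h.contract c hcc K ?_ ?_ ?_ ?_ ?_ ?_
    · intro x y hne hxy
      rcases cases x with ⟨hx, e⟩ | ⟨hx, e⟩ | ⟨hx, e⟩ <;>
        rcases cases y with ⟨hy, e'⟩ | ⟨hy, e'⟩ | ⟨hy, e'⟩ <;> rw [e, e'] at hxy
      · exact hA hx hy hne
      · exact absurd hxy hab
      · exact absurd (hxy ▸ ha) hy.1
      · exact absurd hxy.symm hab
      · exact hB hx hy hne
      · exact absurd (hxy ▸ hb) hy.2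
      · exact absurd (hxy ▸ ha) hx.1
      · exact absurd (hxy ▸ hb) hx.2
      · exact absurd hxy hne
    · refine key 1 (by decide) fun w hw => ?_
      obtain ⟨h3, h4⟩ := hom w (by simpa using hw)
      exact ⟨fun h5 => (h3.resolve_right fun h6 => SAdj.not_sAnti h5 (h6 w rfl a ha)) w rfl,
        fun h5 => (h4.resolve_right fun h6 => SAdj.not_sAnti h5 (h6 w rfl b hb)) w rfl⟩
    · refine key (-1) (by decide) fun w hw => ?_
      obtain ⟨h3, h4⟩ := hom w (by simpa using hw)
      exact ⟨fun h5 => (h3.resolve_left fun h6 => (h6 w rfl a ha).not_sAnti h5) w rfl,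
        fun h5 => (h4.resolve_left fun h6 => (h6 w rfl b hb).not_sAnti h5) w rfl⟩
    · rintro ⟨x, hx⟩ ⟨y, hy⟩ ⟨h3, h4⟩
      by_cases hxy : x = a ∧ y = b ∨ x = b ∧ y = a
      · simp only [SComplete, SAnticomplete, not_forall] at hnc hna
        obtain ⟨p, hp, q, hq, hpq⟩ := hnc
        obtain ⟨p', hp', q', hq', hpq'⟩ := hna
        rcases hxy with ⟨rfl, rfl⟩ | ⟨rfl, rfl⟩
        · exact ⟨⟨p, q, hcA hp, hcB hq, hpq⟩, ⟨p', q', hcA hp', hcB hq', hpq'⟩⟩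
        · exact ⟨⟨q, p, hcB hq, hcA hp, fun h => hpq h.symm⟩,
            ⟨q', p', hcB hq', hcA hp', fun h => hpq' h.symm⟩⟩
      · rw [hKab hx hy hxy] at h4
        have h5 : J'.Semi x y := ⟨fun e => h3 (Subtype.ext e), h4⟩
        exact ⟨⟨x, y, hx, hy, Anti.not_sAdj (.inr h5)⟩, ⟨x, y, hx, hy, Adj.not_sAnti (.inr h5)⟩⟩
    · rintro x hx
      rcases cases x with ⟨hxA, e⟩ | ⟨hxB, e⟩ | ⟨-, e⟩
      · rw [e] at hx
        exact hx.elim (fun h' => absurd ha (hZA h')) fun h' => absurd hxA (hZA h')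
      · rw [e] at hx
        exact hx.elim (fun h' => absurd hb (hZB h')) fun h' => absurd hxB (hZB h')
      · exact e
    · rintro ⟨x, hx⟩ ⟨y, hy⟩ ⟨h3, h4⟩
      by_cases hxy : x = a ∧ y = b ∨ x = b ∧ y = a
      · right
        rcases hxy with ⟨rfl, -⟩ | ⟨rfl, -⟩
        · exact fun h' => hZA h' ha
        · exact fun h' => hZB h' hb
      · rw [hKab hx hy hxy] at h4
        exact .inl ⟨fun e => h3 (Subtype.ext e), h4⟩
  · intro z hz
    obtain ⟨x, rfl⟩ := h.surj z
    refine ⟨x, Set.eq_singleton_iff_unique_mem.2 ⟨rfl, fun y hy => ?_⟩⟩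
    exact (h.inj x y hz (Eq.symm hy)).symm
  · rw [h.ends]
    ext
    simp

end Trigraph

namespace Trigraph

universe u v

variable {V : Type u} {U : Type v}

/-! ### Joins give rise to splits -/

/-- The data of a pseudo-2-join. -/
def IsPseudoTwoJoin (G : Trigraph V) (V₀ V₁ V₂ A₁ A₂ B₁ B₂ : Set V) : Prop :=
  Disjoint V₀ V₁ ∧ Disjoint V₀ V₂ ∧ Disjoint V₁ V₂ ∧ V₀ ∪ V₁ ∪ V₂ = Set.univ ∧
    A₁ ⊆ V₁ ∧ B₁ ⊆ V₁ ∧ Disjoint A₁ B₁ ∧ A₂ ⊆ V₂ ∧ B₂ ⊆ V₂ ∧ Disjoint A₂ B₂ ∧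
    G.StrongClique (V₀ ∪ A₁ ∪ A₂) ∧ G.StrongClique (V₀ ∪ B₁ ∪ B₂) ∧
    (∀ x ∈ V₀, ∀ y ∈ V₁ \ (A₁ ∪ B₁), G.SAnti x y) ∧
    (∀ x ∈ V₀, ∀ y ∈ V₂ \ (A₂ ∪ B₂), G.SAnti x y) ∧
    (∀ x ∈ V₁, ∀ y ∈ V₂, ¬ (x ∈ A₁ ∧ y ∈ A₂) → ¬ (x ∈ B₁ ∧ y ∈ B₂) → G.SAnti x y) ∧
    ¬ G.StronglyStable V₁ ∧ ¬ G.StronglyStable V₂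

variable {G : Trigraph V}

theorem IsPseudoTwoJoin.swapAB {V₀ V₁ V₂ A₁ A₂ B₁ B₂ : Set V}
    (h : G.IsPseudoTwoJoin V₀ V₁ V₂ A₁ A₂ B₁ B₂) : G.IsPseudoTwoJoin V₀ V₁ V₂ B₁ B₂ A₁ A₂ := by
  obtain ⟨h1, h2, h3, h4, h5, h6, h7, h8, h9, h10, h11, h12, h13, h14, h15, h16, h17⟩ := h
  exact ⟨h1, h2, h3, h4, h6, h5, h7.symm, h9, h8, h10.symm, h12, h11,
    fun x hx y hy => h13 x hx y (by rwa [Set.union_comm]),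
    fun x hx y hy => h14 x hx y (by rwa [Set.union_comm]),
    fun x hx y hy hA hB => h15 x hx y hy hB hA, h16, h17⟩

theorem IsPseudoTwoJoin.swap {V₀ V₁ V₂ A₁ A₂ B₁ B₂ : Set V}
    (h : G.IsPseudoTwoJoin V₀ V₁ V₂ A₁ A₂ B₁ B₂) : G.IsPseudoTwoJoin V₀ V₂ V₁ A₂ A₁ B₂ B₁ := by
  obtain ⟨h1, h2, h3, h4, h5, h6, h7, h8, h9, h10, h11, h12, h13, h14, h15, h16, h17⟩ := h
  exact ⟨h2, h1, h3.symm, by rwa [Set.union_right_comm], h8, h9, h10, h5, h6, h7,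
    by rwa [Set.union_right_comm], by rwa [Set.union_right_comm], h14, h13,
    fun x hx y hy hA hB => (h15 y hy x hx (by tauto) (by tauto)).symm, h17, h16⟩

theorem StronglyStable.subset {X Y : Set V} (h : G.StronglyStable Y) (hXY : X ⊆ Y) :
    G.StronglyStable X := Set.Pairwise.mono hXY h

/-- Without `A₁` only the second clique meets `V₁`, so `V₀` can be moved to the side of `V₂`. -/
theorem IsPseudoTwoJoin.hasPseudoOneJoin {V₀ V₁ V₂ A₂ B₁ B₂ : Set V}
    (h : G.IsPseudoTwoJoin V₀ V₁ V₂ ∅ A₂ B₁ B₂) : G.HasPseudoOneJoin := by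
  obtain ⟨h1, h2, h3, h4, -, h6, -, h8, h9, -, -, h12, h13, -, h15, h16, h17⟩ := h
  refine ⟨V₁, V₀ ∪ V₂, B₁, V₀ ∪ B₂, ⟨Set.disjoint_union_right.2 ⟨h1.symm, h3⟩, ?_⟩, h6,
    Set.union_subset_union_right _ h9, ?_, ?_, ?_, h16,
    fun h' => h17 (h'.subset Set.subset_union_right)⟩
  · rw [← h4]
    ext
    simp only [Set.mem_union]
    tauto
  · convert h12 using 1
    ext
    simp only [Set.mem_union]
    tauto
  · rintro x ⟨hx, hxB⟩ y (hy | hy)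
    · exact (h13 y hy x ⟨hx, by simpa using hxB⟩).symm
    · exact h15 x hx y hy (by simp) (fun h' => hxB h'.1)
  · rintro x ⟨hx, hxB⟩ y hy
    simp only [Set.mem_union, not_or] at hx hxB
    exact (h15 y hy x (hx.resolve_left hxB.1) (by simp) (fun h' => hxB.2 h'.2)).symm

/-- Some split of the whole vertex set has on both sides a vertex outside `Z`. -/
def HasSplit (G : Trigraph V) (Z : Set V) : Prop := ∃ C E P Q a₁ a₂ b₁ b₂,
  G.Split Set.univ C E P Q a₁ a₂ b₁ b₂ ∧ (∃ x ∈ P, x ∉ Z) ∧ ∃ x ∈ Q, x ∉ Z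

theorem IsBipartition.mem_or {A B : Set V} (h : IsBipartition A B) (x : V) : x ∈ A ∨ x ∈ B := by
  have : x ∈ A ∪ B := h.2 ▸ Set.mem_univ x
  exact this

theorem hasSplit_of_sAnticomplete {Z A B : Set V} (h : IsBipartition A B)
    (hAB : G.SAnticomplete A B) (hA : ∃ x ∈ A, x ∉ Z) (hB : ∃ x ∈ B, x ∉ Z) : G.HasSplit Z := by
  obtain ⟨x, hx, hxZ⟩ := hA
  refine ⟨∅, ∅, A, B, x, x, x, x, ?_, ⟨x, hx, hxZ⟩, hB⟩
  have : ∀ ⦃x⦄, x ∈ A → x ∉ B := Set.disjoint_left.1 h.1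
  constructor <;> simp_all [StrongClique, h.mem_or]
  exact hAB

/-- This is why pseudo-joins ask for sides that are not strongly stable: each side has a vertex that
is not a terminal. -/
theorem exists_not_mem_of_not_stronglyStable {Z A : Set V} (hZ : G.StronglyStable Z)
    (hA : ¬ G.StronglyStable A) : ∃ x ∈ A, x ∉ Z := by
  by_contra! h
  exact hA (hZ.subset h)

/-- A side containing a terminal also contains its neighbour outside `Z`. For strips the assumption
on `Z` is nullity zero. -/
theorem hasSplit_of_hasZeroJoin {Z : Set V} (hZ' : ∀ z ∈ Z, ∃ v, v ∉ Z ∧ G.Adj z v)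
    (h : G.HasZeroJoin) : G.HasSplit Z := by
  obtain ⟨A, B, h1, h2, ⟨x, hx⟩, ⟨y, hy⟩⟩ := h
  have key {A B : Set V} (h1 : IsBipartition A B) (h2 : G.SAnticomplete A B) {x : V} (hx : x ∈ A) :
      ∃ x ∈ A, x ∉ Z := by
    by_cases hxZ : x ∈ Z
    · obtain ⟨v, hv, hxv⟩ := hZ' x hxZ
      exact ⟨v, (h1.mem_or v).resolve_right fun h' => hxv.not_sAnti (h2 x hx v h'), hv⟩
    · exact ⟨x, hx, hxZ⟩
  exact hasSplit_of_sAnticomplete h1 h2 (key h1 h2 hx)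
    (key ⟨h1.1.symm, by rw [Set.union_comm, h1.2]⟩ (fun x hx y hy => (h2 y hy x hx).symm) hy)

/-- A nonempty clique of a split must reach both sides. If `A₁` or `A₂` is empty, the two sides are
strongly anticomplete, and both cliques are taken empty. -/
theorem hasSplit_of_hasPseudoOneJoin {Z : Set V} (hZ : G.StronglyStable Z)
    (h : G.HasPseudoOneJoin) : G.HasSplit Z := by
  obtain ⟨V₁, V₂, A₁, A₂, h1, h2, h3, h4, h5, h6, h7, h8⟩ := h
  have h7' := exists_not_mem_of_not_stronglyStable hZ h7
  have h8' := exists_not_mem_of_not_stronglyStable hZ h8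
  have hdis : ∀ ⦃x⦄, x ∈ V₁ → x ∉ V₂ := Set.disjoint_left.1 h1.1
  rcases A₁.eq_empty_or_nonempty with rfl | ⟨a₁, ha₁⟩
  · exact hasSplit_of_sAnticomplete h1 (by simpa using h5) h7' h8'
  rcases A₂.eq_empty_or_nonempty with rfl | ⟨a₂, ha₂⟩
  · exact hasSplit_of_sAnticomplete h1 (fun x hx y hy => (h6 y (by simpa using hy) x hx).symm) h7' h8'
  refine ⟨A₁ ∪ A₂, ∅, V₁, V₂, a₁, a₂, a₁, a₁, ?_, h7', h8'⟩
  exact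
    { cliqueC := h4
      cliqueE := by simp [StrongClique]
      subC := Set.subset_univ _
      subE := Set.subset_univ _
      subP := Set.subset_univ _
      subQ := Set.subset_univ _
      cover := fun x _ => by have := h1.mem_or x; tauto
      not_mem_Q := hdis
      centreP := by simp
      centreQ := by simp
      cross := by
        intro x hx y hy hxy _
        by_cases hxA : x ∈ A₁
        · exact (h6 y ⟨hy, fun h' => hxy ⟨.inl hxA, .inr h'⟩⟩ x hx).symm
        · exact h5 x ⟨hx, hxA⟩ y hy
      centre := by simp
      endC := fun _ => ⟨.inl ha₁, h2 ha₁, .inr ha₂, h3 ha₂⟩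
      endE := by simp }

/-- If one of the four sets is empty, the join degenerates to a pseudo-1-join; otherwise their
elements serve as the ends of the two cliques. -/
theorem hasSplit_of_hasPseudoTwoJoin {Z : Set V} (hZ : G.StronglyStable Z)
    (h : G.HasPseudoTwoJoin) : G.HasSplit Z := by
  obtain ⟨V₀, V₁, V₂, A₁, A₂, B₁, B₂, h⟩ := h
  have h : G.IsPseudoTwoJoin V₀ V₁ V₂ A₁ A₂ B₁ B₂ := h
  rcases A₁.eq_empty_or_nonempty with rfl | ⟨a₁, ha₁⟩
  · exact hasSplit_of_hasPseudoOneJoin hZ h.hasPseudoOneJoin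
  rcases A₂.eq_empty_or_nonempty with rfl | ⟨a₂, ha₂⟩
  · exact hasSplit_of_hasPseudoOneJoin hZ h.swap.hasPseudoOneJoin
  rcases B₁.eq_empty_or_nonempty with rfl | ⟨b₁, hb₁⟩
  · exact hasSplit_of_hasPseudoOneJoin hZ h.swapAB.hasPseudoOneJoin
  rcases B₂.eq_empty_or_nonempty with rfl | ⟨b₂, hb₂⟩
  · exact hasSplit_of_hasPseudoOneJoin hZ h.swapAB.swap.hasPseudoOneJoin
  obtain ⟨h1, h2, h3, h4, h5, h6, h7, h8, h9, h10, h11, h12, h13, h14, h15, h16, h17⟩ := h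
  rw [Set.disjoint_left] at h1 h2 h3 h7 h10
  have cov (x : V) : (x ∈ V₀ ∨ x ∈ V₁) ∨ x ∈ V₂ := by
    have : x ∈ V₀ ∪ V₁ ∪ V₂ := h4 ▸ Set.mem_univ x
    exact this
  have hP {x : V} (hx : x ∈ V₁) : (x ∈ V₀ ∪ A₁ ∪ A₂ ↔ x ∈ A₁) ∧ (x ∈ V₀ ∪ B₁ ∪ B₂ ↔ x ∈ B₁) := by
    have e1 : x ∉ V₀ := fun h' => h1 h' hx
    have e2 : x ∉ A₂ := fun h' => h3 hx (h8 h')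
    have e3 : x ∉ B₂ := fun h' => h3 hx (h9 h')
    simp [e1, e2, e3]
  have hQ {x : V} (hx : x ∈ V₂) : (x ∈ V₀ ∪ A₁ ∪ A₂ ↔ x ∈ A₂) ∧ (x ∈ V₀ ∪ B₁ ∪ B₂ ↔ x ∈ B₂) := by
    have e1 : x ∉ V₀ := fun h' => h2 h' hx
    have e2 : x ∉ A₁ := fun h' => h3 (h5 h') hx
    have e3 : x ∉ B₁ := fun h' => h3 (h6 h') hx
    simp [e1, e2, e3]
  refine ⟨V₀ ∪ A₁ ∪ A₂, V₀ ∪ B₁ ∪ B₂, V₁, V₂, a₁, a₂, b₁, b₂, ?_,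
    exists_not_mem_of_not_stronglyStable hZ h16, exists_not_mem_of_not_stronglyStable hZ h17⟩
  exact
    { cliqueC := h11
      cliqueE := h12
      subC := Set.subset_univ _
      subE := Set.subset_univ _
      subP := Set.subset_univ _
      subQ := Set.subset_univ _
      cover := fun x _ => by
        rcases cov x with (h' | h') | h'
        · exact .inr (.inr ⟨.inl (.inl h'), .inl (.inl h')⟩)
        · exact .inl h'
        · exact .inr (.inl h')
      not_mem_Q := fun x hx hx' => h3 hx hx'
      centreP := fun x hx hC hE => h7 ((hP hx).1.1 hC) ((hP hx).2.1 hE)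
      centreQ := fun x hx hC hE => h10 ((hQ hx).1.1 hC) ((hQ hx).2.1 hE)
      cross := fun x hx y hy hC hE => by
        rw [(hP hx).1, (hQ hy).1] at hC
        rw [(hP hx).2, (hQ hy).2] at hE
        exact h15 x hx y hy hC hE
      centre := fun x hC hE y _ hyC hyE => by
        have hx : x ∈ V₀ := by
          rcases cov x with (h' | h') | h'
          · exact h'
          · exact absurd ((hP h').2.1 hE) (h7 ((hP h').1.1 hC))
          · exact absurd ((hQ h').2.1 hE) (h10 ((hQ h').1.1 hC))
        rcases cov y with (h' | h') | h'
        · exact absurd (.inl (.inl h')) hyC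
        · rw [(hP h').1] at hyC
          rw [(hP h').2] at hyE
          exact h13 x hx y ⟨h', by simp [hyC, hyE]⟩
        · rw [(hQ h').1] at hyC
          rw [(hQ h').2] at hyE
          exact h14 x hx y ⟨h', by simp [hyC, hyE]⟩
      endC := fun _ => ⟨.inl (.inr ha₁), h5 ha₁, .inr ha₂, h8 ha₂⟩
      endE := fun _ => ⟨.inl (.inr hb₁), h6 hb₁, .inr hb₂, h9 hb₂⟩ }

/-- Splits of an induced subtrigraph. -/
theorem Split.map {J : Trigraph U} {ι : V → U} (hι : Function.Injective ι)
    (hJ : ∀ x y, J.φ (ι x) (ι y) = G.φ x y) {C E P Q : Set V} {a₁ a₂ b₁ b₂ : V}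
    (h : G.Split Set.univ C E P Q a₁ a₂ b₁ b₂) :
    J.Split (Set.range ι) (ι '' C) (ι '' E) (ι '' P) (ι '' Q) (ι a₁) (ι a₂) (ι b₁) (ι b₂) := by
  have cl {C : Set V} (hC : G.StrongClique C) : J.StrongClique (ι '' C) := by
    rintro _ ⟨x, hx, rfl⟩ _ ⟨y, hy, rfl⟩ hne
    exact (hJ x y).trans (hC hx hy fun e => hne (congrArg ι e))
  exact
    { cliqueC := cl h.cliqueC
      cliqueE := cl h.cliqueE
      subC := Set.image_subset_range _ _
      subE := Set.image_subset_range _ _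
      subP := Set.image_subset_range _ _
      subQ := Set.image_subset_range _ _
      cover := by
        rintro _ ⟨x, rfl⟩
        simpa [hι.mem_set_image] using h.cover x (Set.mem_univ x)
      not_mem_Q := by
        rintro _ ⟨x, hx, rfl⟩
        simpa [hι.mem_set_image] using h.not_mem_Q x hx
      centreP := by
        rintro _ ⟨x, hx, rfl⟩
        simpa [hι.mem_set_image] using h.centreP x hx
      centreQ := by
        rintro _ ⟨x, hx, rfl⟩
        simpa [hι.mem_set_image] using h.centreQ x hx
      cross := by
        rintro _ ⟨x, hx, rfl⟩ _ ⟨y, hy, rfl⟩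
        simp only [hι.mem_set_image]
        exact fun h1 h2 => (hJ x y).trans (h.cross x hx y hy h1 h2)
      centre := by
        rintro _ ⟨x, hx, rfl⟩ hE _ ⟨y, rfl⟩
        simp only [hι.mem_set_image] at hE ⊢
        exact fun h1 h2 => (hJ x y).trans (h.centre x hx hE y (Set.mem_univ y) h1 h2)
      endC := by
        intro hC
        simpa [hι.mem_set_image] using h.endC hC.of_image
      endE := by
        intro hE
        simpa [hι.mem_set_image] using h.endE hE.of_image }

namespace Linkage

/-! ### The strip-structure of a linkage -/

/-- No refinement is possible. -/
def Stuck (s : Linkage V) (G : Trigraph V) : Prop :=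
  ∀ C E P Q a₁ a₂ b₁ b₂ r t, ¬ s.Refinable G C E P Q a₁ a₂ b₁ b₂ r t

variable {s : Linkage V} {p q : ℕ}

theorem Valid.stripSet_eq (hs : s.Valid G) {r t : V} (h : s.same r t) :
    s.stripSet r = s.stripSet t := by
  have e (x : V) : s.same r x ↔ s.same t x :=
    ⟨fun h' => hs.equiv.trans (hs.equiv.symm h) h', fun h' => hs.equiv.trans h h'⟩
  simp only [stripSet, e]

/-- The strip-structure described by a linkage. -/
def toStrip (hs : s.Valid G) (e : Fin p ≃ V × V) (rep : Fin q → V)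
    (hrep : ∀ v, ∃ F, s.same (rep F) v) (hinj : ∀ F F', s.same (rep F) (rep F') → F = F')
    (hq : Nonempty (Fin q)) : StripStructure G (Fin p) (Fin q) where
  ends F := {h | ∃ v, s.same (rep F) v ∧ v ∈ s.K (e h)}
  part F := {v | s.same (rep F) v}
  att F h := {v | s.same (rep F) v ∧ v ∈ s.K (e h)}
  edges_nonempty := hq
  att_subset F h _ v hv := hv.1
  part_nonempty F := ⟨rep F, hs.equiv.refl _⟩
  part_disjoint F F' hne := Set.disjoint_left.2 fun v h1 h2 =>
    hne (hinj F F' (hs.equiv.trans h1 (hs.equiv.symm h2)))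
  part_cover := Set.eq_univ_of_forall fun v => Set.mem_iUnion.2 (hrep v)
  clique h := Set.Pairwise.mono (fun v ⟨F, _, hv⟩ => hv.2) (hs.clique (e h))
  adj F₁ F₂ hne v₁ hv₁ v₂ hv₂ hadj := by
    obtain ⟨h, h1, h2⟩ := hs.cross v₁ v₂ hadj fun h' =>
      hne (hinj F₁ F₂ (hs.equiv.trans (hs.equiv.trans hv₁ h') (hs.equiv.symm hv₂)))
    refine ⟨e.symm h, ⟨⟨v₁, hv₁, ?_⟩, ⟨v₂, hv₂, ?_⟩⟩, ⟨hv₁, ?_⟩, ⟨hv₂, ?_⟩⟩ <;> simpa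
  circus F := by
    refine ⟨?_, ?_, ?_⟩
    · rintro h - x ⟨hx, hxh⟩
      refine Set.Pairwise.mono ?_ (hs.circus (e h) x hxh)
      rintro y ⟨⟨hy, hyh⟩, hxy⟩
      exact ⟨hs.equiv.trans (hs.equiv.symm hx) hy, fun h' => hyh ⟨hy, h'⟩, hxy⟩
    · rintro h - h' - hne x ⟨⟨hx, hxh⟩, ⟨-, hxh'⟩⟩ y ⟨hy, hyh⟩
      have := hs.single x ⟨e h, e h', e.injective.ne hne, hxh, hxh'⟩ y
        (hs.equiv.trans (hs.equiv.symm hx) hy)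
      subst this
      exact absurd (.inl ⟨hx, hxh⟩) hyh
    · rintro h - i - j - h1 h2 h3
      refine Set.eq_empty_of_forall_notMem ?_
      rintro x ⟨⟨⟨-, hh⟩, ⟨-, hi⟩⟩, ⟨-, hj⟩⟩
      exact hs.two _ _ _ x (e.injective.ne h1) (e.injective.ne h2) (e.injective.ne h3) hh hi hj

variable (hs : s.Valid G) (e : Fin p ≃ V × V) (rep : Fin q → V)
  (hrep : ∀ v, ∃ F, s.same (rep F) v) (hinj : ∀ F F', s.same (rep F) (rep F') → F = F')
  (hq : Nonempty (Fin q))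

/-- Only the links that meet a part are made incident with it. -/
theorem toStrip_nullity : (toStrip hs e rep hrep hinj hq).nullity = 0 := by
  have : {x : Fin q × Fin p | x.2 ∈ (toStrip hs e rep hrep hinj hq).ends x.1 ∧
      (toStrip hs e rep hrep hinj hq).att x.1 x.2 = ∅} = ∅ := by
    refine Set.eq_empty_of_forall_notMem ?_
    rintro ⟨F, h⟩ ⟨⟨v, hv⟩, h2⟩
    exact Set.notMem_empty v (h2 ▸ hv)
  rw [StripStructure.nullity, this, Set.ncard_empty]

/-- The part of a double vertex. -/
theorem toStrip_double {F : Fin q} {x : V} (hx : s.same (rep F) x) {h h' : Fin p} (hne : h ≠ h')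
    (hh : x ∈ s.K (e h)) (hh' : x ∈ s.K (e h')) :
    (toStrip hs e rep hrep hinj hq).ends F = {h, h'} ∧
      ∀ y, s.same (rep F) y ↔ y = x := by
  have h1 : ∀ y, s.same (rep F) y ↔ y = x := by
    refine fun y => ⟨fun hy => ?_, fun hy => hy ▸ hx⟩
    exact hs.single x ⟨_, _, e.injective.ne hne, hh, hh'⟩ y (hs.equiv.trans (hs.equiv.symm hx) hy)
  refine ⟨?_, h1⟩
  ext k
  simp only [toStrip, Set.mem_ofPred_eq, h1, exists_eq_left, Set.mem_insert_iff,
    Set.mem_singleton_iff]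
  constructor
  · intro hk
    by_contra! hn
    exact hs.two _ _ _ x (e.injective.ne hne) (e.injective.ne hn.1.symm)
      (e.injective.ne hn.2.symm) hh hh' hk
  · rintro (rfl | rfl)
    exacts [hh, hh']

theorem toStrip_purified : (toStrip hs e rep hrep hinj hq).Purified := by
  intro F
  by_cases hd : ∃ x h h', s.same (rep F) x ∧ h ≠ h' ∧ x ∈ s.K (e h) ∧ x ∈ s.K (e h')
  · right
    obtain ⟨x, h, h', hx, hne, hh, hh'⟩ := hd
    obtain ⟨h1, h2⟩ := toStrip_double hs e rep hrep hinj hq hx hne hh hh'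
    refine ⟨h, h', hne, h1, ⟨x, ?_⟩, ?_, ?_⟩
    · ext y
      exact h2 y
    all_goals
      ext y
      simp only [toStrip, Set.mem_ofPred_eq, h2]
      constructor
      · exact And.left
      · rintro rfl
        exact ⟨rfl, by assumption⟩
  · left
    rintro h - h' - hne
    refine Set.disjoint_left.2 fun x hx hx' => hd ⟨x, h, h', hx.1, hne, hx.2, hx'.2⟩

/-- The strip of an edge, as part of the big trigraph. -/
def stripEmb (F : Fin q) : (toStrip hs e rep hrep hinj hq).part F ⊕
    (toStrip hs e rep hrep hinj hq).ends F → V ⊕ V × V :=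
  Sum.map Subtype.val fun h => e h

theorem stripEmb_injective (F : Fin q) :
    Function.Injective (stripEmb hs e rep hrep hinj hq F) :=
  Subtype.val_injective.sumMap (e.injective.comp Subtype.val_injective)

theorem stripEmb_φ (F : Fin q) (x y) : (s.big G).φ (stripEmb hs e rep hrep hinj hq F x)
    (stripEmb hs e rep hrep hinj hq F y) =
      ((toStrip hs e rep hrep hinj hq).strip F).φ x y := by
  rcases x with ⟨x, hx⟩ | ⟨h, hh⟩ <;> rcases y with ⟨y, hy⟩ | ⟨k, hk⟩
  · rfl
  · have hx' : s.same (rep F) x := hx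
    by_cases hk' : x ∈ s.K (e k) <;>
      simp [stripEmb, big, StripStructure.strip, toStrip, hx', hk']
  · have hy' : s.same (rep F) y := hy
    by_cases hh' : y ∈ s.K (e h) <;>
      simp [stripEmb, big, StripStructure.strip, toStrip, hy', hh']
  · simp [stripEmb, big, StripStructure.strip]

theorem stripEmb_range (F : Fin q) : Set.range (stripEmb hs e rep hrep hinj hq F) =
    s.stripSet (rep F) := by
  ext z
  rcases z with x | h
  · simp [stripEmb, toStrip]
  · simp only [stripEmb, Set.mem_range, Sum.exists, Sum.map_inl, reduceCtorEq, exists_false,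
      Sum.map_inr, Sum.inr.injEq, false_or, Subtype.exists, inr_mem_stripSet]
    constructor
    · rintro ⟨k, ⟨x, hx⟩, rfl⟩
      exact ⟨x, hx⟩
    · rintro ⟨x, hx⟩
      exact ⟨e.symm h, ⟨x, by simpa using hx⟩, by simp⟩

/-- The strip embeds into the big trigraph with image `stripSet`, so a split of it would allow a
refinement. This needs representatives `r` and `t` of the two sides among the vertices of `G`. -/
theorem toStrip_not_hasSplit (hG : G.ClawFree) (hst : s.Stuck G) (F : Fin q) :
    ¬ ((toStrip hs e rep hrep hinj hq).strip F).HasSplit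
      ((toStrip hs e rep hrep hinj hq).stripEnds F) := by
  rintro ⟨C, E, P, Q, a₁, a₂, b₁, b₂, h, ⟨r, hr, hr'⟩, ⟨t, ht, ht'⟩⟩
  rcases r with r | k
  · rcases t with t | k
    · have h1 := h.map (stripEmb_injective hs e rep hrep hinj hq F)
        (stripEmb_φ hs e rep hrep hinj hq F)
      rw [stripEmb_range, hs.stripSet_eq (t := r) r.2] at h1
      exact hst _ _ _ _ _ _ _ _ r t ⟨hG, hs, h1, ⟨_, hr, rfl⟩, ⟨_, ht, rfl⟩⟩
    · exact ht' ⟨k, rfl⟩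
  · exact hr' ⟨k, rfl⟩

/-- A part with a double vertex is a singleton with exactly two links, hence a spot. Any other strip
is a stripe, and a join of it would give a split. -/
theorem toStrip_stripsAreBasic [Finite V] (hG : G.ClawFree) (hst : s.Stuck G) :
    (toStrip hs e rep hrep hinj hq).StripsAreBasic := by
  intro F
  set S := toStrip hs e rep hrep hinj hq with hS
  have sAdj_inl_inr {x : S.part F} {h : S.ends F} (hx : (x : V) ∈ S.att F h) :
      (S.strip F).SAdj (.inl x) (.inr h) := by
    simp [SAdj, StripStructure.strip, hx]
  have adj_inl_inr {x : S.part F} {h : S.ends F} (hx : (S.strip F).Adj (.inl x) (.inr h)) :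
      (x : V) ∈ S.att F h := by
    by_contra hn
    exact hx.not_sAnti (by simp [SAnti, StripStructure.strip, hn])
  have sAnti_inr_inr {h k : S.ends F} (hne : h ≠ k) : (S.strip F).SAnti (.inr h) (.inr k) := by
    simp [SAnti, StripStructure.strip, hne]
  by_cases hd : ∃ x h h', s.same (rep F) x ∧ h ≠ h' ∧ x ∈ s.K (e h) ∧ x ∈ s.K (e h')
  · left
    obtain ⟨x, h, h', hx, hne, hh, hh'⟩ := hd
    obtain ⟨h1, h2⟩ := toStrip_double hs e rep hrep hinj hq hx hne hh hh'
    have hhe : h ∈ S.ends F := ⟨x, hx, hh⟩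
    have hhe' : h' ∈ S.ends F := ⟨x, hx, hh'⟩
    refine ⟨.inl ⟨x, hx⟩, .inr ⟨h, hhe⟩, .inr ⟨h', hhe'⟩, ?_, sAdj_inl_inr ⟨hx, hh⟩,
      sAdj_inl_inr ⟨hx, hh'⟩, sAnti_inr_inr fun e => hne (congrArg Subtype.val e), ?_⟩
    · symm
      refine Set.eq_univ_of_forall ?_
      rintro (⟨y, hy⟩ | ⟨k, hk⟩)
      · simp [(h2 y).1 hy]
      · have : k = h ∨ k = h' := by
          rw [h1] at hk
          exact hk
        rcases this with rfl | rfl <;> simp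
    · ext z
      rcases z with y | ⟨k, hk⟩
      · simp [StripStructure.stripEnds]
      · have : k = h ∨ k = h' := by
          rw [h1] at hk
          exact hk
        rcases this with rfl | rfl <;> simp [StripStructure.stripEnds]
  · right
    have hcf : (S.strip F).ClawFree := by
      have hcf := hs.clawFreeOn hG (r := rep F) (by
        rintro x hx ⟨h, h', hne, hh, hh'⟩
        exact hd ⟨x, e.symm h, e.symm h', hx, e.symm.injective.ne hne, by simpa, by simpa⟩)
      have hφ := stripEmb_φ hs e rep hrep hinj hq F
      have hr := stripEmb_range hs e rep hrep hinj hq F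
      have hi := stripEmb_injective hs e rep hrep hinj hq F
      have hadj {x y} (h : (S.strip F).Adj x y) : (s.big G).Adj
          (stripEmb hs e rep hrep hinj hq F x) (stripEmb hs e rep hrep hinj hq F y) := by
        simp only [Adj, SAdj, Semi, hφ] at h ⊢
        exact h.imp id fun h => ⟨hi.ne h.1, h.2⟩
      have hanti {x y} (h : (S.strip F).Anti x y) : (s.big G).Anti
          (stripEmb hs e rep hrep hinj hq F x) (stripEmb hs e rep hrep hinj hq F y) := by
        simp only [Anti, SAnti, Semi, hφ] at h ⊢
        exact h.imp id fun h => ⟨hi.ne h.1, h.2⟩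
      rintro a b c d ⟨h1, h2, h3, h4, h5, h6⟩
      rw [← hr] at hcf
      exact hcf _ ⟨a, rfl⟩ _ ⟨b, rfl⟩ _ ⟨c, rfl⟩ _ ⟨d, rfl⟩
        ⟨hadj h1, hadj h2, hadj h3, hanti h4, hanti h5, hanti h6⟩
    have hstable : (S.strip F).StronglyStable (S.stripEnds F) := by
      rintro _ ⟨h, rfl⟩ _ ⟨k, rfl⟩ hne
      exact sAnti_inr_inr fun e => hne (congrArg _ e)
    have hstripe : (S.strip F).IsStripe (S.stripEnds F) := by
      refine ⟨hcf, ?_, hstable, ?_⟩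
      · rintro _ ⟨h, rfl⟩
        have nb {z} (hz : (S.strip F).Adj (.inr h) z) :
            ∃ x : S.part F, z = .inl x ∧ (x : V) ∈ S.att F h := by
          rcases z with x | k
          · exact ⟨x, rfl, adj_inl_inr hz.symm⟩
          · exact absurd (sAnti_inr_inr fun e => hz.ne (congrArg _ e)) hz.not_sAnti
        rintro z (rfl | hz) w (rfl | hw) hne
        · exact absurd rfl hne
        · obtain ⟨x, rfl, hx⟩ := nb hw
          exact (sAdj_inl_inr hx).symm
        · obtain ⟨x, rfl, hx⟩ := nb hz
          exact sAdj_inl_inr hx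
        · obtain ⟨x, rfl, hx⟩ := nb hz
          obtain ⟨y, rfl, hy⟩ := nb hw
          exact hs.clique _ hx.2 hy.2 fun e => hne (congrArg _ (Subtype.ext e))
      · rintro (x | k) hv _ ⟨h, rfl⟩ _ ⟨h', rfl⟩ h1 h2
        · by_contra hne
          exact hd ⟨x, h, h', x.2, fun e => hne (congrArg _ (Subtype.ext e)), (adj_inl_inr h1).2,
            (adj_inl_inr h2).2⟩
        · exact absurd ⟨k, rfl⟩ hv
    have hno := toStrip_not_hasSplit hs e rep hrep hinj hq hG hst F
    refine hstripe.isThickeningOfAlmostUnbreakable (fun h => hno (hasSplit_of_hasZeroJoin ?_ h))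
      (fun h => hno (hasSplit_of_hasPseudoOneJoin hstable h))
      (fun h => hno (hasSplit_of_hasPseudoTwoJoin hstable h))
    rintro _ ⟨⟨h, x, hx, hxh⟩, rfl⟩
    exact ⟨.inl ⟨x, hx⟩, by simp [StripStructure.stripEnds],
      .inl (sAdj_inl_inr (h := ⟨h, x, hx, hxh⟩) ⟨hx, hxh⟩).symm⟩

/-- The linkage with a single part and no linking cliques. -/
def trivial (V : Type u) : Linkage V := ⟨fun _ _ => True, fun _ => ∅⟩

theorem trivial_valid : (trivial V).Valid G := by
  constructor <;> simp [trivial, Double, StrongClique]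
  exact ⟨fun _ => by simp, fun _ => by simp, fun _ _ => by simp⟩

theorem exists_stuck [Finite V] (G : Trigraph V) : ∃ s : Linkage V, s.Valid G ∧ s.Stuck G := by
  obtain ⟨s, hs, hmin⟩ := (_root_.measure
    fun s : {s : Linkage V // s.Valid G} => s.1.measure).wf.has_min Set.univ ⟨⟨trivial V, trivial_valid⟩, Set.mem_univ _⟩
  refine ⟨s, s.2, fun C E P Q a₁ a₂ b₁ b₂ r t h => ?_⟩
  exact hmin ⟨_, h.refine_valid⟩ (Set.mem_univ _) h.measure_lt

end Linkage

/-- Every claw-free trigraph has a strip-structure as required. -/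
theorem exists_stripStructure [Finite V] [Nonempty V] (hG : G.ClawFree) :
    ∃ (p q : ℕ) (S : StripStructure G (Fin p) (Fin q)),
      S.Purified ∧ S.nullity = 0 ∧ S.StripsAreBasic := by
  obtain ⟨s, hs, hst⟩ := Linkage.exists_stuck G
  let r : Setoid V := ⟨s.same, hs.equiv⟩
  let e := (Finite.equivFin (V × V)).symm
  let f := (Finite.equivFin (Quotient r)).symm
  let rep : Fin (Nat.card (Quotient r)) → V := fun F => (f F).out
  have hrep : ∀ v, ∃ F, s.same (rep F) v := by
    refine fun v => ⟨f.symm (Quotient.mk r v), ?_⟩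
    simp only [rep, Equiv.apply_symm_apply]
    exact Quotient.mk_out (s := r) v
  have hinj : ∀ F F', s.same (rep F) (rep F') → F = F' := by
    intro F F' h
    have := Quotient.sound (s := r) h
    simpa [rep] using this
  have hq : Nonempty (Fin (Nat.card (Quotient r))) :=
    (hrep (Classical.arbitrary V)).nonempty
  exact ⟨_, _, Linkage.toStrip hs e rep hrep hinj hq, Linkage.toStrip_purified hs e rep hrep hinj hq,
    Linkage.toStrip_nullity hs e rep hrep hinj hq,
    Linkage.toStrip_stripsAreBasic hs e rep hrep hinj hq hG hst⟩

end Trigraph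

namespace Trigraph

universe v

/-! ### Searching for splits -/

section Guess

variable {D : Type v} (J : Trigraph D) (S C E : Set D)

/-- The common closed neighbourhood in `S` of two strongly adjacent vertices. -/
def link (a₁ a₂ : D) : Set D :=
  {x | x ∈ S ∧ J.SAdj a₁ a₂ ∧ (x = a₁ ∨ J.SAdj x a₁) ∧ (x = a₂ ∨ J.SAdj x a₂)}

/-- Extension by all vertices of `S` outside `C ∩ E` that can be reached along an edge that is
contained neither in `C` nor in `E`. -/
def spread (R : Set D) : Set D :=
  {x | x ∈ R ∨ x ∈ S ∧ ¬ (x ∈ C ∧ x ∈ E) ∧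
    ∃ y, y ∈ R ∧ J.SAdj x y ∧ ¬ (x ∈ C ∧ y ∈ C) ∧ ¬ (x ∈ E ∧ y ∈ E)}

/-- All vertices that can be reached from `R`. -/
def reach (R : Set D) : Set D := (J.spread S C E)^[Nat.card D] R

variable {J S C E}

theorem subset_spread (R : Set D) : R ⊆ J.spread S C E R := fun _ => .inl

theorem subset_iterate_spread (R : Set D) (m : ℕ) : R ⊆ (J.spread S C E)^[m] R := by
  induction m with
  | zero => exact subset_rfl
  | succ m ih =>
    rw [Function.iterate_succ_apply']
    exact ih.trans (subset_spread _)

theorem iterate_spread_subset {R P : Set D} (hR : R ⊆ P) (hP : J.spread S C E P ⊆ P) (m : ℕ) :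
    (J.spread S C E)^[m] R ⊆ P := by
  induction m with
  | zero => exact hR
  | succ m ih =>
    rw [Function.iterate_succ_apply']
    rintro x (hx | ⟨h1, h2, y, hy, h3⟩)
    · exact ih hx
    · exact hP (.inr ⟨h1, h2, y, ih hy, h3⟩)

/-- Until it becomes stationary, the growing sequence gains a vertex in every step, so `Nat.card D`
steps are enough. -/
theorem spread_reach [Finite D] (R : Set D) : J.spread S C E (J.reach S C E R) = J.reach S C E R := by
  have key (m : ℕ) : J.spread S C E ((J.spread S C E)^[m] R) = (J.spread S C E)^[m] R ∨
      m ≤ ((J.spread S C E)^[m] R).ncard := by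
    induction m with
    | zero => exact .inr (Nat.zero_le _)
    | succ m ih =>
      rw [Function.iterate_succ_apply']
      rcases ih with h | h
      · left
        rw [h, h]
      · by_cases h' : J.spread S C E ((J.spread S C E)^[m] R) = (J.spread S C E)^[m] R
        · left
          rw [h', h']
        · right
          have := Set.ncard_lt_ncard ((subset_spread _).ssubset_of_ne (Ne.symm h'))
          omega
  rcases key (Nat.card D) with h | h
  · exact h
  · have : (J.spread S C E)^[Nat.card D] R = Set.univ := by
      refine Set.eq_of_subset_of_ncard_le (Set.subset_univ _) ?_
      rwa [Set.ncard_univ]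
    rw [reach, this]
    exact Set.eq_univ_of_univ_subset (subset_spread _)

variable (J S)

/-- The six given vertices determine a split of `S`. -/
structure GoodGuess (a₁ a₂ b₁ b₂ u t : D) (C E R : Set D) : Prop where
  a₁_mem : a₁ ∈ S
  a₂_mem : a₂ ∈ S
  b₁_mem : b₁ ∈ S
  b₂_mem : b₂ ∈ S
  u_mem : u ∈ S
  t_mem : t ∈ S
  cliqueC : ∀ x y, x ∈ C → y ∈ C → x ≠ y → J.SAdj x y
  cliqueE : ∀ x y, x ∈ E → y ∈ E → x ≠ y → J.SAdj x y
  centre : ∀ x y, x ∈ C → x ∈ E → y ∈ S → y ∉ C → y ∉ E → ¬ J.SAdj x y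
  a₁_not_mem : ¬ (a₁ ∈ C ∧ a₁ ∈ E)
  b₁_not_mem : ¬ (b₁ ∈ C ∧ b₁ ∈ E)
  u_not_mem : ¬ (u ∈ C ∧ u ∈ E)
  t_not_mem : ¬ (t ∈ C ∧ t ∈ E)
  t_not_mem' : t ∉ R
  endC : J.SAdj a₁ a₂ → a₂ ∉ R ∧ a₂ ∉ E
  endE : J.SAdj b₁ b₂ → b₂ ∉ R ∧ b₂ ∉ C

variable {J S}

/-- `Q` is everything in `S` outside the reached set and the centre. A cross edge inside neither
clique would have extended the reached set. Without semiadjacent pairs the tests on strong adjacency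
decide strong antiadjacency as well. -/
theorem GoodGuess.split [Finite D] (hJ : ∀ x y, ¬ J.Semi x y) {a₁ a₂ b₁ b₂ u t : D}
    (h : J.GoodGuess S a₁ a₂ b₁ b₂ u t (J.link S a₁ a₂) (J.link S b₁ b₂)
      (J.reach S (J.link S a₁ a₂) (J.link S b₁ b₂) {a₁, b₁, u})) :
    ∃ P Q, J.reach S (J.link S a₁ a₂) (J.link S b₁ b₂) {a₁, b₁, u} = P ∧
      J.Split S (J.link S a₁ a₂) (J.link S b₁ b₂) P Q a₁ a₂ b₁ b₂ ∧ u ∈ P ∧ t ∈ Q := by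
  set C := J.link S a₁ a₂ with hC
  set E := J.link S b₁ b₂ with hE
  set R := J.reach S C E {a₁, b₁, u} with hR
  have hsub : {a₁, b₁, u} ⊆ R := subset_iterate_spread _ _
  have hRS : R ⊆ {x | x ∈ S ∧ ¬ (x ∈ C ∧ x ∈ E)} := by
    refine iterate_spread_subset ?_ ?_ _
    · rintro x (rfl | rfl | rfl)
      exacts [⟨h.a₁_mem, h.a₁_not_mem⟩, ⟨h.b₁_mem, h.b₁_not_mem⟩, ⟨h.u_mem, h.u_not_mem⟩]
    · rintro x (hx | ⟨h1, h2, -⟩)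
      exacts [hx, ⟨h1, h2⟩]
  have anti {x y : D} (hne : x ≠ y) (hn : ¬ J.SAdj x y) : J.SAnti x y := by
    rcases J.trichotomy hne with h1 | h1 | h1
    exacts [absurd h1 hn, absurd h1 (hJ x y), h1]
  refine ⟨R, {x | x ∈ S ∧ x ∉ R ∧ ¬ (x ∈ C ∧ x ∈ E)}, rfl, ?_, hsub (by simp),
    ⟨h.t_mem, h.t_not_mem', h.t_not_mem⟩⟩
  exact
    { cliqueC := fun x hx y hy => h.cliqueC x y hx hy
      cliqueE := fun x hx y hy => h.cliqueE x y hx hy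
      subC := fun x hx => hx.1
      subE := fun x hx => hx.1
      subP := fun x hx => (hRS hx).1
      subQ := fun x hx => hx.1
      cover := fun x hx => by
        by_cases h1 : x ∈ R
        · exact .inl h1
        · by_cases h2 : x ∈ C ∧ x ∈ E
          · exact .inr (.inr h2)
          · exact .inr (.inl ⟨hx, h1, h2⟩)
      not_mem_Q := fun x hx hx' => hx'.2.1 hx
      centreP := fun x hx h1 h2 => (hRS hx).2 ⟨h1, h2⟩
      centreQ := fun x hx h1 h2 => hx.2.2 ⟨h1, h2⟩
      cross := fun x hx y hy h1 h2 => by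
        refine anti (fun e => hy.2.1 (e ▸ hx)) fun hxy => hy.2.1 ?_
        rw [hR, ← spread_reach, ← hR]
        exact .inr ⟨hy.1, hy.2.2, x, hx, hxy.symm, fun h' => h1 h'.symm, fun h' => h2 h'.symm⟩
      centre := fun x h1 h2 y h3 h4 h5 => anti (fun e => h4 (e ▸ h1)) (h.centre x y h1 h2 h3 h4 h5)
      endC := by
        rintro ⟨x, hx⟩
        have h1 := h.endC hx.2.1
        exact ⟨⟨h.a₁_mem, hx.2.1, .inl rfl, .inr hx.2.1⟩, hsub (by simp),
          ⟨h.a₂_mem, hx.2.1, .inr hx.2.1.symm, .inl rfl⟩, h.a₂_mem, h1.1, fun h' => h1.2 h'.2⟩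
      endE := by
        rintro ⟨x, hx⟩
        have h1 := h.endE hx.2.1
        exact ⟨⟨h.b₁_mem, hx.2.1, .inl rfl, .inr hx.2.1⟩, hsub (by simp),
          ⟨h.b₂_mem, hx.2.1, .inr hx.2.1.symm, .inl rfl⟩, h.b₂_mem, h1.1, fun h' => h1.2 h'.1⟩ }

/-- A vertex adjacent to both `a₁` and `a₂` is across from one of them unless it is central, and an
edge across that ends in `a₁` or `a₂`, neither of which is in `E`, must lie in `C`. -/
theorem Split.exists_link {P Q : Set D} {a₁ a₂ b₁ b₂ u : D}
    (h : J.Split S C E P Q a₁ a₂ b₁ b₂) (hu : u ∈ P) :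
    ∃ a a', J.link S a a' = C ∧ a ∈ P ∧ a' ∈ S ∧ (J.SAdj a a' → a' ∈ C ∧ a' ∈ Q) := by
  rcases C.eq_empty_or_nonempty with rfl | hC
  · refine ⟨u, u, ?_, hu, h.subP hu, fun h' => absurd rfl h'.ne⟩
    refine Set.eq_empty_of_forall_notMem fun x hx => ?_
    exact absurd rfl hx.2.1.ne
  · obtain ⟨h1, h2, h3, h4⟩ := h.endC hC
    have hne : a₁ ≠ a₂ := by
      rintro rfl
      exact h.not_mem_Q _ h2 h4
    have h12 : J.SAdj a₁ a₂ := h.cliqueC h1 h3 hne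
    refine ⟨a₁, a₂, ?_, h2, h.subC h3, fun _ => ⟨h3, h4⟩⟩
    ext x
    constructor
    · rintro ⟨hx, -, hx1, hx2⟩
      by_contra hxC
      rcases h.cover x hx with hx' | hx' | hx'
      · rcases hx2 with rfl | hx2
        · exact hxC h3
        · exact hx2.not_sAnti (h.cross x hx' a₂ h4 (fun h' => hxC h'.1)
            fun h' => h.centreQ a₂ h4 h3 h'.2)
      · rcases hx1 with rfl | hx1
        · exact hxC h1
        · exact hx1.symm.not_sAnti (h.cross a₁ h2 x hx' (fun h' => hxC h'.2)
            fun h' => h.centreP a₁ h2 h1 h'.1)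
      · exact hxC hx'.1
    · intro hx
      refine ⟨h.subC hx, h12, ?_, ?_⟩
      · by_cases e : x = a₁
        exacts [.inl e, .inr (h.cliqueC hx h1 e)]
      · by_cases e : x = a₂
        exacts [.inl e, .inr (h.cliqueC hx h3 e)]

/-- The reached set may be smaller than `P`, but it never leaves `P`, which is all the conditions on
a guess require. -/
theorem Split.exists_goodGuess {P Q : Set D} {a₁ a₂ b₁ b₂ u t : D}
    (h : J.Split S C E P Q a₁ a₂ b₁ b₂) (hu : u ∈ P) (ht : t ∈ Q) :
    ∃ a a' b b', J.GoodGuess S a a' b b' u t (J.link S a a') (J.link S b b')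
      (J.reach S (J.link S a a') (J.link S b b') {a, b, u}) := by
  obtain ⟨a, a', rfl, h1, h2, h3⟩ := h.exists_link hu
  obtain ⟨b, b', rfl, h4, h5, h6⟩ := h.swapCE.exists_link hu
  have hR : J.reach S (J.link S a a') (J.link S b b') {a, b, u} ⊆ P := by
    refine iterate_spread_subset ?_ ?_ _
    · rintro x (rfl | rfl | rfl) <;> assumption
    · rintro x (hx | ⟨hx, hx', y, hy, hxy, h7, h8⟩)
      · exact hx
      · rcases h.cover x hx with h9 | h9 | h9
        · exact h9
        · exact absurd (h.cross y hy x h9 (fun h' => h7 h'.symm) fun h' => h8 h'.symm)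
            hxy.symm.not_sAnti
        · exact absurd h9 hx'
  refine ⟨a, a', b, b', ?_⟩
  exact
    { a₁_mem := h.subP h1
      a₂_mem := h2
      b₁_mem := h.subP h4
      b₂_mem := h5
      u_mem := h.subP hu
      t_mem := h.subQ ht
      cliqueC := fun x y hx hy => h.cliqueC hx hy
      cliqueE := fun x y hx hy => h.cliqueE hx hy
      centre := fun x y h7 h8 h9 h10 h11 h12 => h12.not_sAnti (h.centre x h7 h8 y h9 h10 h11)
      a₁_not_mem := fun h' => h.centreP _ h1 h'.1 h'.2
      b₁_not_mem := fun h' => h.centreP _ h4 h'.1 h'.2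
      u_not_mem := fun h' => h.centreP _ hu h'.1 h'.2
      t_not_mem := fun h' => h.centreQ _ ht h'.1 h'.2
      t_not_mem' := fun h' => h.not_mem_Q _ (hR h') ht
      endC := fun h' => ⟨fun h7 => h.not_mem_Q _ (hR h7) (h3 h').2,
        h.centreQ _ (h3 h').2 (h3 h').1⟩
      endE := fun h' => ⟨fun h7 => h.not_mem_Q _ (hR h7) (h6 h').2,
        fun h7 => h.centreQ _ (h6 h').2 h7 (h6 h').1⟩ }

end Guess

/-! ### Guesses that refine a linkage -/

namespace Linkage

variable {V : Type v}

/-- The vertices of the strip of the part containing the vertex `u`. -/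
def stripOf (s : Linkage V) (u : V ⊕ V × V) : Set (V ⊕ V × V) :=
  {x | ∃ r, u = .inl r ∧ x ∈ s.stripSet r}

/-- The six given vertices determine a refinement of the linkage. -/
def Good (s : Linkage V) (G : Trigraph V) (a₁ a₂ b₁ b₂ u t : V ⊕ V × V) : Prop :=
  (∃ r, t = .inl r) ∧ (s.big G).GoodGuess (s.stripOf u) a₁ a₂ b₁ b₂ u t
    ((s.big G).link (s.stripOf u) a₁ a₂) ((s.big G).link (s.stripOf u) b₁ b₂)
    ((s.big G).reach (s.stripOf u) ((s.big G).link (s.stripOf u) a₁ a₂)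
      ((s.big G).link (s.stripOf u) b₁ b₂) {a₁, b₁, u})

/-- The refinement determined by six vertices. -/
def refineBy (s : Linkage V) (G : Trigraph V) (a₁ a₂ b₁ b₂ u : V ⊕ V × V) : Linkage V :=
  s.refine ((s.big G).link (s.stripOf u) a₁ a₂) ((s.big G).link (s.stripOf u) b₁ b₂)
    ((s.big G).reach (s.stripOf u) ((s.big G).link (s.stripOf u) a₁ a₂)
      ((s.big G).link (s.stripOf u) b₁ b₂) {a₁, b₁, u}) a₁ a₂ b₁ b₂

variable {s : Linkage V} {G : Trigraph V}

theorem not_semi_big (hG : ∀ x y, ¬ G.Semi x y) (x y : V ⊕ V × V) : ¬ (s.big G).Semi x y := by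
  rcases x with x | h <;> rcases y with y | k
  · exact fun h' => hG x y ⟨fun e => h'.1 (congrArg _ e), h'.2⟩
  · rintro ⟨h1, h2⟩
    simp only [big] at h2
    split_ifs at h2
  · rintro ⟨h1, h2⟩
    simp only [big] at h2
    split_ifs at h2
  · rintro ⟨h1, h2⟩
    simp only [big] at h2
    split_ifs at h2 with h3
    exact h1 (congrArg _ h3)

theorem Good.exists_refinable [Finite V] (hG : G.ClawFree) (hG' : ∀ x y, ¬ G.Semi x y)
    (hs : s.Valid G) {a₁ a₂ b₁ b₂ u t : V ⊕ V × V} (h : s.Good G a₁ a₂ b₁ b₂ u t) :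
    ∃ C E P Q r r', s.Refinable G C E P Q a₁ a₂ b₁ b₂ r r' ∧
      s.refineBy G a₁ a₂ b₁ b₂ u = s.refine C E P a₁ a₂ b₁ b₂ := by
  obtain ⟨⟨r', rfl⟩, h⟩ := h
  obtain ⟨P, Q, h1, h2, h3, h4⟩ := h.split (not_semi_big hG')
  obtain ⟨r, rfl, -⟩ := h.u_mem
  have e : s.stripOf (.inl r) = s.stripSet r := by
    ext x
    simp [stripOf]
  refine ⟨_, _, P, Q, r, r', ⟨hG, hs, ?_, h3, h4⟩, by rw [← h1]; rfl⟩
  rw [e] at h2 ⊢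
  exact h2

/-- Justifies stopping: exhaustive search over six vertices misses no refinement. -/
theorem stuck_of_not_good (h : ∀ a₁ a₂ b₁ b₂ u t, ¬ s.Good G a₁ a₂ b₁ b₂ u t) : s.Stuck G := by
  intro C E P Q a₁ a₂ b₁ b₂ r t hr
  obtain ⟨a, a', b, b', h1⟩ := hr.split.exists_goodGuess hr.leftP hr.rightQ
  have e : s.stripOf (.inl r) = s.stripSet r := by
    ext x
    simp [stripOf]
  refine h a a' b b' (.inl r) (.inl t) ⟨⟨t, rfl⟩, ?_⟩
  rw [e]
  exact h1

end Linkage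

end Trigraph

/-! ### The algorithm -/

namespace RAM

namespace Fm

def or (φ ψ : Fm) : Fm := not (and (not φ) (not ψ))

def imp (φ ψ : Fm) : Fm := not (and φ (not ψ))

def all (φ : Fm) : Fm := not (ex (not φ))

variable {n : ℕ} {inp : ℕ → Prop} {k : ℕ} {ρ : ℕ → ℕ} {I : Interp} {φ ψ : Fm}

theorem holds_or : (or φ ψ).Holds n inp k ρ I ↔ φ.Holds n inp k ρ I ∨ ψ.Holds n inp k ρ I := by
  simp only [or, Holds]
  tauto

theorem holds_imp :
    (imp φ ψ).Holds n inp k ρ I ↔ (φ.Holds n inp k ρ I → ψ.Holds n inp k ρ I) := by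
  simp only [imp, Holds]
  tauto

theorem holds_all : (all φ).Holds n inp k ρ I ↔
    ∀ v < width n, φ.Holds n inp (k + 1) (Function.update ρ k v) I := by
  simp only [all, Holds]
  push Not
  rfl

end Fm

/-- Relations `0`: adjacency, `1`: being in the same part; unary relations are stored in the first
coordinate. The variables `1, …, 6` are the guessed vertices. -/
def stripFm : Fm := .or (.rel 1 5 7) (.and (.not (.real 7)) (.ex (.and (.rel 1 5 9) (.rel 0 9 7))))

/-- Relation 2 holds the strip, 3 and 4 the cliques `C` and `E`, 5 the reached set; 6, 7 and 8 are
scratch. Variable 0 counts sweeps and 1 to 6 hold the guess, so 7 is the first one bound here. -/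
def linkFm (i j : ℕ) : Fm := .and (.rel 2 7 7) (.and (.rel 0 i j)
  (.and (.or (.eq 7 i) (.rel 0 7 i)) (.or (.eq 7 j) (.rel 0 7 j))))

def seedFm : Fm := .or (.eq 7 1) (.or (.eq 7 3) (.eq 7 5))

def spreadFm : Fm := .or (.rel 5 8 8) (.and (.rel 2 8 8) (.and (.not (.and (.rel 3 8 8) (.rel 4 8 8)))
  (.ex (.and (.rel 5 10 10) (.and (.rel 0 8 10) (.and (.not (.and (.rel 3 8 8) (.rel 3 10 10)))
    (.not (.and (.rel 4 8 8) (.rel 4 10 10)))))))))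

def cliqueFm (a : ℕ) : Fm := .all (.all (.imp (.rel a 7 7) (.imp (.rel a 8 8)
  (.imp (.not (.eq 7 8)) (.rel 0 7 8)))))

def centreFm : Fm := .all (.all (.imp (.rel 3 7 7) (.imp (.rel 4 7 7) (.imp (.rel 2 8 8)
  (.imp (.not (.rel 3 8 8)) (.imp (.not (.rel 4 8 8)) (.not (.rel 0 7 8))))))))

def outFm (i : ℕ) : Fm := .not (.and (.rel 3 i i) (.rel 4 i i))

def goodFm : Fm := .and (.real 6) (.and (.rel 2 1 1) (.and (.rel 2 2 2) (.and (.rel 2 3 3)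
  (.and (.rel 2 4 4) (.and (.rel 2 5 5) (.and (.rel 2 6 6) (.and (cliqueFm 3) (.and (cliqueFm 4)
  (.and centreFm (.and (outFm 1) (.and (outFm 3) (.and (outFm 5) (.and (outFm 6)
  (.and (.not (.rel 5 6 6)) (.and (.imp (.rel 0 1 2) (.and (.not (.rel 5 2 2)) (.not (.rel 4 2 2))))
    (.imp (.rel 0 3 4) (.and (.not (.rel 5 4 4)) (.not (.rel 3 4 4)))))))))))))))))))

/-- Membership of `x` in the new link with terminal `h`: the terminal is the one coded by the ends
`i`, `j`, and the clique stored in `a` has no old terminal. -/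
def newFm (h x a i j : ℕ) : Fm := .and (.not (.real h)) (.and (.real x) (.and (.real i)
  (.and (.real j) (.and (.code h i j) (.and (.not (.ex (.and (.not (.real 9)) (.rel a 9 9))))
    (.rel a x x))))))

def adjFm : Fm := .or (.rel 0 7 8) (.or (.or (newFm 7 8 3 1 2) (newFm 7 8 4 3 4))
  (.or (newFm 8 7 3 1 2) (newFm 8 7 4 3 4)))

def doubleFm (x : ℕ) : Fm := .ex (.ex (.and (.not (.real 9)) (.and (.not (.real 10))
  (.and (.not (.eq 9 10)) (.and (.rel 0 x 9) (.rel 0 x 10))))))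

def sameFm : Fm := .and (.real 7) (.and (.real 8) (.or (.eq 7 8) (.and (.rel 1 7 8)
  (.and (.not (doubleFm 7)) (.and (.not (doubleFm 8))
    (.and (.imp (.rel 5 7 7) (.rel 5 8 8)) (.imp (.rel 5 8 8) (.rel 5 7 7))))))))

def spreadCmd : Cmd := .seq (.fill 6 spreadFm) (.fill 5 (.rel 6 8 8))

def searchCmd : Cmd := .seq (.fill 2 stripFm) (.seq (.fill 3 (linkFm 1 2))
  (.seq (.fill 4 (linkFm 3 4)) (.seq (.fill 5 seedFm) (.loop spreadCmd))))

/-- The adjacency is replaced first, since double vertices must be computed from the new links,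
whereas `sameFm` still reads the old parts. -/
def updateCmd : Cmd := .seq (.fill 7 adjFm) (.seq (.fill 0 (.rel 7 7 8)) (.seq (.fill 8 sameFm)
  (.fill 1 (.rel 8 7 8))))

def bodyCmd : Cmd := .seq searchCmd (.ite goodFm updateCmd .nop)

def sweepCmd : Cmd := .loop (.loop (.loop (.loop (.loop (.loop bodyCmd)))))

def initCmd : Cmd := .seq (.fill 0 (.and (.real 0) (.and (.real 1) (.inp 0 1))))
  (.fill 1 (.and (.real 0) (.real 1)))

/-- The variable `0` is the least vertex of its part. -/
def repFm : Fm := .and (.real 0) (.not (.ex (.and (.lt 1 0) (.rel 1 1 0))))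

/-- Iteration over all values of the variable that satisfy `φ`. -/
def forCmd (φ : Fm) (c : Cmd) : Cmd := .loop (.ite φ c .nop)

/-- All `n * n` indices are vertices of the strip-graph, used or not; its edges are the least
vertices of the parts. -/
def emitCmd : Cmd := .seq (.count (.not (.real 0))) (.seq (.count repFm)
  (.seq (forCmd repFm (forCmd (.not (.real 1)) (.emit (.ex (.and (.rel 1 0 2) (.rel 0 2 1))))))
    (.seq (forCmd repFm (forCmd (.real 1) (.emit (.rel 1 0 1))))
      (forCmd repFm (forCmd (.not (.real 1)) (forCmd (.real 2)
        (.emit (.and (.rel 1 0 2) (.rel 0 2 1)))))))))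

def mainCmd : Cmd := .seq initCmd (.seq (.loop sweepCmd) emitCmd)

theorem mainCmd_closedAt : mainCmd.closedAt 0 := by decide

end RAM

/-! ### Numbering of vertices and meaning of the formulas -/

namespace Trigraph.Linkage

open RAM

variable {n : ℕ} {G : Trigraph (Fin n)}

/-- The number that represents a vertex of the big trigraph. -/
def num : Fin n ⊕ Fin n × Fin n → ℕ
  | .inl x => x
  | .inr h => n + (n * h.1 + h.2)

theorem num_injective : Function.Injective (num (n := n)) := by
  rintro (x | ⟨u, v⟩) (y | ⟨u', v'⟩) h
  · exact congrArg _ (Fin.ext h)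
  · simp only [num] at h
    omega
  · simp only [num] at h
    omega
  · simp only [num] at h
    have h1 : (u : ℕ) * n + v = u' * n + v' := by
      rw [Nat.mul_comm, Nat.mul_comm (u' : ℕ)]
      omega
    obtain ⟨h2, h3⟩ := (mul_add_inj v.2 v'.2).1 h1
    rw [Fin.ext h2, Fin.ext h3]

theorem num_lt (x : Fin n ⊕ Fin n × Fin n) : num x < width n := by
  rcases x with x | ⟨u, v⟩
  · simp only [num, width]
    omega
  · simp only [num, width]
    have : n * (u : ℕ) + n ≤ n * n := by
      rw [← Nat.mul_succ]
      exact Nat.mul_le_mul_left n u.2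
    omega

theorem exists_num {i : ℕ} (hi : i < width n) : ∃ x : Fin n ⊕ Fin n × Fin n, num x = i := by
  by_cases h : i < n
  · exact ⟨.inl ⟨i, h⟩, rfl⟩
  · have h1 : i - n < n * n := by
      simp only [width] at hi
      omega
    have hn : 0 < n := by
      rcases Nat.eq_zero_or_pos n with rfl | h2
      · simp at h1
      · exact h2
    refine ⟨.inr (⟨(i - n) / n, Nat.div_lt_of_lt_mul h1⟩, ⟨(i - n) % n, Nat.mod_lt _ hn⟩), ?_⟩
    simp only [num, Nat.div_add_mod]
    omega

theorem exists_lt_width {p : ℕ → Prop} :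
    (∃ i < width n, p i) ↔ ∃ x : Fin n ⊕ Fin n × Fin n, p (num x) := by
  constructor
  · rintro ⟨i, hi, h⟩
    obtain ⟨x, rfl⟩ := exists_num hi
    exact ⟨x, h⟩
  · rintro ⟨x, h⟩
    exact ⟨_, num_lt x, h⟩

theorem forall_lt_width {p : ℕ → Prop} :
    (∀ i < width n, p i) ↔ ∀ x : Fin n ⊕ Fin n × Fin n, p (num x) := by
  constructor
  · exact fun h x => h _ (num_lt x)
  · intro h i hi
    obtain ⟨x, rfl⟩ := exists_num hi
    exact h x

theorem num_inj {x y : Fin n ⊕ Fin n × Fin n} : num x = num y ↔ x = y := num_injective.eq_iff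

theorem num_lt_iff {x : Fin n ⊕ Fin n × Fin n} : num x < n ↔ ∃ u, x = .inl u := by
  rcases x with x | h <;> simp [num]

/-- The interpretation represents the linkage. -/
structure Represents (G : Trigraph (Fin n)) (s : Linkage (Fin n)) (I : Interp) : Prop where
  adj : ∀ x y, I 0 (num x) (num y) ↔ (s.big G).SAdj x y
  same : ∀ x y, I 1 (num x) (num y) ↔ ∃ u v, x = .inl u ∧ y = .inl v ∧ s.same u v

/-- The relation `a` represents the set `X`. -/
def Holding (I : Interp) (a : ℕ) (X : Set (Fin n ⊕ Fin n × Fin n)) : Prop :=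
  ∀ x y : Fin n ⊕ Fin n × Fin n, I a (num x) (num y) ↔ x ∈ X

section Body

variable {s : Linkage (Fin n)} {I : Interp} {inp : ℕ → Prop} {ρ : ℕ → ℕ}
  {a₁ a₂ b₁ b₂ u t : Fin n ⊕ Fin n × Fin n}

theorem holds_stripFm (hI : Represents G s I) (h5 : ρ 5 = num u) (x : Fin n ⊕ Fin n × Fin n) (j : ℕ) :
    stripFm.Holds n inp 9 (Function.update (Function.update ρ 7 (num x)) 8 j) I ↔
      x ∈ s.stripOf u := by
  simp only [stripFm, Fm.holds_or, Fm.Holds, exists_lt_width, Function.update_apply]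
  simp only [Nat.reduceEqDiff, if_true, if_false, h5, hI.adj, hI.same, num_lt_iff]
  rcases x with x | h
  · simp [stripOf]
  · simp only [stripOf, reduceCtorEq, false_and, exists_false, and_false, false_or, not_false_eq_true,
      true_and, Set.mem_ofPred_eq, inr_mem_stripSet]
    constructor
    · rintro ⟨_, ⟨r, v, rfl, rfl, h1⟩, h2⟩
      exact ⟨r, rfl, v, h1, by simpa using h2⟩
    · rintro ⟨r, rfl, v, h1, h2⟩
      exact ⟨.inl v, ⟨r, v, rfl, rfl, h1⟩, by simpa using h2⟩

theorem holds_linkFm {S : Set (Fin n ⊕ Fin n × Fin n)} (hI : ∀ x y, I 0 (num x) (num y) ↔ (s.big G).SAdj x y)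
    (hS : Holding I 2 S) {i j : ℕ} (hi : ρ i = num a₁) (hj : ρ j = num a₂) (hi7 : i < 7) (hj7 : j < 7)
    (x : Fin n ⊕ Fin n × Fin n) (y : ℕ) :
    (linkFm i j).Holds n inp 9 (Function.update (Function.update ρ 7 (num x)) 8 y) I ↔
      x ∈ (s.big G).link S a₁ a₂ := by
  have e1 : i ≠ 7 := by omega
  have e2 : i ≠ 8 := by omega
  have e3 : j ≠ 7 := by omega
  have e4 : j ≠ 8 := by omega
  simp only [linkFm, Fm.holds_or, Fm.Holds, Function.update_apply]
  simp only [Nat.reduceEqDiff, if_true, if_false, hi, hj, hI, hS _ _, num_inj, link,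
    Set.mem_ofPred_eq, e1, e2, e3, e4]

theorem holds_spreadFm {S C E R : Set (Fin n ⊕ Fin n × Fin n)}
    (hI : ∀ x y, I 0 (num x) (num y) ↔ (s.big G).SAdj x y) (hS : Holding I 2 S)
    (hC : Holding I 3 C) (hE : Holding I 4 E) (hR : Holding I 5 R)
    (x : Fin n ⊕ Fin n × Fin n) (y : ℕ) :
    spreadFm.Holds n inp 10 (Function.update (Function.update ρ 8 (num x)) 9 y) I ↔
      x ∈ (s.big G).spread S C E R := by
  simp only [spreadFm, Fm.holds_or, Fm.Holds, Function.update_apply, exists_lt_width]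
  simp only [Nat.reduceEqDiff, if_true, if_false, hI, hS _ _, hC _ _, hE _ _, hR _ _, spread,
    Set.mem_ofPred_eq]

theorem holds_goodFm {S C E R : Set (Fin n ⊕ Fin n × Fin n)}
    (hI : ∀ x y, I 0 (num x) (num y) ↔ (s.big G).SAdj x y) (hS : Holding I 2 S)
    (hC : Holding I 3 C) (hE : Holding I 4 E) (hR : Holding I 5 R)
    (h1 : ρ 1 = num a₁) (h2 : ρ 2 = num a₂) (h3 : ρ 3 = num b₁) (h4 : ρ 4 = num b₂)
    (h5 : ρ 5 = num u) (h6 : ρ 6 = num t) :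
    goodFm.Holds n inp 7 ρ I ↔
      (∃ r, t = .inl r) ∧ (s.big G).GoodGuess S a₁ a₂ b₁ b₂ u t C E R := by
  simp only [goodFm, cliqueFm, centreFm, outFm, Fm.holds_imp, Fm.holds_all, Fm.Holds,
    Function.update_apply, forall_lt_width]
  simp only [Nat.reduceEqDiff, if_true, if_false, hI, hS _ _, hC _ _, hE _ _, hR _ _,
    h1, h2, h3, h4, h5, h6, num_inj, num_lt_iff]
  constructor
  · rintro ⟨c0, c1, c2, c3, c4, c5, c6, c7, c8, c9, c10, c11, c12, c13, c14, c15, c16⟩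
    exact ⟨c0, c1, c2, c3, c4, c5, c6, c7, c8, c9, c10, c11, c12, c13, c14, c15, c16⟩
  · rintro ⟨c0, c1, c2, c3, c4, c5, c6, c7, c8, c9, c10, c11, c12, c13, c14, c15, c16⟩
    exact ⟨c0, c1, c2, c3, c4, c5, c6, c7, c8, c9, c10, c11, c12, c13, c14, c15, c16⟩

theorem holds_newFm {C : Set (Fin n ⊕ Fin n × Fin n)} {a h x i j : ℕ} (hC : Holding I a C)
    (hi : ρ i = num a₁) (hj : ρ j = num a₂) (h9 : h < 9) (x9 : x < 9) (i9 : i < 9) (j9 : j < 9)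
    {z w : Fin n ⊕ Fin n × Fin n} (hz : ρ h = num z) (hw : ρ x = num w) :
    (newFm h x a i j).Holds n inp 9 ρ I ↔ ∃ k v, z = .inr k ∧ w = .inl v ∧ NewLink C a₁ a₂ k ∧
      .inl v ∈ C := by
  have e1 : i ≠ 9 := by omega
  have e2 : j ≠ 9 := by omega
  have e3 : h ≠ 9 := by omega
  have e4 : x ≠ 9 := by omega
  simp only [newFm, Fm.Holds, Function.update_apply, exists_lt_width]
  simp only [if_true, hi, hj, hz, hw, num_lt_iff, hC _ _]
  constructor
  · rintro ⟨c1, ⟨v, rfl⟩, ⟨p, rfl⟩, ⟨q, rfl⟩, c5, c6, c7⟩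
    have hz : z = .inr (p, q) := num_injective c5
    refine ⟨(p, q), v, hz, rfl, ⟨rfl, rfl, fun k hk => c6 ⟨.inr k, ?_, hk⟩⟩, c7⟩
    simp
  · rintro ⟨⟨p, q⟩, v, rfl, rfl, ⟨rfl, rfl, c3⟩, c4⟩
    refine ⟨by simp, ⟨v, rfl⟩, ⟨p, rfl⟩, ⟨q, rfl⟩, rfl, ?_, c4⟩
    rintro ⟨y | k, h1, h2⟩
    · exact h1 ⟨y, rfl⟩
    · exact c3 k h2

theorem holds_adjFm {C E P : Set (Fin n ⊕ Fin n × Fin n)}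
    (hI : ∀ x y, I 0 (num x) (num y) ↔ (s.big G).SAdj x y)
    (hC : Holding I 3 C) (hE : Holding I 4 E)
    (h1 : ρ 1 = num a₁) (h2 : ρ 2 = num a₂) (h3 : ρ 3 = num b₁) (h4 : ρ 4 = num b₂)
    (x y : Fin n ⊕ Fin n × Fin n) :
    adjFm.Holds n inp 9 (Function.update (Function.update ρ 7 (num x)) 8 (num y)) I ↔
      ((s.refine C E P a₁ a₂ b₁ b₂).big G).SAdj x y := by
  have u (i : ℕ) (hi : i < 7) :
      Function.update (Function.update ρ 7 (num x)) 8 (num y) i = ρ i := by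
    rw [Function.update_of_ne (by omega), Function.update_of_ne (by omega)]
  have u7 : Function.update (Function.update ρ 7 (num x)) 8 (num y) 7 = num x := by simp
  have u8 : Function.update (Function.update ρ 7 (num x)) 8 (num y) 8 = num y := by simp
  have u1 := (u 1 (by omega)).trans h1
  have u2 := (u 2 (by omega)).trans h2
  have u3 := (u 3 (by omega)).trans h3
  have u4 := (u 4 (by omega)).trans h4
  simp only [adjFm, Fm.holds_or,
    holds_newFm hC u1 u2 (h := 7) (x := 8) (by omega) (by omega) (by omega) (by omega) u7 u8,
    holds_newFm hE u3 u4 (h := 7) (x := 8) (by omega) (by omega) (by omega) (by omega) u7 u8,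
    holds_newFm hC u1 u2 (h := 8) (x := 7) (by omega) (by omega) (by omega) (by omega) u8 u7,
    holds_newFm hE u3 u4 (h := 8) (x := 7) (by omega) (by omega) (by omega) (by omega) u8 u7]
  simp only [Fm.Holds, u7, u8, hI]
  rcases x with x | k <;> rcases y with y | k' <;> simp [mem_refine]

theorem holds_doubleFm {s : Linkage (Fin n)} (hI : ∀ x y, I 0 (num x) (num y) ↔ (s.big G).SAdj x y)
    {i : ℕ} (hi : i < 9) {x : Fin n} (hx : ρ i = num (.inl x)) :
    (doubleFm i).Holds n inp 9 ρ I ↔ s.Double x := by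
  have e1 : i ≠ 9 := by omega
  have e2 : i ≠ 10 := by omega
  simp only [doubleFm, Fm.Holds, Function.update_apply, exists_lt_width]
  simp only [Nat.reduceEqDiff, Nat.reduceAdd, if_true, if_false, e1, e2, hx, hI, num_lt_iff, num_inj]
  constructor
  · rintro ⟨y | k, y' | k', h⟩
    · exact absurd ⟨y, rfl⟩ h.1
    · exact absurd ⟨y, rfl⟩ h.1
    · exact absurd ⟨y', rfl⟩ h.2.1
    · exact ⟨k, k', by simpa using h.2.2⟩
  · rintro ⟨k, k', h⟩
    exact ⟨.inr k, .inr k', by simpa using h⟩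

theorem holds_sameFm {C E P : Set (Fin n ⊕ Fin n × Fin n)}
    (hI : ∀ x y, I 0 (num x) (num y) ↔ ((s.refine C E P a₁ a₂ b₁ b₂).big G).SAdj x y)
    (hs : ∀ x y, I 1 (num x) (num y) ↔ ∃ u v, x = .inl u ∧ y = .inl v ∧ s.same u v)
    (hP : Holding I 5 P) (x y : Fin n ⊕ Fin n × Fin n) :
    sameFm.Holds n inp 9 (Function.update (Function.update ρ 7 (num x)) 8 (num y)) I ↔
      ∃ u v, x = .inl u ∧ y = .inl v ∧ (s.refine C E P a₁ a₂ b₁ b₂).same u v := by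
  have u7 : Function.update (Function.update ρ 7 (num x)) 8 (num y) 7 = num x := by simp
  have u8 : Function.update (Function.update ρ 7 (num x)) 8 (num y) 8 = num y := by simp
  rcases x with x | k
  · rcases y with y | k'
    · simp only [sameFm, Fm.holds_or, Fm.holds_imp, Fm.Holds,
        holds_doubleFm hI (i := 7) (by omega) u7, holds_doubleFm hI (i := 8) (by omega) u8,
        u7, u8, hs, hP _ _, num_inj, num_lt_iff]
      simp only [Sum.inl.injEq, exists_eq', true_and]
      constructor
      · rintro (rfl | ⟨⟨_, _, rfl, rfl, h1⟩, h2, h3, h4, h5⟩)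
        · exact ⟨x, x, rfl, rfl, .inl rfl⟩
        · exact ⟨_, _, rfl, rfl, .inr ⟨h1, h2, h3, h4, h5⟩⟩
      · rintro ⟨_, _, rfl, rfl, rfl | h1⟩
        · exact .inl rfl
        · exact .inr ⟨⟨_, _, rfl, rfl, h1.1⟩, h1.2.1, h1.2.2.1, h1.2.2.2.1, h1.2.2.2.2⟩
    · simp [sameFm, Fm.Holds, num]
  · simp [sameFm, Fm.Holds, num]

/-- A loop runs `width n` times, which is exactly the number of vertices of the big trigraph used in
`reach`. -/
theorem exec_spread {S C E R : Set (Fin n ⊕ Fin n × Fin n)} (L : List ℕ)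
    (hI : ∀ x y, I 0 (num x) (num y) ↔ (s.big G).SAdj x y) (hS : Holding I 2 S)
    (hC : Holding I 3 C) (hE : Holding I 4 E) (hR : Holding I 5 R) :
    ∃ I', (Cmd.loop spreadCmd).exec n inp 7 ρ (I, L) = (I', L) ∧
      (∀ a, a ≠ 5 → a ≠ 6 → I' a = I a) ∧ Holding I' 5 ((s.big G).reach S C E R) := by
  have key (m : ℕ) : ∃ I', (List.range m).foldl
      (fun p i => spreadCmd.exec n inp 8 (Function.update ρ 7 i) p) (I, L) = (I', L) ∧
      (∀ a, a ≠ 5 → a ≠ 6 → I' a = I a) ∧ Holding I' 5 (((s.big G).spread S C E)^[m] R) := by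
    induction m with
    | zero => exact ⟨I, rfl, fun _ _ _ => rfl, hR⟩
    | succ m ih =>
      obtain ⟨I', h1, h2, h3⟩ := ih
      rw [List.range_succ, List.foldl_append, h1, List.foldl_cons, List.foldl_nil,
        Function.iterate_succ_apply']
      refine ⟨_, rfl, fun a h5 h6 => ?_, fun x y => ?_⟩
      · rw [Function.update_of_ne h5]
        exact (Function.update_of_ne h6 _ _).trans (h2 a h5 h6)
      · simp only [Function.update_self, Fm.Holds]
        simp only [ne_eq, Nat.reduceEqDiff, not_false_eq_true, Function.update_of_ne,
          Function.update_self]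
        refine holds_spreadFm ?_ ?_ ?_ ?_ h3 x _
        · rwa [h2 0 (by omega) (by omega)]
        · intro x y
          rw [h2 2 (by omega) (by omega)]
          exact hS x y
        · intro x y
          rw [h2 3 (by omega) (by omega)]
          exact hC x y
        · intro x y
          rw [h2 4 (by omega) (by omega)]
          exact hE x y
  have := key (width n)
  have hc : Nat.card (Fin n ⊕ Fin n × Fin n) = width n := by simp [width]
  rw [reach, hc]
  exact this

theorem exec_search (L : List ℕ) (hI : Represents G s I)
    (h1 : ρ 1 = num a₁) (h2 : ρ 2 = num a₂) (h3 : ρ 3 = num b₁) (h4 : ρ 4 = num b₂)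
    (h5 : ρ 5 = num u) :
    ∃ I', searchCmd.exec n inp 7 ρ (I, L) = (I', L) ∧ Represents G s I' ∧
      Holding I' 2 (s.stripOf u) ∧ Holding I' 3 ((s.big G).link (s.stripOf u) a₁ a₂) ∧
      Holding I' 4 ((s.big G).link (s.stripOf u) b₁ b₂) ∧
      Holding I' 5 ((s.big G).reach (s.stripOf u) ((s.big G).link (s.stripOf u) a₁ a₂)
        ((s.big G).link (s.stripOf u) b₁ b₂) {a₁, b₁, u}) := by
  set I₁ : Interp := Function.update I 2 fun x y =>
    stripFm.Holds n inp 9 (Function.update (Function.update ρ 7 x) 8 y) I with hI₁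
  set I₂ : Interp := Function.update I₁ 3 fun x y =>
    (linkFm 1 2).Holds n inp 9 (Function.update (Function.update ρ 7 x) 8 y) I₁ with hI₂
  set I₃ : Interp := Function.update I₂ 4 fun x y =>
    (linkFm 3 4).Holds n inp 9 (Function.update (Function.update ρ 7 x) 8 y) I₂ with hI₃
  set I₄ : Interp := Function.update I₃ 5 fun x y =>
    seedFm.Holds n inp 9 (Function.update (Function.update ρ 7 x) 8 y) I₃ with hI₄
  have hS₁ : Holding I₁ 2 (s.stripOf u) := fun x y => by
    rw [hI₁, Function.update_self]
    exact holds_stripFm hI h5 x _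
  have hC₂ : Holding I₂ 3 ((s.big G).link (s.stripOf u) a₁ a₂) := fun x y => by
    rw [hI₂, Function.update_self]
    exact holds_linkFm (I := I₁) hI.adj hS₁ h1 h2 (by omega) (by omega) x _
  have hE₃ : Holding I₃ 4 ((s.big G).link (s.stripOf u) b₁ b₂) := fun x y => by
    rw [hI₃, Function.update_self]
    exact holds_linkFm (I := I₂) hI.adj hS₁ h3 h4 (by omega) (by omega) x _
  have hR₄ : Holding I₄ 5 {a₁, b₁, u} := fun x y => by
    rw [hI₄, Function.update_self]
    simp only [seedFm, Fm.holds_or, Fm.Holds, Function.update_apply]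
    simp [h1, h3, h5, num_inj]
  obtain ⟨I', h6, h7, h8⟩ := exec_spread (inp := inp) (ρ := ρ) L (I := I₄) hI.adj hS₁ hC₂ hE₃ hR₄
  refine ⟨I', h6, ⟨?_, ?_⟩, ?_, ?_, ?_, h8⟩
  · rw [h7 0 (by omega) (by omega)]
    exact hI.adj
  · rw [h7 1 (by omega) (by omega)]
    exact hI.same
  · intro x y
    rw [h7 2 (by omega) (by omega)]
    exact hS₁ x y
  · intro x y
    rw [h7 3 (by omega) (by omega)]
    exact hC₂ x y
  · intro x y
    rw [h7 4 (by omega) (by omega)]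
    exact hE₃ x y

theorem exec_update {C E P : Set (Fin n ⊕ Fin n × Fin n)} (L : List ℕ) (hI : Represents G s I)
    (hC : Holding I 3 C) (hE : Holding I 4 E) (hP : Holding I 5 P)
    (h1 : ρ 1 = num a₁) (h2 : ρ 2 = num a₂) (h3 : ρ 3 = num b₁) (h4 : ρ 4 = num b₂) :
    ∃ I', updateCmd.exec n inp 7 ρ (I, L) = (I', L) ∧
      Represents G (s.refine C E P a₁ a₂ b₁ b₂) I' := by
  set I₁ : Interp := Function.update I 7 fun x y =>
    adjFm.Holds n inp 9 (Function.update (Function.update ρ 7 x) 8 y) I with hI₁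
  set I₂ : Interp := Function.update I₁ 0 fun x y =>
    (Fm.rel 7 7 8).Holds n inp 9 (Function.update (Function.update ρ 7 x) 8 y) I₁ with hI₂
  set I₃ : Interp := Function.update I₂ 8 fun x y =>
    sameFm.Holds n inp 9 (Function.update (Function.update ρ 7 x) 8 y) I₂ with hI₃
  set I₄ : Interp := Function.update I₃ 1 fun x y =>
    (Fm.rel 8 7 8).Holds n inp 9 (Function.update (Function.update ρ 7 x) 8 y) I₃ with hI₄
  have hA : ∀ x y, I₂ 0 (num x) (num y) ↔ ((s.refine C E P a₁ a₂ b₁ b₂).big G).SAdj x y := by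
    intro x y
    rw [hI₂, Function.update_self]
    simp only [Fm.Holds, Function.update_apply, Nat.reduceEqDiff, if_true, if_false, hI₁]
    exact holds_adjFm hI.adj hC hE h1 h2 h3 h4 x y
  refine ⟨I₄, rfl, hA, fun x y => ?_⟩
  rw [hI₄, Function.update_self]
  simp only [Fm.Holds, Function.update_apply, Nat.reduceEqDiff, if_true, if_false, hI₃]
  exact holds_sameFm hA hI.same hP x y

end Body

end Trigraph.Linkage

/-! ### Correctness and termination of the search -/

namespace Trigraph.Linkage

open RAM

variable {n : ℕ} {G : Trigraph (Fin n)} {inp : ℕ → Prop} {k : ℕ} {ρ : ℕ → ℕ}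

/-- The command refines linkages; a linkage is left unchanged if and only if it satisfies `Φ`. -/
def Refines (G : Trigraph (Fin n)) (inp : ℕ → Prop) (c : Cmd) (k : ℕ) (ρ : ℕ → ℕ)
    (Φ : Linkage (Fin n) → Prop) : Prop :=
  ∀ I L s, Represents G s I → s.Valid G → ∃ I' s', c.exec n inp k ρ (I, L) = (I', L) ∧
    Represents G s' I' ∧ s'.Valid G ∧ (Φ s ∧ s' = s ∨ ¬ Φ s ∧ s'.measure < s.measure)

theorem refines_bodyCmd (hG : G.ClawFree) (hG' : ∀ x y, ¬ G.Semi x y)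
    {a₁ a₂ b₁ b₂ u t : Fin n ⊕ Fin n × Fin n} (h1 : ρ 1 = num a₁) (h2 : ρ 2 = num a₂)
    (h3 : ρ 3 = num b₁) (h4 : ρ 4 = num b₂) (h5 : ρ 5 = num u) (h6 : ρ 6 = num t) :
    Refines G inp bodyCmd 7 ρ fun s => ¬ s.Good G a₁ a₂ b₁ b₂ u t := by
  intro I L s hI hs
  obtain ⟨I₁, e1, hI₁, hS, hC, hE, hR⟩ := exec_search (inp := inp) L hI h1 h2 h3 h4 h5
  have hgood := holds_goodFm (inp := inp) hI₁.adj hS hC hE hR h1 h2 h3 h4 h5 h6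
  have e3 : bodyCmd.exec n inp 7 ρ (I, L) = (Cmd.ite goodFm updateCmd .nop).exec n inp 7 ρ (I₁, L) :=
    congrArg _ e1
  rw [Cmd.exec] at e3
  by_cases hg : s.Good G a₁ a₂ b₁ b₂ u t
  · rw [if_pos (hgood.2 hg)] at e3
    obtain ⟨I₂, e2, hI₂⟩ := exec_update (inp := inp) L hI₁ hC hE hR h1 h2 h3 h4
    obtain ⟨C, E, P, Q, r, r', h7, h8⟩ := hg.exists_refinable hG hG' hs
    refine ⟨I₂, s.refineBy G a₁ a₂ b₁ b₂ u, e3.trans e2, hI₂, ?_, .inr ⟨not_not_intro hg, ?_⟩⟩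
    · rw [h8]
      exact h7.refine_valid
    · rw [h8]
      exact h7.measure_lt
  · rw [if_neg fun h => hg (hgood.1 h)] at e3
    exact ⟨I₁, s, e3, hI₁, hs, .inl ⟨hg, rfl⟩⟩

/-- The first value of the variable that violates its condition meets the original linkage and
lowers the measure; later iterations never raise it. -/
theorem Refines.loop {c : Cmd} {Φ : Fin n ⊕ Fin n × Fin n → Linkage (Fin n) → Prop}
    (h : ∀ x, Refines G inp c (k + 1) (Function.update ρ k (num x)) (Φ x)) :
    Refines G inp (.loop c) k ρ fun s => ∀ x, Φ x s := by
  intro I L s hI hs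
  have key (m : ℕ) (hm : m ≤ width n) : ∃ I' s', (List.range m).foldl
      (fun p i => c.exec n inp (k + 1) (Function.update ρ k i) p) (I, L) = (I', L) ∧
      Represents G s' I' ∧ s'.Valid G ∧ ((∀ x, num x < m → Φ x s) ∧ s' = s ∨
        (∃ x, ¬ Φ x s) ∧ s'.measure < s.measure) := by
    induction m with
    | zero => exact ⟨I, s, rfl, hI, hs, .inl ⟨fun x hx => absurd hx (Nat.not_lt_zero _), rfl⟩⟩
    | succ m ih =>
      obtain ⟨I', s', e1, hI', hs', h1⟩ := ih (by omega)
      obtain ⟨x, rfl⟩ := exists_num hm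
      obtain ⟨I'', s'', e2, hI'', hs'', h2⟩ := h x I' L s' hI' hs'
      rw [List.range_succ, List.foldl_append, e1, List.foldl_cons, List.foldl_nil]
      refine ⟨I'', s'', e2, hI'', hs'', ?_⟩
      rcases h1 with ⟨h1, rfl⟩ | ⟨h1, h1'⟩ <;> rcases h2 with ⟨h2, rfl⟩ | ⟨h2, h2'⟩
      · refine .inl ⟨fun y hy => ?_, rfl⟩
        rcases Nat.lt_succ_iff_lt_or_eq.1 hy with h3 | h3
        · exact h1 y h3
        · rwa [num_injective h3]
      · exact .inr ⟨⟨x, h2⟩, h2'⟩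
      · exact .inr ⟨h1, h1'⟩
      · exact .inr ⟨h1, h2'.trans h1'⟩
  obtain ⟨I', s', e1, hI', hs', h1⟩ := key (width n) le_rfl
  refine ⟨I', s', e1, hI', hs', ?_⟩
  rcases h1 with ⟨h1, h2⟩ | ⟨⟨x, h1⟩, h2⟩
  · exact .inl ⟨fun x => h1 x (num_lt x), h2⟩
  · exact .inr ⟨fun h' => h1 (h' x), h2⟩

theorem refines_sweepCmd (hG : G.ClawFree) (hG' : ∀ x y, ¬ G.Semi x y) :
    Refines G inp sweepCmd 1 ρ fun s => ∀ a₁ a₂ b₁ b₂ u t, ¬ s.Good G a₁ a₂ b₁ b₂ u t :=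
  Refines.loop fun _ => Refines.loop fun _ => Refines.loop fun _ => Refines.loop fun _ =>
    Refines.loop fun _ => Refines.loop fun _ => refines_bodyCmd hG hG' (by simp) (by simp)
      (by simp) (by simp) (by simp) (by simp)

theorem measure_le (s : Linkage (Fin n)) : s.measure ≤ n * n := by
  refine (Set.ncard_le_card _).trans ?_
  simp

/-- As long as good guesses remain, each sweep has lowered the measure. It starts at no more than `n
* n`, and for `n > 0` the number `n + n * n` of sweeps exceeds this. -/
theorem exec_loop_sweepCmd (hG : G.ClawFree) (hG' : ∀ x y, ¬ G.Semi x y) (hn : 0 < n)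
    {s : Linkage (Fin n)} {I : Interp} (L : List ℕ) (hI : Represents G s I) (hs : s.Valid G) :
    ∃ I' s', (Cmd.loop sweepCmd).exec n inp 0 ρ (I, L) = (I', L) ∧ Represents G s' I' ∧
      s'.Valid G ∧ s'.Stuck G := by
  have key (m : ℕ) : ∃ I' s', (List.range m).foldl
      (fun p i => sweepCmd.exec n inp 1 (Function.update ρ 0 i) p) (I, L) = (I', L) ∧
      Represents G s' I' ∧ s'.Valid G ∧ ((∀ a₁ a₂ b₁ b₂ u t, ¬ s'.Good G a₁ a₂ b₁ b₂ u t) ∨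
        s'.measure + m ≤ s.measure) := by
    induction m with
    | zero => exact ⟨I, s, rfl, hI, hs, .inr le_rfl⟩
    | succ m ih =>
      obtain ⟨I', s', e1, hI', hs', h1⟩ := ih
      obtain ⟨I'', s'', e2, hI'', hs'', h2⟩ := refines_sweepCmd hG hG' (inp := inp)
        (ρ := Function.update ρ 0 m) I' L s' hI' hs'
      rw [List.range_succ, List.foldl_append, e1, List.foldl_cons, List.foldl_nil]
      refine ⟨I'', s'', e2, hI'', hs'', ?_⟩
      rcases h2 with ⟨h2, rfl⟩ | ⟨h2, h2'⟩
      · exact .inl h2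
      · rcases h1 with h1 | h1
        · exact absurd h1 h2
        · exact .inr (by omega)
  obtain ⟨I', s', e1, hI', hs', h1⟩ := key (width n)
  refine ⟨I', s', e1, hI', hs', ?_⟩
  rcases h1 with h1 | h1
  · exact stuck_of_not_good h1
  · have := s.measure_le
    simp only [width] at h1
    omega

end Trigraph.Linkage

/-! ### Input -/

namespace List

theorem getD_flatMap_of_length_eq {α : Type*} (l : List α) (f : α → List ℕ) {m : ℕ}
    (hf : ∀ a, (f a).length = m) {i j : ℕ} (hi : i < l.length) (hj : j < m) :
    (l.flatMap f).getD (m * i + j) 0 = (f l[i]).getD j 0 := by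
  induction l generalizing i with
  | nil => simp at hi
  | cons a l ih =>
    rw [flatMap_cons]
    rcases i with _ | i
    · rw [getD_append _ _ _ _ (by simp [hf, hj])]
      simp
    · have h1 : m * (i + 1) + j = (f a).length + (m * i + j) := by
        rw [hf]
        ring
      rw [h1, getD_append_right _ _ _ _ (by omega), Nat.add_sub_cancel_left]
      exact ih (by simpa using hi)

end List

namespace SimpleGraph

variable {n : ℕ} (G : SimpleGraph (Fin n))

theorem code_getD_zero : G.code.getD 0 0 = n := rfl

theorem code_getD_ne_zero (x y : Fin n) : G.code.getD (1 + (n * x + y)) 0 ≠ 0 ↔ G.Adj x y := by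
  rw [Nat.add_comm, code, List.getD_cons_succ,
    List.getD_flatMap_of_length_eq _ _ (m := n) (by simp) (by simp) y.2]
  simp

theorem code_getD_le (i : ℕ) : G.code.getD i 0 ≤ RAM.width n + 1 := by
  have h : ∀ x ∈ G.code, x ≤ RAM.width n + 1 := by
    intro x hx
    simp only [code, List.mem_cons, List.mem_flatMap, List.mem_map] at hx
    rcases hx with rfl | ⟨i, -, j, -, rfl⟩
    · simp only [RAM.width]
      omega
    · split_ifs <;> omega
  by_cases hi : i < G.code.length
  · rw [List.getD_eq_getElem _ _ hi]
    exact h _ (List.getElem_mem hi)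
  · rw [List.getD_eq_default _ _ (by omega)]
    omega

end SimpleGraph

/-! ### The initial linkage is read from the adjacency matrix -/

namespace Trigraph

open RAM

theorem ofGraph_sAdj {V : Type*} {G : SimpleGraph V} {x y : V} :
    (ofGraph G).SAdj x y ↔ G.Adj x y := by
  simp only [SAdj, ofGraph]
  split_ifs with h1 h2
  · subst h1
    simp
  · simpa
  · simpa using h2

theorem not_semi_ofGraph {V : Type*} (G : SimpleGraph V) (x y : V) : ¬ (ofGraph G).Semi x y := by
  rintro ⟨h1, h2⟩
  simp only [ofGraph, if_neg h1] at h2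
  split_ifs at h2

theorem exec_initCmd {n : ℕ} (G : SimpleGraph (Fin n)) (ρ : ℕ → ℕ) (I : Interp) (L : List ℕ) :
    ∃ I', initCmd.exec n (fun i => G.code.getD i 0 ≠ 0) 0 ρ (I, L) = (I', L) ∧
      Linkage.Represents (ofGraph G) (Linkage.trivial (Fin n)) I' := by
  refine ⟨_, rfl, ⟨fun x y => ?_, fun x y => ?_⟩⟩
  · simp only [Cmd.exec, Fm.Holds, Function.update_apply]
    simp only [Nat.reduceEqDiff, Nat.reduceAdd, zero_ne_one, if_true, if_false]
    rcases x with x | k <;> rcases y with y | k'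
    · have := G.code_getD_ne_zero x y
      simpa [Linkage.num, ofGraph_sAdj] using this
    all_goals simp [Linkage.num, Linkage.trivial]
  · simp only [Cmd.exec, Fm.Holds, Function.update_apply]
    simp only [Nat.reduceEqDiff, Nat.reduceAdd, zero_ne_one, if_true, if_false]
    rcases x with x | k <;> rcases y with y | k' <;> simp [Linkage.num, Linkage.trivial]

end Trigraph

/-! ### Output -/

namespace RAM

open Classical

/-- The command prints the list `l` and changes nothing else. -/
def Emits (n : ℕ) (inp : ℕ → Prop) (I : Interp) (c : Cmd) (k : ℕ) (ρ : ℕ → ℕ) (l : List ℕ) : Prop :=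
  ∀ L, c.exec n inp k ρ (I, L) = (I, L ++ l)

variable {n : ℕ} {inp : ℕ → Prop} {I : Interp} {c d : Cmd} {φ : Fm} {k : ℕ} {ρ : ℕ → ℕ}
  {l l' : List ℕ}

theorem Emits.seq (hc : Emits n inp I c k ρ l) (hd : Emits n inp I d k ρ l') :
    Emits n inp I (.seq c d) k ρ (l ++ l') := fun L => by
  rw [Cmd.exec, hc L, hd, List.append_assoc]

theorem emits_emit : Emits n inp I (.emit φ) k ρ [bit (φ.Holds n inp k ρ I)] := fun _ => rfl

/-- The list `l` enumerates the values of the variable `k` that satisfy `φ`. -/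
def Enumerates (n : ℕ) (inp : ℕ → Prop) (I : Interp) (φ : Fm) (k : ℕ) (ρ : ℕ → ℕ) (l : List ℕ) :
    Prop :=
  (List.range (width n)).filter (fun i => φ.Holds n inp (k + 1) (Function.update ρ k i) I) = l

theorem Enumerates.emits_count (h : Enumerates n inp I φ k ρ l) :
    Emits n inp I (.count φ) k ρ [l.length] := fun L => by
  rw [Cmd.exec, List.countP_eq_length_filter, ← h]

theorem Enumerates.emits_forCmd {q : ℕ} {g : Fin q → ℕ} {f : Fin q → List ℕ}
    (h : Enumerates n inp I φ k ρ ((List.finRange q).map g))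
    (hc : ∀ a, Emits n inp I c (k + 1) (Function.update ρ k (g a)) (f a)) :
    Emits n inp I (forCmd φ c) k ρ ((List.finRange q).flatMap f) := by
  -- Stated for any list of values, with `M` the labels still to be handled, so that the induction
  -- can follow the loop.
  have key (l : List ℕ) : ∀ (M : List (Fin q)) (L : List ℕ),
      l.filter (fun i => φ.Holds n inp (k + 1) (Function.update ρ k i) I) = M.map g →
      l.foldl (fun p i => (Cmd.ite φ c .nop).exec n inp (k + 1) (Function.update ρ k i) p) (I, L) =
        (I, L ++ M.flatMap f) := by
    induction l with
    | nil =>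
      intro M L hM
      obtain rfl : M = [] := by simpa using hM.symm
      simp
    | cons i l ih =>
      intro M L hM
      rw [List.foldl_cons, Cmd.exec]
      by_cases hi : φ.Holds n inp (k + 1) (Function.update ρ k i) I
      · rw [if_pos hi]
        rw [List.filter_cons_of_pos (by simpa using hi)] at hM
        rcases M with _ | ⟨a, M⟩
        · simp at hM
        · rw [List.map_cons, List.cons.injEq] at hM
          obtain ⟨rfl, hM⟩ := hM
          rw [hc, ih M _ hM, List.flatMap_cons, List.append_assoc]
      · rw [if_neg hi]
        rw [List.filter_cons_of_neg (by simpa using hi)] at hM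
        exact ih M L hM
  exact fun L => key _ _ L h

theorem filter_range_width {p : ℕ → Prop} {p' : Fin n → Prop} (h1 : ∀ i : Fin n, p i ↔ p' i)
    (h2 : ∀ i, p i → i < n) :
    (List.range (width n)).filter p = ((List.finRange n).filter p').map (fun i : Fin n => (i : ℕ)) := by
  have h3 : ((List.range (n * n)).map (n + ·)).filter p = [] := by
    rw [List.filter_eq_nil_iff]
    intro a ha h
    obtain ⟨b, -, rfl⟩ := List.mem_map.1 ha
    have := h2 _ (of_decide_eq_true h)
    omega
  rw [width, List.range_add, List.filter_append, h3, List.append_nil,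
    ← List.map_coe_finRange_eq_range, List.filter_map]
  congr 2
  funext i
  simp [h1]

theorem enumerates_real : Enumerates n inp I (.real k) k ρ
    ((List.finRange n).map (fun i : Fin n => (i : ℕ))) := by
  rw [Enumerates, filter_range_width (p' := fun _ => True)]
  · simp
  · simp [Fm.Holds]
  · simp [Fm.Holds]

theorem enumerates_not_real : Enumerates n inp I (.not (.real k)) k ρ
    ((List.finRange (n * n)).map (fun i : Fin (n * n) => n + (i : ℕ))) := by
  have h1 : (List.range n).filter
      (fun i => (Fm.not (.real k)).Holds n inp (k + 1) (Function.update ρ k i) I) = [] := by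
    rw [List.filter_eq_nil_iff]
    intro a ha
    simpa [Fm.Holds] using ha
  have h2 : ((List.range (n * n)).map (n + ·)).filter
      (fun i => (Fm.not (.real k)).Holds n inp (k + 1) (Function.update ρ k i) I) =
      (List.range (n * n)).map (n + ·) := by
    rw [List.filter_eq_self]
    intro a ha
    obtain ⟨b, -, rfl⟩ := List.mem_map.1 ha
    simp [Fm.Holds]
  rw [Enumerates, width, List.range_add, List.filter_append, h1, h2, List.nil_append,
    ← List.map_coe_finRange_eq_range, List.map_map]
  rfl

end RAM

/-! ### The printed list is the code of the strip-structure -/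

namespace Trigraph.Linkage

open RAM Classical

variable {n q : ℕ} {G : Trigraph (Fin n)} {s : Linkage (Fin n)} {inp : ℕ → Prop} {I : Interp}

/-- The least vertex of a part. -/
def Leads (s : Linkage (Fin n)) (v : Fin n) : Prop := ∀ w < v, ¬ s.same w v

/-- Every part of a linkage is represented by its least vertex. -/
theorem exists_rep (hs : s.Valid G) : ∃ (q : ℕ) (rep : Fin q → Fin n),
    (List.finRange n).filter s.Leads = (List.finRange q).map rep ∧
      (∀ v, ∃ F, s.same (rep F) v) ∧ ∀ F F', s.same (rep F) (rep F') → F = F' := by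
  set l := (List.finRange n).filter s.Leads with hl
  have hmem {v : Fin n} : v ∈ l ↔ ∀ w < v, ¬ s.same w v := by
    simp only [hl, List.mem_filter, List.mem_finRange, true_and, decide_eq_true_eq]
    rfl
  have hnd : l.Nodup := (List.nodup_finRange n).filter _
  refine ⟨l.length, l.get, ?_, fun v => ?_, fun F F' h => ?_⟩
  · rw [List.map_get_finRange]
  · obtain ⟨m, hm, hmin⟩ := (wellFounded_lt (α := Fin n)).has_min {w | s.same w v}
      ⟨v, hs.equiv.refl v⟩
    have : m ∈ l := hmem.2 fun w hw hwm => hmin w (hs.equiv.trans hwm hm) hw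
    obtain ⟨F, hF⟩ := List.mem_iff_get.1 this
    exact ⟨F, by rwa [hF]⟩
  · refine List.nodup_iff_injective_get.1 hnd ?_
    rcases lt_trichotomy (l.get F) (l.get F') with h1 | h1 | h1
    · exact absurd h (hmem.1 (List.get_mem l F') _ h1)
    · exact h1
    · exact absurd (hs.equiv.symm h) (hmem.1 (List.get_mem l F) _ h1)

theorem enumerates_repFm (hI : Represents G s I) {ρ : ℕ → ℕ} {rep : Fin q → Fin n}
    (hrep : (List.finRange n).filter s.Leads =
      (List.finRange q).map rep) :
    Enumerates n inp I repFm 0 ρ ((List.finRange q).map fun F => (rep F : ℕ)) := by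
  rw [Enumerates, filter_range_width (p' := s.Leads), hrep, List.map_map]
  · rfl
  · intro v
    have h1 := hI.same
    simp only [repFm, Fm.Holds, Function.update_apply, exists_lt_width]
    simp only [Nat.reduceAdd, Nat.reduceEqDiff, zero_ne_one, if_true, if_false, v.2, true_and]
    have h2 (y : Fin n ⊕ Fin n × Fin n) : I 1 (num y) v ↔ ∃ w, y = .inl w ∧ s.same w v := by
      refine (h1 y (.inl v)).trans ?_
      simp
    simp only [h2]
    constructor
    · exact fun h w hw hwv => h ⟨.inl w, hw, w, rfl, hwv⟩
    · rintro h ⟨_, hw, w, rfl, hwv⟩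
      exact h w hw hwv
  · intro i hi
    simpa [Fm.Holds, repFm] using hi.1

theorem emits_emitCmd (hI : Represents G s I) (hs : s.Valid G) (ρ : ℕ → ℕ) {rep : Fin q → Fin n}
    (h : (List.finRange n).filter s.Leads = (List.finRange q).map rep)
    (hrep : ∀ v, ∃ F, s.same (rep F) v) (hinj : ∀ F F', s.same (rep F) (rep F') → F = F')
    (hq : Nonempty (Fin q)) : Emits n inp I emitCmd 0 ρ
      (toStrip hs finProdFinEquiv.symm rep hrep hinj hq).code := by
  have hr := enumerates_repFm (inp := inp) (ρ := ρ) hI h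
  -- `finProdFinEquiv` numbers pairs row by row, as `num` does after the shift by `n`; so the
  -- terminals are printed in the order of `Fin (n * n)`.
  have hnum (a : Fin (n * n)) : num (.inr (finProdFinEquiv.symm a)) = n + (a : ℕ) := by
    obtain ⟨⟨x, y⟩, rfl⟩ := finProdFinEquiv.surjective a
    rw [Equiv.symm_apply_apply]
    simp only [num, finProdFinEquiv_apply_val]
    omega
  have hsame (u v : Fin n) : I 1 u v ↔ s.same u v := by
    refine (hI.same (.inl u) (.inl v)).trans ?_
    simp
  have hadj (a : Fin (n * n)) (v : Fin n) : I 0 v (n + a) ↔ v ∈ s.K (finProdFinEquiv.symm a) := by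
    rw [← hnum]
    exact (hI.adj (.inl v) _).trans (big_sAdj_inl_inr s)
  have e1 := (enumerates_not_real (n := n) (inp := inp) (I := I) (k := 0) (ρ := ρ)).emits_count
  have e2 := hr.emits_count
  have e3 := hr.emits_forCmd fun F => (enumerates_not_real (k := 1)).emits_forCmd fun a =>
    emits_emit (φ := .ex (.and (.rel 1 0 2) (.rel 0 2 1)))
  have e4 := hr.emits_forCmd fun F => (enumerates_real (k := 1)).emits_forCmd fun a =>
    emits_emit (φ := .rel 1 0 1)
  have e5 := hr.emits_forCmd fun F => (enumerates_not_real (k := 1)).emits_forCmd fun a =>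
    (enumerates_real (k := 2)).emits_forCmd fun v => emits_emit (φ := .and (.rel 1 0 2) (.rel 0 2 1))
  have e := e1.seq (e2.seq (e3.seq (e4.seq e5)))
  have b1 (F : Fin q) (a : Fin (n * n)) : (Fm.ex (.and (.rel 1 0 2) (.rel 0 2 1))).Holds n inp 2
      (Function.update (Function.update ρ 0 (rep F)) 1 (n + a)) I ↔
        ∃ v, s.same (rep F) v ∧ v ∈ s.K (finProdFinEquiv.symm a) := by
    simp only [Fm.Holds, exists_lt_width, Function.update_apply]
    simp only [Nat.reduceEqDiff, if_true, if_false, zero_ne_one]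
    constructor
    · rintro ⟨y, h1, h2⟩
      obtain ⟨u, v, h3, rfl, -⟩ := (hI.same (.inl (rep F)) y).1 h1
      exact ⟨v, (hsame _ _).1 h1, (hadj _ _).1 h2⟩
    · rintro ⟨v, h1, h2⟩
      exact ⟨.inl v, (hsame _ _).2 h1, (hadj _ _).2 h2⟩
  have b2 (F : Fin q) (v : Fin n) : (Fm.rel 1 0 1).Holds n inp 2
      (Function.update (Function.update ρ 0 (rep F)) 1 v) I ↔ s.same (rep F) v := by
    simpa [Fm.Holds] using hsame (rep F) v
  have b3 (F : Fin q) (a : Fin (n * n)) (v : Fin n) :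
      (Fm.and (.rel 1 0 2) (.rel 0 2 1)).Holds n inp 3 (Function.update (Function.update
        (Function.update ρ 0 (rep F)) 1 (n + a)) 2 v) I ↔
          s.same (rep F) v ∧ v ∈ s.K (finProdFinEquiv.symm a) := by
    simpa [Fm.Holds] using and_congr (hsame (rep F) v) (hadj a v)
  simp only [b1, b2, b3] at e
  simp only [List.length_map, List.length_finRange] at e
  simp only [StripStructure.code, List.map_eq_flatMap, List.append_assoc]
  exact e

end Trigraph.Linkage

/-! ### Existence and algorithm combined -/

theorem mainTheorem6 :
    (∀ (V : Type*) [Finite V] [Nonempty V] (G : Trigraph V), G.ClawFree →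
      ∃ (p q : ℕ) (S : StripStructure G (Fin p) (Fin q)),
        S.Purified ∧ S.nullity = 0 ∧ S.StripsAreBasic) ∧
    (∃ (P : RAM.Prog) (B : Polynomial ℕ), ∀ (n : ℕ) (G : SimpleGraph (Fin n)), 0 < n →
      (Trigraph.ofGraph G).ClawFree →
      ∃ (p q : ℕ) (S : StripStructure (Trigraph.ofGraph G) (Fin p) (Fin q)),
        S.Purified ∧ S.nullity = 0 ∧ S.StripsAreBasic ∧
        RAM.Computes P G.code S.code (B.eval n)) := by
  refine ⟨fun V _ _ G hG => Trigraph.exists_stripStructure hG, ?_⟩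
  obtain ⟨P, B, hP⟩ := RAM.Cmd.exists_computes RAM.mainCmd RAM.mainCmd_closedAt
  refine ⟨P, B, fun n G hn hG => ?_⟩
  have hrun := hP n G.code G.code_getD_le G.code_getD_zero
  obtain ⟨I₁, e1, h1⟩ := Trigraph.exec_initCmd G (fun _ => 0) (fun _ _ _ => False) []
  obtain ⟨I₂, s, e2, h2, hs, hst⟩ := Trigraph.Linkage.exec_loop_sweepCmd
    (inp := fun i => G.code.getD i 0 ≠ 0) (ρ := fun _ => 0) hG (Trigraph.not_semi_ofGraph G) hn []
    h1 Trigraph.Linkage.trivial_valid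
  obtain ⟨q, rep, h3, hrep, hinj⟩ := Trigraph.Linkage.exists_rep hs
  have hq : Nonempty (Fin q) := (hrep ⟨0, hn⟩).nonempty
  refine ⟨_, _, Trigraph.Linkage.toStrip hs finProdFinEquiv.symm rep hrep hinj hq,
    Trigraph.Linkage.toStrip_purified hs _ rep hrep hinj hq,
    Trigraph.Linkage.toStrip_nullity hs _ rep hrep hinj hq,
    Trigraph.Linkage.toStrip_stripsAreBasic hs _ rep hrep hinj hq hG hst, ?_⟩
  have e3 := Trigraph.Linkage.emits_emitCmd (inp := fun i => G.code.getD i 0 ≠ 0) h2 hs (fun _ => 0)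
    h3 hrep hinj hq []
  rw [RAM.mainCmd, RAM.Cmd.exec, RAM.Cmd.exec, e1, e2, e3] at hrun
  exact hrun
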